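/- Let $k$ be a field. A *finite category* over $k$ is a $k$-linear category that is $k$-linearly equivalent to the category of finite-dimensional right modules over some finite-dimensional $k$-algebra. A *multi-tensor category* over $k$ is a monoidal category $\mathcal C$ whose underlying category is a finite category over $k$, whose tensor product is $k$-bilinear and right exact in each variable, and in which every object has a left dual and a right dual. It is *indecomposable* if it is neither zero nor (as a $k$-linear monoidal category) a direct sum of two nonzero multi-tensor categories. For an object $a$, write $a^R$ for its right dual, i.e. an object with maps $\mathbf 1\to a^R\otimes a$ and $a\otimes a^R\to\mathbf 1$ satisfying the two triangle identities. For a monoidal category $\mathcal B$, a right $\mathcal B$-module $\mathcal M$ and a left $\mathcal B$-module $\mathcal N$, all having finite colimits, with tensor product and actions preserving finite colimits in each variable, a *balanced functor* $F:\mathcal M\times\mathcal N\to\mathcal D$ is a functor preserving finite colimits separately in each variable, together with a natural isomorphism $F(x\odot b,y)\simeq F(x,b\odot y)$ compatible with the unit and the associativity constraints. The *tensor product* $\mathcal M\boxtimes_{\mathcal B}\mathcal N$ is a category with finite colimits, equipped with a balanced functor from $\mathcal M\times\mathcal N$, such that for every category $\mathcal D$ with finite colimits composition induces an equivalence from the category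 of finite-colimit-preserving functors $\mathcal M\boxtimes_{\mathcal B}\mathcal N\to\mathcal D$ to the category of balanced functors $\mathcal M\times\mathcal N\to\mathcal D$. If $\mathcal M$ is an $\mathcal A$-$\mathcal B$-bimodule and $\mathcal N$ a $\mathcal B$-$\mathcal B'$-bimodule, then $\mathcal M\boxtimes_{\mathcal B}\mathcal N$ carries the induced $\mathcal A$-$\mathcal B'$-bimodule structure. An $\mathcal A$-$\mathcal B$-bimodule $\mathcal M$ is *invertible* if there is a $\mathcal B$-$\mathcal A$-bimodule $\mathcal N$ with $\mathcal M\boxtimes_{\mathcal B}\mathcal N\simeq\mathcal A$ as $\mathcal A$-$\mathcal A$-bimodules and $\mathcal N\boxtimes_{\mathcal A}\mathcal M\simeq\mathcal B$ as $\mathcal B$-$\mathcal B$-bimodules. $\mathfrak Z(-)$ denotes the Drinfeld center. **Theorem.** Let $\mathcal C$ be a multi-tensor category over $k$. 1. The unit object $\mathbf 1$ is semisimple, i.e. a finite direct sum of simple objects. If $\mathbf 1=\bigoplus_{i\in\Lambda}e_i$ with $\Lambda$ finite and every $e_i$ simple, then $e_i\otimes e_i\simeq e_i\simeq e_i^R$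 for all $i$, and $e_i\otimes e_j\simeq 0$ for $i\ne j$. Fix such a decomposition. Let $\mathcal C_{ij}=e_i\otimes\mathcal C\otimes e_j$ be the full subcategory of $\mathcal C$ of objects isomorphic to $e_i\otimes X\otimes e_j$ for some $X\in\mathcal C$. The tensor product of $\mathcal C$ makes $\mathcal C_{ii}$ a monoidal category with unit $e_i$ and $\mathcal C_{ij}$ a $\mathcal C_{ii}$-$\mathcal C_{jj}$-bimodule. 2. The functor $X\mapsto(e_i\otimes X\otimes e_j)_{i,j}$ is a $k$-linear equivalence $\mathcal C\simeq\bigoplus_{i,j\in\Lambda}\mathcal C_{ij}$, and $\mathcal C_{ij}\otimes\mathcal C_{jl}\subset\mathcal C_{il}$ for all $i,j,l\in\Lambda$. Suppose in addition that $\mathcal C$ is indecomposable. Then: 3. $\mathcal C_{ij}\not\simeq0$ for all $i,j\in\Lambda$. 4. For all $i,j,l\in\Lambda$, the tensor product of $\mathcal C$ induces an equivalence $\mathcal C_{ij}\boxtimes_{\mathcal C_{jj}}\mathcal C_{jl}\simeq\mathcal C_{il}$ of $\mathcal C_{ii}$-$\mathcal C_{ll}$-bimodules. 5. For all $i,j\in\Lambda$,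 $\mathcal C_{ij}$ is an invertible $\mathcal C_{ii}$-$\mathcal C_{jj}$-bimodule. 6. For each $i\in\Lambda$, $\bigoplus_{j\in\Lambda}\mathcal C_{ij}$, identified with the full subcategory $e_i\otimes\mathcal C$ of $\mathcal C$ by $X\mapsto(X\otimes e_j)_j$, is an invertible $\mathcal C_{ii}$-$\mathcal C$-bimodule. 7. For each $i\in\Lambda$, there is a canonical braided monoidal equivalence $\mathfrak Z(\mathcal C)\simeq\mathfrak Z(\mathcal C_{ii})$: it intertwines, by a monoidal isomorphism of bimodule functors, the right action of $\mathfrak Z(\mathcal C)$ and the left action of $\mathfrak Z(\mathcal C_{ii})$ on the bimodule $\bigoplus_{j\in\Lambda}\mathcal C_{ij}$. -/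

import Mathlib

open CategoryTheory CategoryTheory.Limits CategoryTheory.MonoidalCategory
open scoped CategoryTheory.MonoidalCategory.MonoidalLeftAction
open scoped CategoryTheory.MonoidalCategory.MonoidalRightAction

universe w u v u' v' u₁ v₁ u₂ v₂ u₃ v₃ u₄ v₄ u₅ v₅ u₆ v₆

/-! ### Multi-tensor categories -/

section MultiTensor

open scoped ModuleCat

/-- A finite category over `k`: a `k`-linear category which is `k`-linearly equivalent to the
category of finite-dimensional right modules over a finite-dimensional `k`-algebra `A`. -/
def IsFiniteCategory (k : Type w) [Field k] (C : Type u) [Category.{v} C] [Preadditive C]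
    [Linear k C] : Prop :=
  ∃ (A : Type w) (_ : Ring A) (_ : Algebra k A) (_ : Module.Finite k A)
    (F : C ⥤ FGModuleCat.{w} Aᵐᵒᵖ), F.IsEquivalence ∧ F.Additive ∧ F.Linear k

/-- A multi-tensor category over `k`: a monoidal category whose underlying category is a finite
category over `k`, whose tensor product is `k`-bilinear and right exact in each variable, and in
which every object has duals on both sides. -/
class IsMultiTensorCategory (k : Type w) [Field k] (C : Type u) [Category.{v} C] [Preadditive C]
    [Linear k C] [MonoidalCategory C] : Prop
    extends MonoidalPreadditive C, MonoidalLinear k C where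
  finite : IsFiniteCategory k C
  rightExact_tensorLeft (X : C) : PreservesFiniteColimits (tensorLeft X)
  rightExact_tensorRight (X : C) : PreservesFiniteColimits (tensorRight X)
  rigid : Nonempty (RigidCategory C)

/-- A category (with zero morphisms) is nonzero if it has a nonzero object. -/
def IsNonzeroCategory (C : Type u) [Category.{v} C] : Prop := ∃ X : C, ¬ IsZero X

/-- `C` is, as a `k`-linear monoidal category, the direct sum of `D₁` and `D₂`: there is a
`k`-linear monoidal equivalence from `C` to the product category with its componentwise
structure, given by its two components. -/
def IsDirectSum (k : Type w) [Field k]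
    (C : Type u) [Category.{v} C] [Preadditive C] [Linear k C] [MonoidalCategory C]
    (D₁ : Type u₁) [Category.{v₁} D₁] [Preadditive D₁] [Linear k D₁] [MonoidalCategory D₁]
    (D₂ : Type u₂) [Category.{v₂} D₂] [Preadditive D₂] [Linear k D₂] [MonoidalCategory D₂] :
    Prop :=
  ∃ (F₁ : C ⥤ D₁) (F₂ : C ⥤ D₂) (_ : F₁.Monoidal) (_ : F₂.Monoidal),
    F₁.Additive ∧ F₁.Linear k ∧ F₂.Additive ∧ F₂.Linear k ∧ (F₁.prod' F₂).IsEquivalence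

/-- A multi-tensor category is indecomposable if it is neither zero nor the direct sum of two
nonzero multi-tensor categories. -/
def IsIndecomposableMultiTensor (k : Type w) [Field k] (C : Type u) [Category.{v} C]
    [Preadditive C] [Linear k C] [MonoidalCategory C] : Prop :=
  IsNonzeroCategory C ∧
    ∀ (D₁ : Type u) [Category.{v} D₁] [Preadditive D₁] [Linear k D₁] [MonoidalCategory D₁]
      [IsMultiTensorCategory k D₁]
      (D₂ : Type u) [Category.{v} D₂] [Preadditive D₂] [Linear k D₂] [MonoidalCategory D₂]
      [IsMultiTensorCategory k D₂],
      IsNonzeroCategory D₁ → IsNonzeroCategory D₂ → ¬ IsDirectSum k C D₁ D₂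

end MultiTensor

/-! ### Bimodule categories -/

/-- A `C`-`D`-bimodule category: a category with a left action of `C`, a right action of `D`, and
a coherent natural isomorphism `(c ⊙ m) ⊙ d ≅ c ⊙ (m ⊙ d)`. -/
class BimoduleCategory (C : Type u₁) [Category.{v₁} C] [MonoidalCategory C]
    (D : Type u₂) [Category.{v₂} D] [MonoidalCategory D] (M : Type u₃) [Category.{v₃} M]
    [MonoidalLeftAction C M] [MonoidalRightAction D M] where
  middle (c : C) (m : M) (d : D) : (c ⊙ₗ m) ⊙ᵣ d ≅ c ⊙ₗ (m ⊙ᵣ d)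
  middle_naturality {c c' : C} {m m' : M} {d d' : D} (f : c ⟶ c') (g : m ⟶ m') (h : d ⟶ d') :
    ((f ⊙ₗₘ g) ⊙ᵣₘ h) ≫ (middle c' m' d').hom = (middle c m d).hom ≫ (f ⊙ₗₘ (g ⊙ᵣₘ h))
  middle_tensor_left (c c' : C) (m : M) (d : D) :
    (middle (c ⊗ c') m d).hom ≫ (αₗ c c' (m ⊙ᵣ d)).hom =
      (αₗ c c' m).hom ⊵ᵣ d ≫ (middle c (c' ⊙ₗ m) d).hom ≫ c ⊴ₗ (middle c' m d).hom
  middle_tensor_right (c : C) (m : M) (d d' : D) :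
    (middle c m (d ⊗ d')).hom ≫ c ⊴ₗ (αᵣ m d d').hom =
      (αᵣ (c ⊙ₗ m) d d').hom ≫ (middle c m d).hom ⊵ᵣ d' ≫ (middle c (m ⊙ᵣ d) d').hom
  middle_unit_left (m : M) (d : D) :
    (middle (𝟙_ C) m d).hom ≫ (λₗ (m ⊙ᵣ d)).hom = (λₗ m).hom ⊵ᵣ d
  middle_unit_right (c : C) (m : M) :
    (middle c m (𝟙_ D)).hom ≫ c ⊴ₗ (ρᵣ m).hom = (ρᵣ (c ⊙ₗ m)).hom

/-- The regular bimodule: a monoidal category acting on itself on both sides. -/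
instance regularBimodule (C : Type u₁) [Category.{v₁} C] [MonoidalCategory C] :
    BimoduleCategory C C C where
  middle c m d := α_ c m d
  middle_naturality f g h := by
    change ((f ⊗ₘ g) ⊗ₘ h) ≫ _ = _ ≫ (f ⊗ₘ (g ⊗ₘ h))
    simp
  middle_tensor_left c c' m d := by
    change (α_ (c ⊗ c') m d).hom ≫ (α_ c c' (m ⊗ d)).hom =
      (α_ c c' m).hom ▷ d ≫ (α_ c (c' ⊗ m) d).hom ≫ c ◁ (α_ c' m d).hom
    simp
  middle_tensor_right c m d d' := by
    change (α_ c m (d ⊗ d')).hom ≫ c ◁ (α_ m d d').inv =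
      (α_ (c ⊗ m) d d').inv ≫ (α_ c m d).hom ▷ d' ≫ (α_ c (m ⊗ d) d').hom
    simp
  middle_unit_left m d := by
    change (α_ (𝟙_ C) m d).hom ≫ (λ_ (m ⊗ d)).hom = (λ_ m).hom ▷ d
    simp
  middle_unit_right c m := by
    change (α_ c m (𝟙_ C)).hom ≫ c ◁ (ρ_ m).hom = (ρ_ (c ⊗ m)).hom
    simp

/-! ### Tensor products of module categories -/

/-- A balanced `C`-module functor `M × N ⥤ D` (in curried form): a functor preserving finite
colimits separately in each variable, with a coherent natural isomorphism
`F (x ⊙ c, y) ≅ F (x, c ⊙ y)`. -/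
structure BalancedFunctor (C : Type u₁) [Category.{v₁} C] [MonoidalCategory C]
    (M : Type u₂) [Category.{v₂} M] [MonoidalRightAction C M]
    (N : Type u₃) [Category.{v₃} N] [MonoidalLeftAction C N]
    (D : Type u₄) [Category.{v₄} D] where
  functor : M ⥤ N ⥤ D
  rightExact_left (y : N) : PreservesFiniteColimits (functor.flip.obj y)
  rightExact_right (x : M) : PreservesFiniteColimits (functor.obj x)
  balance (x : M) (c : C) (y : N) :
    (functor.obj (x ⊙ᵣ c)).obj y ≅ (functor.obj x).obj (c ⊙ₗ y)
  balance_naturality_left {x x' : M} (f : x ⟶ x') (c : C) (y : N) :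
    (functor.map (f ⊵ᵣ c)).app y ≫ (balance x' c y).hom =
      (balance x c y).hom ≫ (functor.map f).app (c ⊙ₗ y)
  balance_naturality_middle (x : M) {c c' : C} (g : c ⟶ c') (y : N) :
    (functor.map (x ⊴ᵣ g)).app y ≫ (balance x c' y).hom =
      (balance x c y).hom ≫ (functor.obj x).map (g ⊵ₗ y)
  balance_naturality_right (x : M) (c : C) {y y' : N} (h : y ⟶ y') :
    (functor.obj (x ⊙ᵣ c)).map h ≫ (balance x c y').hom =
      (balance x c y).hom ≫ (functor.obj x).map (c ⊴ₗ h)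
  balance_unit (x : M) (y : N) :
    (balance x (𝟙_ C) y).hom ≫ (functor.obj x).map (λₗ y).hom =
      (functor.map (ρᵣ x).hom).app y
  balance_tensor (x : M) (a b : C) (y : N) :
    (balance x (a ⊗ b) y).hom ≫ (functor.obj x).map (αₗ a b y).hom =
      (functor.map (αᵣ x a b).hom).app y ≫ (balance (x ⊙ᵣ a) b y).hom ≫
        (balance x a (b ⊙ₗ y)).hom

namespace BalancedFunctor

section

variable {C : Type u₁} [Category.{v₁} C] [MonoidalCategory C]
  {M : Type u₂} [Category.{v₂} M] [MonoidalRightAction C M]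
  {N : Type u₃} [Category.{v₃} N] [MonoidalLeftAction C N]
  {D : Type u₄} [Category.{v₄} D]

/-- A morphism of balanced functors: a natural transformation compatible with the balancings. -/
@[ext]
structure Hom (F G : BalancedFunctor C M N D) where
  nat : F.functor ⟶ G.functor
  comm (x : M) (c : C) (y : N) :
    (F.balance x c y).hom ≫ (nat.app x).app (c ⊙ₗ y) =
      (nat.app (x ⊙ᵣ c)).app y ≫ (G.balance x c y).hom

/-- The category of balanced functors. -/
instance : Category (BalancedFunctor C M N D) where
  Hom F G := Hom F G
  id F := { nat := 𝟙 _, comm := by simp }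
  comp {F G H} f g :=
    { nat := f.nat ≫ g.nat
      comm := fun x c y => by
        simp only [NatTrans.comp_app, Category.assoc]
        rw [← g.comm, ← Category.assoc, f.comm, Category.assoc] }
  id_comp f := Hom.ext (Category.id_comp f.nat)
  comp_id f := Hom.ext (Category.comp_id f.nat)
  assoc f g h := Hom.ext (Category.assoc f.nat g.nat h.nat)

variable {T : Type u₅} [Category.{v₅} T]

/-- The composite of a balanced functor `M × N ⥤ T` with a functor `T ⥤ D` which preserves
finite colimits. -/
def compObj (B : BalancedFunctor C M N T) (G : T ⥤ᵣ D) : BalancedFunctor C M N D where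
  functor := B.functor ⋙ (Functor.whiskeringRight N T D).obj G.obj
  rightExact_left y := by
    have := B.rightExact_left y
    have : PreservesFiniteColimits G.obj := G.property
    exact inferInstanceAs (PreservesFiniteColimits (B.functor.flip.obj y ⋙ G.obj))
  rightExact_right x := by
    have := B.rightExact_right x
    have : PreservesFiniteColimits G.obj := G.property
    exact inferInstanceAs (PreservesFiniteColimits (B.functor.obj x ⋙ G.obj))
  balance x c y := G.obj.mapIso (B.balance x c y)
  balance_naturality_left f c y := by
    simpa using congrArg G.obj.map (B.balance_naturality_left f c y)
  balance_naturality_middle x _ _ g y := by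
    simpa using congrArg G.obj.map (B.balance_naturality_middle x g y)
  balance_naturality_right x c _ _ h := by
    simpa using congrArg G.obj.map (B.balance_naturality_right x c h)
  balance_unit x y := by
    simpa using congrArg G.obj.map (B.balance_unit x y)
  balance_tensor x a b y := by
    simpa using congrArg G.obj.map (B.balance_tensor x a b y)

/-- Composition with a balanced functor `M × N ⥤ T`, as a functor from the category of finite
colimit preserving functors `T ⥤ D` to the category of balanced functors `M × N ⥤ D`. -/
def compFunctor (B : BalancedFunctor C M N T) (D : Type u₄) [Category.{v₄} D] :
    (T ⥤ᵣ D) ⥤ BalancedFunctor C M N D where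
  obj G := B.compObj G
  map {G H} f :=
    { nat := Functor.whiskerLeft B.functor ((Functor.whiskeringRight N T D).map f.hom)
      comm := fun x c y => f.hom.naturality (B.balance x c y).hom }
  map_id _ := Hom.ext (by ext; simp [CategoryStruct.id]; rfl)
  map_comp _ _ := Hom.ext (by ext; simp [CategoryStruct.comp]; rfl)

/-- The balanced functor `B : M × N ⥤ T` exhibits `T` as the tensor product `M ⊠_C N`. The first
fields are the conditions on `C`, `M`, `N` under which the tensor product is defined; the last
one is the universal property. -/
structure IsTensorProduct (B : BalancedFunctor C M N T) : Prop where
  hasFiniteColimits_base : HasFiniteColimits C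
  hasFiniteColimits_left : HasFiniteColimits M
  hasFiniteColimits_right : HasFiniteColimits N
  rightExact_tensorLeft (c : C) : PreservesFiniteColimits (tensorLeft c)
  rightExact_tensorRight (c : C) : PreservesFiniteColimits (tensorRight c)
  rightExact_rightAction (x : M) :
    PreservesFiniteColimits ((MonoidalRightAction.curriedAction C M).flip.obj x)
  rightExact_rightAction' (c : C) :
    PreservesFiniteColimits ((MonoidalRightAction.curriedAction C M).obj c)
  rightExact_leftAction (c : C) :
    PreservesFiniteColimits ((MonoidalLeftAction.curriedAction C N).obj c)
  rightExact_leftAction' (y : N) :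
    PreservesFiniteColimits ((MonoidalLeftAction.curriedAction C N).flip.obj y)
  hasFiniteColimits : HasFiniteColimits T
  isEquivalence (D : Type u') [Category.{v'} D] [HasFiniteColimits D] :
    (B.compFunctor D).IsEquivalence

end

end BalancedFunctor

/-- A balanced bimodule functor `M × N ⥤ T`, for an `A`-`B`-bimodule `M`, a `B`-`C`-bimodule `N`
and an `A`-`C`-bimodule `T`: a balanced `B`-module functor with coherent natural isomorphisms
`F (a ⊙ x, y) ≅ a ⊙ F (x, y)` and `F (x, y ⊙ c) ≅ F (x, y) ⊙ c`, compatible with each other and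
with the balancing. -/
structure BalancedBimoduleFunctor
    (A : Type u₁) [Category.{v₁} A] [MonoidalCategory A]
    (B : Type u₂) [Category.{v₂} B] [MonoidalCategory B]
    (C : Type u₃) [Category.{v₃} C] [MonoidalCategory C]
    (M : Type u₄) [Category.{v₄} M] [MonoidalLeftAction A M] [MonoidalRightAction B M]
    [BimoduleCategory A B M]
    (N : Type u₅) [Category.{v₅} N] [MonoidalLeftAction B N] [MonoidalRightAction C N]
    [BimoduleCategory B C N]
    (T : Type u₆) [Category.{v₆} T] [MonoidalLeftAction A T] [MonoidalRightAction C T]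
    [BimoduleCategory A C T]
    extends BalancedFunctor B M N T where
  left (a : A) (x : M) (y : N) : (functor.obj (a ⊙ₗ x)).obj y ≅ a ⊙ₗ (functor.obj x).obj y
  left_naturality {a a' : A} {x x' : M} {y y' : N} (f : a ⟶ a') (g : x ⟶ x') (h : y ⟶ y') :
    (functor.map (f ⊙ₗₘ g)).app y ≫ (functor.obj (a' ⊙ₗ x')).map h ≫ (left a' x' y').hom =
      (left a x y).hom ≫ (f ⊙ₗₘ ((functor.map g).app y ≫ (functor.obj x').map h))
  left_tensor (a a' : A) (x : M) (y : N) :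
    (left (a ⊗ a') x y).hom ≫ (αₗ a a' ((functor.obj x).obj y)).hom =
      (functor.map (αₗ a a' x).hom).app y ≫ (left a (a' ⊙ₗ x) y).hom ≫
        a ⊴ₗ (left a' x y).hom
  left_unit (x : M) (y : N) :
    (left (𝟙_ A) x y).hom ≫ (λₗ ((functor.obj x).obj y)).hom = (functor.map (λₗ x).hom).app y
  right (x : M) (y : N) (c : C) : (functor.obj x).obj (y ⊙ᵣ c) ≅ (functor.obj x).obj y ⊙ᵣ c
  right_naturality {x x' : M} {y y' : N} {c c' : C} (g : x ⟶ x') (h : y ⟶ y') (f : c ⟶ c') :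
    (functor.map g).app (y ⊙ᵣ c) ≫ (functor.obj x').map (h ⊙ᵣₘ f) ≫ (right x' y' c').hom =
      (right x y c).hom ≫ (((functor.map g).app y ≫ (functor.obj x').map h) ⊙ᵣₘ f)
  right_tensor (x : M) (y : N) (c c' : C) :
    (right x y (c ⊗ c')).hom ≫ (αᵣ ((functor.obj x).obj y) c c').hom =
      (functor.obj x).map (αᵣ y c c').hom ≫ (right x (y ⊙ᵣ c) c').hom ≫
        (right x y c).hom ⊵ᵣ c'
  right_unit (x : M) (y : N) :
    (right x y (𝟙_ C)).hom ≫ (ρᵣ ((functor.obj x).obj y)).hom = (functor.obj x).map (ρᵣ y).hom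
  left_right (a : A) (x : M) (y : N) (c : C) :
    (right (a ⊙ₗ x) y c).hom ≫ (left a x y).hom ⊵ᵣ c ≫
        (BimoduleCategory.middle a ((functor.obj x).obj y) c).hom =
      (left a x (y ⊙ᵣ c)).hom ≫ a ⊴ₗ (right x y c).hom
  left_balance (a : A) (x : M) (b : B) (y : N) :
    (balance (a ⊙ₗ x) b y).hom ≫ (left a x (b ⊙ₗ y)).hom =
      (functor.map (BimoduleCategory.middle a x b).hom).app y ≫ (left a (x ⊙ᵣ b) y).hom ≫
        a ⊴ₗ (balance x b y).hom
  right_balance (x : M) (b : B) (y : N) (c : C) :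
    (right (x ⊙ᵣ b) y c).hom ≫ (balance x b y).hom ⊵ᵣ c =
      (balance x b (y ⊙ᵣ c)).hom ≫
        (functor.obj x).map (BimoduleCategory.middle b y c).inv ≫ (right x (b ⊙ₗ y) c).hom

/-- A balanced bimodule functor which exhibits `T` as the tensor product `M ⊠_B N`. Since the
actions on `M ⊠_B N` are the ones induced from those on `M` and `N`, this says that
`M ⊠_B N ≃ T` as `A`-`C`-bimodules. -/
def BalancedBimoduleFunctor.IsTensorProduct
    {A : Type u₁} [Category.{v₁} A] [MonoidalCategory A]
    {B : Type u₂} [Category.{v₂} B] [MonoidalCategory B]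
    {C : Type u₃} [Category.{v₃} C] [MonoidalCategory C]
    {M : Type u₄} [Category.{v₄} M] [MonoidalLeftAction A M] [MonoidalRightAction B M]
    [BimoduleCategory A B M]
    {N : Type u₅} [Category.{v₅} N] [MonoidalLeftAction B N] [MonoidalRightAction C N]
    [BimoduleCategory B C N]
    {T : Type u₆} [Category.{v₆} T] [MonoidalLeftAction A T] [MonoidalRightAction C T]
    [BimoduleCategory A C T] (F : BalancedBimoduleFunctor A B C M N T) : Prop :=
  BalancedFunctor.IsTensorProduct.{u', v'} F.toBalancedFunctor

/-- A `C`-`D`-bimodule `M` is invertible if there is a `D`-`C`-bimodule `N` with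
`M ⊠_D N ≃ C` as `C`-`C`-bimodules and `N ⊠_C M ≃ D` as `D`-`D`-bimodules. -/
def IsInvertibleBimodule (C : Type u₁) [Category.{v₁} C] [MonoidalCategory C]
    (D : Type u₂) [Category.{v₂} D] [MonoidalCategory D]
    (M : Type u₃) [Category.{v₃} M] [MonoidalLeftAction C M] [MonoidalRightAction D M]
    [BimoduleCategory C D M] : Prop :=
  ∃ (N : Type u₃) (_ : Category.{v₃} N) (_ : MonoidalLeftAction D N)
    (_ : MonoidalRightAction C N) (_ : BimoduleCategory D C N),
    (∃ F : BalancedBimoduleFunctor C D C M N C,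
      BalancedBimoduleFunctor.IsTensorProduct.{u', v'} F) ∧
    (∃ G : BalancedBimoduleFunctor D C D N M D,
      BalancedBimoduleFunctor.IsTensorProduct.{u', v'} G)

/-- For a `C`-`D`-bimodule `M` and a monoidal functor `F` between the centers, the data of a
monoidal isomorphism between the two actions of `Z(D)` on `M` by bimodule functors: `Z` acting
through its image `F Z` in `Z(C)` from the left, and `Z` acting from the right. The half braidings
of `F Z` and of `Z` are the bimodule functor structures on `F Z ⊙ -` and `- ⊙ Z`. -/
structure CenterIntertwiner {C : Type u₁} [Category.{v₁} C] [MonoidalCategory C]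
    {D : Type u₂} [Category.{v₂} D] [MonoidalCategory D]
    (M : Type u₃) [Category.{v₃} M] [MonoidalLeftAction C M] [MonoidalRightAction D M]
    [BimoduleCategory C D M] (F : Center D ⥤ Center C) [F.Monoidal] where
  iso (Z : Center D) (x : M) : (F.obj Z).1 ⊙ₗ x ≅ x ⊙ᵣ Z.1
  naturality (Z : Center D) {x y : M} (f : x ⟶ y) :
    (F.obj Z).1 ⊴ₗ f ≫ (iso Z y).hom = (iso Z x).hom ≫ f ⊵ᵣ Z.1
  naturality_center {Z Z' : Center D} (g : Z ⟶ Z') (x : M) :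
    (F.map g).f ⊵ₗ x ≫ (iso Z' x).hom = (iso Z x).hom ≫ x ⊴ᵣ g.f
  left (Z : Center D) (c : C) (x : M) :
    (αₗ (F.obj Z).1 c x).hom ≫ (iso Z (c ⊙ₗ x)).hom ≫ (BimoduleCategory.middle c x Z.1).hom =
      ((F.obj Z).2.β c).hom ⊵ₗ x ≫ (αₗ c (F.obj Z).1 x).hom ≫ c ⊴ₗ (iso Z x).hom
  right (Z : Center D) (x : M) (d : D) :
    (BimoduleCategory.middle (F.obj Z).1 x d).hom ≫ (iso Z (x ⊙ᵣ d)).hom ≫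
        (αᵣ x d Z.1).inv =
      (iso Z x).hom ⊵ᵣ d ≫ (αᵣ x Z.1 d).inv ≫ x ⊴ᵣ (Z.2.β d).hom
  tensor (Z Z' : Center D) (x : M) :
    (Functor.LaxMonoidal.μ F Z Z').f ⊵ₗ x ≫ (iso (Z ⊗ Z') x).hom ≫ (αᵣ x Z.1 Z'.1).hom =
      (αₗ (F.obj Z).1 (F.obj Z').1 x).hom ≫ (F.obj Z).1 ⊴ₗ (iso Z' x).hom ≫
        (BimoduleCategory.middle (F.obj Z).1 x Z'.1).inv ≫ (iso Z x).hom ⊵ᵣ Z'.1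
  unit (x : M) :
    (Functor.LaxMonoidal.ε F).f ⊵ₗ x ≫ (iso (𝟙_ (Center D)) x).hom ≫ (ρᵣ x).hom = (λₗ x).hom

/-! ### The categories `e ⊗ C ⊗ f` for direct summands `e`, `f` of the unit -/

namespace UnitSummand

variable {C : Type u} [Category.{v} C] [MonoidalCategory C] {e f g h : C}

/-- The objects of `e ⊗ C`. -/
def row (_ : Retract e (𝟙_ C)) : ObjectProperty C :=
  fun X => ∃ Y, Nonempty (X ≅ e ⊗ Y)

/-- The objects of `C ⊗ f`. -/
def column (_ : Retract f (𝟙_ C)) : ObjectProperty C :=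
  fun X => ∃ Y, Nonempty (X ≅ Y ⊗ f)

/-- The objects of `e ⊗ C ⊗ f`. -/
def corner (_ : Retract e (𝟙_ C)) (_ : Retract f (𝟙_ C)) : ObjectProperty C :=
  fun X => ∃ Y, Nonempty (X ≅ e ⊗ (Y ⊗ f))

lemma corner_le_row (s : Retract e (𝟙_ C)) (t : Retract f (𝟙_ C)) : corner s t ≤ row s :=
  fun _ ⟨Y, h⟩ => ⟨Y ⊗ f, h⟩

lemma corner_le_column (s : Retract e (𝟙_ C)) (t : Retract f (𝟙_ C)) :
    corner s t ≤ column t :=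
  fun _ ⟨Y, ⟨φ⟩⟩ => ⟨e ⊗ Y, ⟨φ ≪≫ (α_ _ _ _).symm⟩⟩

lemma corner_tensor {e' f' : C} {s : Retract e (𝟙_ C)} {t : Retract f (𝟙_ C)}
    {s' : Retract e' (𝟙_ C)} {t' : Retract f' (𝟙_ C)} {X X' : C}
    (hX : corner s t X) (hX' : corner s' t' X') : corner s t' (X ⊗ X') := by
  obtain ⟨Y, ⟨φ⟩⟩ := hX
  obtain ⟨Y', ⟨φ'⟩⟩ := hX'
  exact ⟨(Y ⊗ f) ⊗ (e' ⊗ Y'), ⟨(φ ⊗ᵢ φ') ≪≫ α_ _ _ _ ≪≫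
    whiskerLeftIso e (whiskerLeftIso _ (α_ _ _ _).symm ≪≫ (α_ _ _ _).symm)⟩⟩

lemma row_tensor {s : Retract e (𝟙_ C)} {X : C} (hX : row s X) (X' : C) :
    row s (X ⊗ X') := by
  obtain ⟨Y, ⟨φ⟩⟩ := hX
  exact ⟨Y ⊗ X', ⟨whiskerRightIso φ X' ≪≫ α_ _ _ _⟩⟩

lemma idem_whiskerRight_self (s : Retract e (𝟙_ C)) : (s.r ≫ s.i) ▷ e = 𝟙 (𝟙_ C ⊗ e) := by
  have h : (s.r ≫ s.i) ▷ 𝟙_ C = 𝟙_ C ◁ (s.r ≫ s.i) := by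
    simp [MonoidalCategory.whiskerRight_id, MonoidalCategory.id_whiskerLeft, unitors_equal,
      unitors_inv_equal]
  have h2 : (s.r ≫ s.i) ▷ e ≫ 𝟙_ C ◁ s.i = 𝟙_ C ◁ s.i := by
    rw [← whisker_exchange, h, ← MonoidalCategory.whiskerLeft_comp, s.retract_assoc]
  have h3 := congrArg (· ≫ 𝟙_ C ◁ s.r) h2
  simpa only [Category.assoc, ← MonoidalCategory.whiskerLeft_comp, s.retract,
    MonoidalCategory.whiskerLeft_id, Category.comp_id] using h3

lemma self_whiskerLeft_idem (s : Retract e (𝟙_ C)) : e ◁ (s.r ≫ s.i) = 𝟙 (e ⊗ 𝟙_ C) := by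
  have h : (s.r ≫ s.i) ▷ 𝟙_ C = 𝟙_ C ◁ (s.r ≫ s.i) := by
    simp [MonoidalCategory.whiskerRight_id, MonoidalCategory.id_whiskerLeft, unitors_equal,
      unitors_inv_equal]
  have h2 : e ◁ (s.r ≫ s.i) ≫ s.i ▷ 𝟙_ C = s.i ▷ 𝟙_ C := by
    rw [whisker_exchange, ← h, ← comp_whiskerRight, s.retract_assoc]
  have h3 := congrArg (· ≫ s.r ▷ 𝟙_ C) h2
  simpa only [Category.assoc, ← comp_whiskerRight, s.retract, id_whiskerRight,
    Category.comp_id] using h3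

lemma idem_whiskerRight {s : Retract e (𝟙_ C)} {X : C} (hX : row s X) :
    (s.r ≫ s.i) ▷ X = 𝟙 (𝟙_ C ⊗ X) := by
  obtain ⟨Y, ⟨φ⟩⟩ := hX
  have h : (s.r ≫ s.i) ▷ (e ⊗ Y) = 𝟙 _ := by
    rw [whiskerRight_tensor, idem_whiskerRight_self]
    simp
  rw [← cancel_mono (𝟙_ C ◁ φ.hom), ← whisker_exchange, h]
  simp

lemma whiskerLeft_idem {s : Retract e (𝟙_ C)} {X : C} (hX : column s X) :
    X ◁ (s.r ≫ s.i) = 𝟙 (X ⊗ 𝟙_ C) := by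
  obtain ⟨Y, ⟨φ⟩⟩ := hX
  have h : (Y ⊗ e) ◁ (s.r ≫ s.i) = 𝟙 _ := by
    rw [tensor_whiskerLeft, self_whiskerLeft_idem]
    simp
  rw [← cancel_mono (φ.hom ▷ 𝟙_ C), whisker_exchange, h]
  simp

/-- The isomorphism `e ⊗ X ≅ X` induced by `e ⟶ 𝟙`, for `X` in `e ⊗ C`. -/
@[simps]
def leftIso (s : Retract e (𝟙_ C)) {X : C} (hX : row s X) : e ⊗ X ≅ X where
  hom := s.i ▷ X ≫ (λ_ X).hom
  inv := (λ_ X).inv ≫ s.r ▷ X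
  hom_inv_id := by
    simp [← comp_whiskerRight]
  inv_hom_id := by
    rw [Category.assoc, ← comp_whiskerRight_assoc, idem_whiskerRight hX]
    simp

/-- The isomorphism `X ⊗ e ≅ X` induced by `e ⟶ 𝟙`, for `X` in `C ⊗ e`. -/
@[simps]
def rightIso (s : Retract e (𝟙_ C)) {X : C} (hX : column s X) : X ⊗ e ≅ X where
  hom := X ◁ s.i ≫ (ρ_ X).hom
  inv := (ρ_ X).inv ≫ X ◁ s.r
  hom_inv_id := by
    simp [← MonoidalCategory.whiskerLeft_comp]
  inv_hom_id := by
    rw [Category.assoc, ← MonoidalCategory.whiskerLeft_comp_assoc, whiskerLeft_idem hX]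
    simp

lemma corner_self (s : Retract e (𝟙_ C)) : corner s s e :=
  ⟨𝟙_ C, ⟨(leftIso s (X := e) ⟨𝟙_ C, ⟨(ρ_ e).symm⟩⟩).symm ≪≫
    whiskerLeftIso e (λ_ e).symm⟩⟩

lemma corner_tensor_tensor (s : Retract e (𝟙_ C)) (t : Retract f (𝟙_ C)) (X : C) :
    corner s t (e ⊗ (X ⊗ f)) := ⟨X, ⟨Iso.refl _⟩⟩

/-- The full subcategory `e ⊗ C ⊗ f` of `C`. -/
abbrev Corner (s : Retract e (𝟙_ C)) (t : Retract f (𝟙_ C)) : Type u :=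
  (corner s t).FullSubcategory

/-- The full subcategory `e ⊗ C` of `C`. -/
abbrev Row (s : Retract e (𝟙_ C)) : Type u := (row s).FullSubcategory

/-- The functor `X ↦ e ⊗ X ⊗ f` from `C` to `e ⊗ C ⊗ f`. -/
def toCorner (s : Retract e (𝟙_ C)) (t : Retract f (𝟙_ C)) : C ⥤ Corner s t :=
  (corner s t).lift (tensorRight f ⋙ tensorLeft e) (corner_tensor_tensor s t)

/-- The functor `X ↦ X ⊗ f` from `e ⊗ C` to `e ⊗ C ⊗ f`. -/
def rowToCorner (s : Retract e (𝟙_ C)) (t : Retract f (𝟙_ C)) : Row s ⥤ Corner s t :=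
  (corner s t).lift ((row s).ι ⋙ tensorRight f) (fun X => by
    obtain ⟨Y, ⟨φ⟩⟩ := X.property
    exact ⟨Y, ⟨whiskerRightIso φ f ≪≫ α_ _ _ _⟩⟩)

/-- The monoidal category `e ⊗ C ⊗ e`: its tensor product is that of `C`, its unit is `e`. -/
instance cornerMonoidal (s : Retract e (𝟙_ C)) : MonoidalCategory (Corner s s) where
  tensorObj X Y := ⟨X.obj ⊗ Y.obj, corner_tensor X.property Y.property⟩
  whiskerLeft X _ _ φ := ObjectProperty.homMk (X.obj ◁ φ.hom)
  whiskerRight φ X := ObjectProperty.homMk (φ.hom ▷ X.obj)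
  tensorHom φ ψ := ObjectProperty.homMk (φ.hom ⊗ₘ ψ.hom)
  tensorUnit := ⟨e, corner_self s⟩
  associator X Y Z := ObjectProperty.isoMk _ (α_ X.obj Y.obj Z.obj)
  leftUnitor X := ObjectProperty.isoMk _ (leftIso s (corner_le_row s s _ X.property))
  rightUnitor X := ObjectProperty.isoMk _ (rightIso s (corner_le_column s s _ X.property))
  tensorHom_def _ _ := by ext; simp [MonoidalCategory.tensorHom_def]
  id_tensorHom_id _ _ := by ext; simp
  tensorHom_comp_tensorHom _ _ _ _ := by ext; simp
  whiskerLeft_id _ _ := by ext; simp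
  id_whiskerRight _ _ := by ext; simp
  associator_naturality _ _ _ := by ext; simp
  leftUnitor_naturality _ := by ext; simp [whisker_exchange_assoc]
  rightUnitor_naturality _ := by ext; simp [← whisker_exchange_assoc]
  pentagon _ _ _ _ := by ext; simp
  triangle _ _ := by ext; simp

/-- The left action of `e ⊗ C ⊗ e`, by the tensor product of `C`, on a full subcategory of
`e ⊗ C` which is stable under it. -/
abbrev leftActionOn (s : Retract e (𝟙_ C)) (P : ObjectProperty C) (hP : P ≤ row s)
    (hP' : ∀ X Y, corner s s X → P Y → P (X ⊗ Y)) :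
    MonoidalLeftAction (Corner s s) P.FullSubcategory where
  actionObj X Y := ⟨X.obj ⊗ Y.obj, hP' _ _ X.property Y.property⟩
  actionHomLeft φ Y := ObjectProperty.homMk (φ.hom ▷ Y.obj)
  actionHomRight X _ _ φ := ObjectProperty.homMk (X.obj ◁ φ.hom)
  actionHom φ ψ := ObjectProperty.homMk (φ.hom ⊗ₘ ψ.hom)
  actionAssocIso X X' Y := ObjectProperty.isoMk _ (α_ X.obj X'.obj Y.obj)
  actionUnitIso Y := ObjectProperty.isoMk _ (leftIso s (hP _ Y.property))
  actionHom_def _ _ := by ext; simp [MonoidalCategory.tensorHom_def]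
  actionHomRight_id _ _ := by ext; simp
  id_actionHomLeft _ _ := by ext; simp
  actionHom_comp _ _ _ _ := by ext; simp
  actionAssocIso_hom_naturality _ _ _ := by
    ext
    exact associator_naturality _ _ _
  actionUnitIso_hom_naturality φ := by
    ext
    change (s.i ▷ _ ≫ (λ_ _).hom) ≫ φ.hom = e ◁ φ.hom ≫ s.i ▷ _ ≫ (λ_ _).hom
    simp [whisker_exchange_assoc]
  whiskerLeft_actionHomLeft X _ _ φ Y := by
    ext
    change (X.obj ◁ φ.hom) ▷ Y.obj = (α_ _ _ _).hom ≫ X.obj ◁ φ.hom ▷ Y.obj ≫ (α_ _ _ _).inv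
    simp
  whiskerRight_actionHomLeft X φ Y := by
    ext
    change (φ.hom ▷ X.obj) ▷ Y.obj = (α_ _ _ _).hom ≫ φ.hom ▷ (X.obj ⊗ Y.obj) ≫ (α_ _ _ _).inv
    simp
  associator_actionHom _ _ _ _ := by
    ext
    exact pentagon _ _ _ _
  leftUnitor_actionHom X Y := by
    ext
    change (s.i ▷ X.obj ≫ (λ_ _).hom) ▷ Y.obj =
      (α_ _ _ _).hom ≫ s.i ▷ (X.obj ⊗ Y.obj) ≫ (λ_ _).hom
    simp
  rightUnitor_actionHom X Y := by
    ext
    change (X.obj ◁ s.i ≫ (ρ_ _).hom) ▷ Y.obj =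
      (α_ _ _ _).hom ≫ X.obj ◁ (s.i ▷ Y.obj ≫ (λ_ _).hom)
    simp

/-- The left action of `e ⊗ C ⊗ e` on `e ⊗ C ⊗ f` by the tensor product of `C`. -/
instance cornerLeftAction (s : Retract e (𝟙_ C)) (t : Retract f (𝟙_ C)) :
    MonoidalLeftAction (Corner s s) (Corner s t) :=
  leftActionOn s (corner s t) (corner_le_row s t) (fun _ _ hX hY => corner_tensor hX hY)

/-- The left action of `e ⊗ C ⊗ e` on `e ⊗ C` by the tensor product of `C`. -/
instance rowLeftAction (s : Retract e (𝟙_ C)) : MonoidalLeftAction (Corner s s) (Row s) :=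
  leftActionOn s (row s) le_rfl (fun _ Y hX _ => row_tensor (corner_le_row s s _ hX) Y)

/-- The right action of `f ⊗ C ⊗ f` on `e ⊗ C ⊗ f` by the tensor product of `C`. -/
instance cornerRightAction (s : Retract e (𝟙_ C)) (t : Retract f (𝟙_ C)) :
    MonoidalRightAction (Corner t t) (Corner s t) where
  actionObj Y X := ⟨Y.obj ⊗ X.obj, corner_tensor Y.property X.property⟩
  actionHomLeft φ X := ObjectProperty.homMk (φ.hom ▷ X.obj)
  actionHomRight Y _ _ φ := ObjectProperty.homMk (Y.obj ◁ φ.hom)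
  actionHom φ ψ := ObjectProperty.homMk (φ.hom ⊗ₘ ψ.hom)
  actionAssocIso Y X X' := ObjectProperty.isoMk _ (α_ Y.obj X.obj X'.obj).symm
  actionUnitIso Y := ObjectProperty.isoMk _ (rightIso t (corner_le_column s t _ Y.property))
  actionHom_def _ _ := by ext; simp [MonoidalCategory.tensorHom_def]
  actionHomRight_id _ _ := by ext; simp
  id_actionHomLeft _ _ := by ext; simp
  actionHom_comp _ _ _ _ := by ext; simp
  actionAssocIso_hom_naturality _ _ _ := by
    ext
    exact associator_inv_naturality _ _ _
  actionUnitIso_hom_naturality φ := by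
    ext
    change (_ ◁ t.i ≫ (ρ_ _).hom) ≫ φ.hom = φ.hom ▷ f ≫ _ ◁ t.i ≫ (ρ_ _).hom
    simp [← whisker_exchange_assoc]
  actionHomRight_whiskerRight φ X Y := by
    ext
    change Y.obj ◁ (φ.hom ▷ X.obj) = (α_ _ _ _).inv ≫ (Y.obj ◁ φ.hom) ▷ X.obj ≫ (α_ _ _ _).hom
    simp
  whiskerRight_actionHomLeft X _ _ φ Y := by
    ext
    change Y.obj ◁ X.obj ◁ φ.hom = (α_ _ _ _).inv ≫ (Y.obj ⊗ X.obj) ◁ φ.hom ≫ (α_ _ _ _).hom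
    simp
  actionHom_associator X X' X'' Y := by
    ext
    change Y.obj ◁ (α_ X.obj X'.obj X''.obj).hom ≫ (α_ _ _ _).inv ≫ (α_ _ _ _).inv =
      (α_ _ _ _).inv ≫ (α_ _ _ _).inv ▷ _
    simp
  actionHom_leftUnitor X Y := by
    ext
    change Y.obj ◁ (t.i ▷ X.obj ≫ (λ_ _).hom) =
      (α_ _ _ _).inv ≫ (Y.obj ◁ t.i ≫ (ρ_ _).hom) ▷ X.obj
    simp
  actionHom_rightUnitor X Y := by
    ext
    change Y.obj ◁ (X.obj ◁ t.i ≫ (ρ_ _).hom) =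
      (α_ _ _ _).inv ≫ (Y.obj ⊗ X.obj) ◁ t.i ≫ (ρ_ _).hom
    simp

/-- The right action of `C` on `e ⊗ C` by the tensor product. -/
instance rowRightAction (s : Retract e (𝟙_ C)) : MonoidalRightAction C (Row s) where
  actionObj Y X := ⟨Y.obj ⊗ X, row_tensor Y.property X⟩
  actionHomLeft φ X := ObjectProperty.homMk (φ.hom ▷ X)
  actionHomRight Y _ _ φ := ObjectProperty.homMk (Y.obj ◁ φ)
  actionHom φ ψ := ObjectProperty.homMk (φ.hom ⊗ₘ ψ)
  actionAssocIso Y X X' := ObjectProperty.isoMk _ (α_ Y.obj X X').symm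
  actionUnitIso Y := ObjectProperty.isoMk _ (ρ_ Y.obj)
  actionHom_def _ _ := by ext; simp [MonoidalCategory.tensorHom_def]
  actionHomRight_id _ _ := by ext; simp
  id_actionHomLeft _ _ := by ext; simp
  actionHom_comp _ _ _ _ := by ext; simp
  actionAssocIso_hom_naturality _ _ _ := by
    ext
    exact associator_inv_naturality _ _ _
  actionUnitIso_hom_naturality φ := by ext; simp
  actionHomRight_whiskerRight φ X Y := by ext; simp
  whiskerRight_actionHomLeft X _ _ φ Y := by ext; simp
  actionHom_associator X X' X'' Y := by ext; simp
  actionHom_leftUnitor X Y := by ext; simp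
  actionHom_rightUnitor X Y := by ext; simp

/-- `e ⊗ C ⊗ f` as a bimodule over `e ⊗ C ⊗ e` and `f ⊗ C ⊗ f`. -/
instance cornerBimodule (s : Retract e (𝟙_ C)) (t : Retract f (𝟙_ C)) :
    BimoduleCategory (Corner s s) (Corner t t) (Corner s t) where
  middle X Y Z := ObjectProperty.isoMk _ (α_ X.obj Y.obj Z.obj)
  middle_naturality _ _ _ := by
    ext
    exact associator_naturality _ _ _
  middle_tensor_left _ _ _ _ := by
    ext
    exact (pentagon _ _ _ _).symm
  middle_tensor_right X Y Z Z' := by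
    ext
    change (α_ X.obj Y.obj (Z.obj ⊗ Z'.obj)).hom ≫ X.obj ◁ (α_ _ _ _).inv =
      (α_ _ _ _).inv ≫ (α_ _ _ _).hom ▷ _ ≫ (α_ _ _ _).hom
    simp
  middle_unit_left Y Z := by
    ext
    change (α_ e Y.obj Z.obj).hom ≫ s.i ▷ _ ≫ (λ_ _).hom = (s.i ▷ Y.obj ≫ (λ_ _).hom) ▷ Z.obj
    simp
  middle_unit_right X Y := by
    ext
    change (α_ X.obj Y.obj f).hom ≫ X.obj ◁ (Y.obj ◁ t.i ≫ (ρ_ _).hom) =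
      (X.obj ⊗ Y.obj) ◁ t.i ≫ (ρ_ _).hom
    simp

/-- `e ⊗ C` as a bimodule over `e ⊗ C ⊗ e` and `C`. -/
instance rowBimodule (s : Retract e (𝟙_ C)) : BimoduleCategory (Corner s s) C (Row s) where
  middle X Y Z := ObjectProperty.isoMk _ (α_ X.obj Y.obj Z)
  middle_naturality _ _ _ := by
    ext
    exact associator_naturality _ _ _
  middle_tensor_left _ _ _ _ := by
    ext
    exact (pentagon _ _ _ _).symm
  middle_tensor_right X Y Z Z' := by
    ext
    change (α_ X.obj Y.obj (Z ⊗ Z')).hom ≫ X.obj ◁ (α_ _ _ _).inv =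
      (α_ _ _ _).inv ≫ (α_ _ _ _).hom ▷ _ ≫ (α_ _ _ _).hom
    simp
  middle_unit_left Y Z := by
    ext
    change (α_ e Y.obj Z).hom ≫ s.i ▷ _ ≫ (λ_ _).hom = (s.i ▷ Y.obj ≫ (λ_ _).hom) ▷ Z
    simp
  middle_unit_right X Y := by
    ext
    change (α_ X.obj Y.obj (𝟙_ C)).hom ≫ X.obj ◁ (ρ_ _).hom = (ρ_ _).hom
    simp

/-! The tensor product of `C` restricted to these subcategories. -/

/-- The canonical map `e ⊗ X ⊗ f ⟶ X`. -/
def counitMap (s : Retract e (𝟙_ C)) (t : Retract f (𝟙_ C)) (X : C) : e ⊗ (X ⊗ f) ⟶ X :=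
  s.i ▷ (X ⊗ f) ≫ (λ_ _).hom ≫ X ◁ t.i ≫ (ρ_ _).hom

/-- The canonical map `X ⟶ e ⊗ X ⊗ f`. -/
def unitMap (s : Retract e (𝟙_ C)) (t : Retract f (𝟙_ C)) (X : C) : X ⟶ e ⊗ (X ⊗ f) :=
  (ρ_ _).inv ≫ X ◁ t.r ≫ (λ_ _).inv ≫ s.r ▷ (X ⊗ f)

lemma counitMap_unitMap (s : Retract e (𝟙_ C)) (t : Retract f (𝟙_ C)) (X : C) :
    counitMap s t X ≫ unitMap s t X = 𝟙 _ := by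
  have h1 : X ◁ t.i ≫ X ◁ t.r = 𝟙 _ := by
    rw [← MonoidalCategory.whiskerLeft_comp, t.retract, MonoidalCategory.whiskerLeft_id]
  have h2 : s.i ▷ (X ⊗ f) ≫ s.r ▷ (X ⊗ f) = 𝟙 _ := by
    rw [← comp_whiskerRight, s.retract, id_whiskerRight]
  simp only [counitMap, unitMap, Category.assoc, Iso.hom_inv_id_assoc, reassoc_of% h1, h2]

lemma unitMap_counitMap {s : Retract e (𝟙_ C)} {t : Retract f (𝟙_ C)} {X : C}
    (hX : corner s t X) : unitMap s t X ≫ counitMap s t X = 𝟙 _ := by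
  have h1 : X ◁ t.r ≫ X ◁ t.i = 𝟙 _ := by
    rw [← MonoidalCategory.whiskerLeft_comp, whiskerLeft_idem (corner_le_column s t _ hX)]
  have hX' : row s (X ⊗ f) := row_tensor (corner_le_row s t _ hX) f
  have h2 : s.r ▷ (X ⊗ f) ≫ s.i ▷ (X ⊗ f) = 𝟙 _ := by
    rw [← comp_whiskerRight, idem_whiskerRight hX']
  simp only [counitMap, unitMap, Category.assoc, Iso.inv_hom_id_assoc, reassoc_of% h1,
    reassoc_of% h2, Iso.inv_hom_id]

lemma counitMap_naturality (s : Retract e (𝟙_ C)) (t : Retract f (𝟙_ C)) {X Y : C}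
    (φ : X ⟶ Y) : e ◁ (φ ▷ f) ≫ counitMap s t Y = counitMap s t X ≫ φ := by
  simp only [counitMap, Category.assoc]
  rw [whisker_exchange_assoc, leftUnitor_naturality_assoc, ← whisker_exchange_assoc,
    rightUnitor_naturality]

lemma unitMap_naturality (s : Retract e (𝟙_ C)) (t : Retract f (𝟙_ C)) {X Y : C}
    (φ : X ⟶ Y) : φ ≫ unitMap s t Y = unitMap s t X ≫ e ◁ (φ ▷ f) := by
  simp only [unitMap, Category.assoc]
  rw [← whisker_exchange, ← leftUnitor_inv_naturality_assoc (φ ▷ f), whisker_exchange_assoc,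
    rightUnitor_inv_naturality_assoc]

/-- The inclusion of `e ⊗ C ⊗ f` is left adjoint to `X ↦ e ⊗ X ⊗ f`. -/
def cornerAdjunction (s : Retract e (𝟙_ C)) (t : Retract f (𝟙_ C)) :
    (corner s t).ι ⊣ toCorner s t :=
  Adjunction.mkOfUnitCounit
    { unit :=
        { app := fun X => ObjectProperty.homMk (unitMap s t X.obj)
          naturality := fun _ _ φ => by
            ext
            exact unitMap_naturality s t φ.hom }
      counit :=
        { app := fun X => counitMap s t X
          naturality := fun _ _ φ => counitMap_naturality s t φ }
      left_triangle := by
        ext X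
        change unitMap s t X.obj ≫ 𝟙 _ ≫ counitMap s t X.obj = 𝟙 _
        rw [Category.id_comp, unitMap_counitMap X.property]
      right_triangle := by
        ext X
        change unitMap s t (e ⊗ (X ⊗ f)) ≫ 𝟙 _ ≫ e ◁ (counitMap s t X ▷ f) = 𝟙 _
        rw [Category.id_comp, ← unitMap_naturality, counitMap_unitMap] }

instance corner_ι_preservesFiniteColimits (s : Retract e (𝟙_ C)) (t : Retract f (𝟙_ C)) :
    PreservesFiniteColimits (corner s t).ι := by
  have := (cornerAdjunction s t).leftAdjoint_preservesColimits
  infer_instance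

/-- The tensor product of `C`, as a functor `(e ⊗ C ⊗ f) × (f ⊗ C ⊗ g) ⥤ e ⊗ C ⊗ g`. -/
def cornerTensorFunctor (s : Retract e (𝟙_ C)) (t : Retract f (𝟙_ C)) (r : Retract g (𝟙_ C)) :
    Corner s t ⥤ Corner t r ⥤ Corner s r where
  obj X :=
    { obj := fun Y => ⟨X.obj ⊗ Y.obj, corner_tensor X.property Y.property⟩
      map := fun φ => ObjectProperty.homMk (X.obj ◁ φ.hom)
      map_id := fun _ => by ext; simp
      map_comp := fun _ _ => by ext; simp }
  map φ :=
    { app := fun Y => ObjectProperty.homMk (φ.hom ▷ Y.obj)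
      naturality := fun _ _ _ => by ext; simp [whisker_exchange] }
  map_id _ := by ext; simp
  map_comp _ _ := by ext; simp

/-- The tensor product of `C`, as a balanced bimodule functor
`(e ⊗ C ⊗ f) × (f ⊗ C ⊗ g) ⥤ e ⊗ C ⊗ g` over `e ⊗ C ⊗ e`, `f ⊗ C ⊗ f` and `g ⊗ C ⊗ g`: all
structure isomorphisms are given by the associator of `C`. -/
def cornerTensor (hl : ∀ X : C, PreservesFiniteColimits (tensorLeft X))
    (hr : ∀ X : C, PreservesFiniteColimits (tensorRight X))
    (s : Retract e (𝟙_ C)) (t : Retract f (𝟙_ C)) (r : Retract g (𝟙_ C)) :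
    BalancedBimoduleFunctor (Corner s s) (Corner t t) (Corner r r)
      (Corner s t) (Corner t r) (Corner s r) where
  functor := cornerTensorFunctor s t r
  rightExact_left Y := by
    have := hr Y.obj
    have : PreservesFiniteColimits ((cornerTensorFunctor s t r).flip.obj Y ⋙ (corner s r).ι) :=
      inferInstanceAs (PreservesFiniteColimits ((corner s t).ι ⋙ tensorRight Y.obj))
    exact preservesFiniteColimits_of_reflects_of_preserves _ (corner s r).ι
  rightExact_right X := by
    have := hl X.obj
    have : PreservesFiniteColimits ((cornerTensorFunctor s t r).obj X ⋙ (corner s r).ι) :=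
      inferInstanceAs (PreservesFiniteColimits ((corner t r).ι ⋙ tensorLeft X.obj))
    exact preservesFiniteColimits_of_reflects_of_preserves _ (corner s r).ι
  balance X Z Y := ObjectProperty.isoMk _ (α_ X.obj Z.obj Y.obj)
  balance_naturality_left φ Z Y := by
    ext
    exact associator_naturality_left _ _ _
  balance_naturality_middle X _ _ φ Y := by
    ext
    exact associator_naturality_middle _ _ _
  balance_naturality_right X Z _ _ φ := by
    ext
    exact associator_naturality_right _ _ _
  balance_unit X Y := by
    ext
    change (α_ X.obj f Y.obj).hom ≫ X.obj ◁ (t.i ▷ Y.obj ≫ (λ_ _).hom) =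
      (X.obj ◁ t.i ≫ (ρ_ _).hom) ▷ Y.obj
    simp
  balance_tensor X Z Z' Y := by
    ext
    change (α_ X.obj (Z.obj ⊗ Z'.obj) Y.obj).hom ≫ X.obj ◁ (α_ _ _ _).hom =
      (α_ _ _ _).inv ▷ _ ≫ (α_ _ _ _).hom ≫ (α_ _ _ _).hom
    simp
  left Z X Y := ObjectProperty.isoMk _ (α_ Z.obj X.obj Y.obj)
  left_naturality {Z Z' X X' Y Y'} φ ψ χ := by
    ext
    change (φ.hom ⊗ₘ ψ.hom) ▷ Y.obj ≫ (Z'.obj ⊗ X'.obj) ◁ χ.hom ≫ (α_ _ _ _).hom =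
      (α_ _ _ _).hom ≫ (φ.hom ⊗ₘ (ψ.hom ▷ Y.obj ≫ X'.obj ◁ χ.hom))
    rw [← MonoidalCategory.tensorHom_def, ← MonoidalCategory.tensorHom_def_assoc,
      associator_naturality]
  left_tensor Z Z' X Y := by
    ext
    exact (pentagon _ _ _ _).symm
  left_unit X Y := by
    ext
    change (α_ e X.obj Y.obj).hom ≫ s.i ▷ _ ≫ (λ_ _).hom = (s.i ▷ X.obj ≫ (λ_ _).hom) ▷ Y.obj
    simp
  right X Y Z := ObjectProperty.isoMk _ (α_ X.obj Y.obj Z.obj).symm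
  right_naturality {X X' Y Y' Z Z'} φ ψ χ := by
    ext
    change φ.hom ▷ (Y.obj ⊗ Z.obj) ≫ X'.obj ◁ (ψ.hom ⊗ₘ χ.hom) ≫ (α_ _ _ _).inv =
      (α_ _ _ _).inv ≫ ((φ.hom ▷ Y.obj ≫ X'.obj ◁ ψ.hom) ⊗ₘ χ.hom)
    rw [← MonoidalCategory.tensorHom_def, ← MonoidalCategory.tensorHom_def_assoc,
      associator_inv_naturality]
  right_tensor X Y Z Z' := by
    ext
    change (α_ X.obj Y.obj (Z.obj ⊗ Z'.obj)).inv ≫ (α_ _ _ _).inv =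
      X.obj ◁ (α_ _ _ _).inv ≫ (α_ _ _ _).inv ≫ (α_ _ _ _).inv ▷ _
    simp
  right_unit X Y := by
    ext
    change (α_ X.obj Y.obj g).inv ≫ (X.obj ⊗ Y.obj) ◁ r.i ≫ (ρ_ _).hom =
      X.obj ◁ (Y.obj ◁ r.i ≫ (ρ_ _).hom)
    simp
  left_right Z X Y Z' := by
    ext
    change (α_ (Z.obj ⊗ X.obj) Y.obj Z'.obj).inv ≫ (α_ _ _ _).hom ▷ _ ≫ (α_ _ _ _).hom =
      (α_ _ _ _).hom ≫ _ ◁ (α_ _ _ _).inv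
    simp
  left_balance Z X Z' Y := by
    ext
    exact (pentagon _ _ _ _).symm
  right_balance X Z Y Z' := by
    ext
    change (α_ (X.obj ⊗ Z.obj) Y.obj Z'.obj).inv ≫ (α_ _ _ _).hom ▷ _ =
      (α_ _ _ _).hom ≫ _ ◁ (α_ _ _ _).inv ≫ (α_ _ _ _).inv
    simp

end UnitSummand

/-- A decomposition of the unit object of `C` into a direct sum of simple objects `e i`. -/
structure UnitDecomposition (C : Type u) [Category.{v} C] [Preadditive C] [MonoidalCategory C]
    (Λ : Type w) where
  e : Λ → C
  simple (i : Λ) : Simple (e i)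
  bicone : Bicone e
  isBilimit : bicone.IsBilimit
  iso : bicone.pt ≅ 𝟙_ C

/-- The inclusion of and projection to the summand `e i` of the unit. -/
@[simps]
def UnitDecomposition.summand {C : Type u} [Category.{v} C] [Preadditive C] [MonoidalCategory C]
    {Λ : Type w} (d : UnitDecomposition C Λ) (i : Λ) : Retract (d.e i) (𝟙_ C) where
  i := d.bicone.ι i ≫ d.iso.hom
  r := d.iso.inv ≫ d.bicone.π i
  retract := by simp

/-- The full subcategory `C_ij = e_i ⊗ C ⊗ e_j`. -/
abbrev UnitDecomposition.Block {C : Type u} [Category.{v} C] [Preadditive C] [MonoidalCategory C]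
    {Λ : Type w} (d : UnitDecomposition C Λ) (i j : Λ) : Type u :=
  UnitSummand.Corner (d.summand i) (d.summand j)

/-- The full subcategory `e_i ⊗ C`, which is the direct sum of the `C_ij` over all `j`. -/
abbrev UnitDecomposition.RowBlock {C : Type u} [Category.{v} C] [Preadditive C]
    [MonoidalCategory C] {Λ : Type w} (d : UnitDecomposition C Λ) (i : Λ) : Type u :=
  UnitSummand.Row (d.summand i)

/-! Everything rests on rigidity: tensoring with an object has adjoints on both sides, hence is
exact, and the evaluation and coevaluation of an object become split after tensoring with that
object.

The unit. A subobject `I` of the unit splits off (`exists_retraction`). Let `D` be its dual. The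
inclusion transposes to an epimorphism from the unit to `D`, whose kernel `J` satisfies `J ⊗ I = 0`.
Then `I ⊗ J` is a subobject of the unit with zero square, and a subobject of the unit is isomorphic
to its square; so `I ⊗ J = 0`, `I ≅ I ⊗ D`, and the coevaluation of `I` becomes a retraction. As
endomorphism spaces are finite-dimensional, splitting off subobjects ends in simple ones. The
resulting orthogonal idempotents act on every object from the left and from the right by natural
endomorphisms, and these cut `C` into the blocks `C_ij`.

Nonvanishing. Since `e_i` is simple, `X ⊗ Y = 0` forces `X ⊗ e_i = 0` or `e_i ⊗ Y = 0`
(`isZero_or_isZero_of_isZero_tensor`). With duals, this makes `C_ij ≠ 0` an equivalence relation on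
the indices. The sum of the idempotents in one class is central, so two classes would decompose `C`.
Moreover the cokernel of the evaluation of `X` is killed by `X`; hence the evaluation is epimorphic
on `e_i ⊗ C` as soon as `e_i ⊗ X ≠ 0`.

Relative tensor products. If the evaluation maps `X ⊗ X' ⊗ Z ⟶ Z` are epimorphic, each `Z` is the
coequalizer of the two maps from `X ⊗ X' ⊗ X ⊗ X' ⊗ Z` to `X ⊗ X' ⊗ Z`. The right exact functor
induced by a balanced functor `F` must therefore be a coequalizer of values of `F` at `(X, X' ⊗ -)`,
and this coequalizer works. `PresentingObject` isolates what the argument uses. A nonzero object of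
`C_ij` serves for the blocks; for rows and columns one needs `e_i` and an object of `C ⊗ e_i` that
meets every block.

The center. The equivalence is `Z ↦ e_i ⊗ Z`, and the half braiding of `Z` gives `(e_i ⊗ Z) ⊗ x ≅ x
⊗ Z` on `e_i ⊗ C`. Choose `y` in `C ⊗ e_i` with epimorphic evaluation and dual `x₀` in `e_i ⊗ C`.
Transformations `x ⊗ A ⟶ x ⊗ B` over `C_ii` all come from morphisms `A ⟶ B`
(`exists_eq_whiskerLeft`), which yields full faithfulness and the half braidings. Descent along the
evaluation of `y` shows that every central object of `C_ii` acts on `e_i ⊗ C` as some object of `C`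
does (`exists_centerRowIso`). -/

set_option linter.unusedSectionVars false
set_option linter.unusedSimpArgs false
/-! ### Exactness of the tensor product of a rigid abelian category -/

section RigidExact

variable {C : Type u} [Category.{v} C] [MonoidalCategory C] [RigidCategory C]

instance tensorLeft_isLeftAdjoint (X : C) : (tensorLeft X).IsLeftAdjoint :=
  (tensorLeftAdjunction (ᘁX) X).isLeftAdjoint

instance tensorLeft_isRightAdjoint (X : C) : (tensorLeft X).IsRightAdjoint :=
  (tensorLeftAdjunction X (Xᘁ)).isRightAdjoint

instance tensorRight_isLeftAdjoint (X : C) : (tensorRight X).IsLeftAdjoint :=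
  (tensorRightAdjunction X (Xᘁ)).isLeftAdjoint

instance tensorRight_isRightAdjoint (X : C) : (tensorRight X).IsRightAdjoint :=
  (tensorRightAdjunction (ᘁX) X).isRightAdjoint

instance mono_whiskerLeft (X : C) {Y Z : C} (f : Y ⟶ Z) [Mono f] : Mono (X ◁ f) :=
  inferInstanceAs (Mono ((tensorLeft X).map f))

instance epi_whiskerLeft (X : C) {Y Z : C} (f : Y ⟶ Z) [Epi f] : Epi (X ◁ f) :=
  inferInstanceAs (Epi ((tensorLeft X).map f))

instance mono_whiskerRight (X : C) {Y Z : C} (f : Y ⟶ Z) [Mono f] : Mono (f ▷ X) :=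
  inferInstanceAs (Mono ((tensorRight X).map f))

instance epi_whiskerRight (X : C) {Y Z : C} (f : Y ⟶ Z) [Epi f] : Epi (f ▷ X) :=
  inferInstanceAs (Epi ((tensorRight X).map f))

end RigidExact

/-! ### The unit of a rigid abelian category is semisimple -/

namespace UnitSemisimple

section

variable {C : Type u} [Category.{v} C] [Abelian C] [MonoidalCategory C] [MonoidalPreadditive C]

lemma isZero_tensor_left {X : C} (h : IsZero X) (Y : C) : IsZero (X ⊗ Y) :=
  (tensorRight Y).map_isZero h

lemma isZero_tensor_right (X : C) {Y : C} (h : IsZero Y) : IsZero (X ⊗ Y) :=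
  (tensorLeft X).map_isZero h

variable [RigidCategory C]

/-- Followed by the monomorphism `cokernel i ◁ i`, the epimorphism `cokernel.π i ▷ I` becomes, by
the exchange law, `i` followed by its cokernel map. It is therefore zero. -/
lemma isZero_cokernel_tensor {I : C} (i : I ⟶ 𝟙_ C) [Mono i] :
    IsZero (cokernel i ⊗ I) := by
  have h : cokernel.π i ▷ I = 0 := by
    rw [← cancel_mono (cokernel i ◁ i), ← whisker_exchange, zero_comp, ← cancel_epi (λ_ I).inv,
      ← leftUnitor_inv_naturality_assoc, unitors_inv_equal, ← rightUnitor_inv_naturality,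
      cokernel.condition_assoc]
    simp
  exact IsZero.of_epi_eq_zero _ h

/-- The cokernel of `i ▷ I` is `cokernel i ⊗ I = 0`; a subobject of the unit is thus isomorphic to
its square. -/
instance isIso_whiskerRight_self {I : C} (i : I ⟶ 𝟙_ C) [Mono i] : IsIso (i ▷ I) := by
  have : Epi (i ▷ I) := Preadditive.epi_of_cokernel_zero <| by
    have := (isZero_cokernel_tensor i).of_iso (PreservesCokernel.iso (tensorRight I) i).symm
    exact this.eq_of_tgt _ _
  exact isIso_of_mono_of_epi _

lemma whiskerRight_self_eq {I : C} (i : I ⟶ 𝟙_ C) [Mono i] :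
    i ▷ I ≫ (λ_ I).hom = I ◁ i ≫ (ρ_ I).hom := by
  rw [← cancel_mono i, Category.assoc, Category.assoc, ← leftUnitor_naturality,
    ← rightUnitor_naturality, whisker_exchange_assoc, unitors_equal]

lemma exists_retraction {I : C} (i : I ⟶ 𝟙_ C) [Mono i] : ∃ r : 𝟙_ C ⟶ I, i ≫ r = 𝟙 I := by
  let D : C := Iᘁ
  -- The transpose of `i`; it is an epimorphism because `i` is a monomorphism.
  let d : 𝟙_ C ⟶ D := η_ I D ≫ i ▷ D ≫ (λ_ D).hom
  have hd : Epi d := by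
    refine Preadditive.epi_of_cancel_zero _ fun {X} g hg => ?_
    have h1 : η_ I D ≫ I ◁ g = 0 := by
      rw [← cancel_mono (i ▷ X), ← cancel_mono (λ_ X).hom]
      simpa [d, whisker_exchange_assoc, ← whisker_exchange] using hg
    have h2 : (tensorLeftHomEquiv (𝟙_ C) I D X) ((ρ_ D).hom ≫ g) = 0 := by
      simp [tensorLeftHomEquiv, h1]
    have h3 : (ρ_ D).hom ≫ g = 0 := by
      apply (tensorLeftHomEquiv (𝟙_ C) I D X).injective
      rw [h2]
      simp [tensorLeftHomEquiv]
    simpa using h3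
  -- Under the adjunction between `- ⊗ I` and `- ⊗ D`, the embedding of `kernel d ⊗ I` into the unit
  -- corresponds to `kernel.ι d ≫ d = 0`.
  have hJI : IsZero (kernel d ⊗ I) := by
    let j := kernel.ι d
    have h0 : ∀ {J : C} (j : J ⟶ 𝟙_ C), (tensorRightHomEquiv J I D (𝟙_ C))
        (j ▷ I ≫ (λ_ I).hom ≫ i) = j ≫ d ≫ (λ_ D).inv := by
      intro J j
      simp only [tensorRightHomEquiv, Equiv.coe_fn_mk, comp_whiskerRight, d, Category.assoc,
        Iso.hom_inv_id, Category.comp_id]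
      rw [← associator_inv_naturality_left_assoc, whisker_exchange_assoc,
        ← rightUnitor_inv_naturality_assoc, ← unitors_inv_equal]
      simp
    have h1 := h0 j
    have h2 : j ▷ I ≫ (λ_ I).hom ≫ i = 0 := by
      apply (tensorRightHomEquiv (kernel d) I D (𝟙_ C)).injective
      rw [h1]
      simp [tensorRightHomEquiv, j]
    have : Mono (j ▷ I ≫ (λ_ I).hom ≫ i) := by infer_instance
    exact IsZero.of_mono_eq_zero _ h2
  -- `K` is a subobject of the unit, hence isomorphic to `K ⊗ K`; erasing the two outer factors
  -- embeds `K ⊗ K` into `kernel d ⊗ I = 0`.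
  have hIJ : IsZero (I ⊗ kernel d) := by
    let K := I ⊗ kernel d
    let k : K ⟶ 𝟙_ C := I ◁ kernel.ι d ≫ (ρ_ I).hom ≫ i
    have : Mono k := by infer_instance
    have hKK : IsZero (K ⊗ K) := by
      let m : K ⊗ K ⟶ kernel d ⊗ I :=
        (i ▷ kernel d ≫ (λ_ _).hom) ▷ K ≫ kernel d ◁ (I ◁ kernel.ι d ≫ (ρ_ I).hom)
      exact IsZero.of_mono m hJI
    exact hKK.of_iso (asIso (k ▷ K) ≪≫ λ_ K).symm
  have hm : Mono (I ◁ d) := Preadditive.mono_of_kernel_zero <| by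
    have := hIJ.of_iso (PreservesKernel.iso (tensorLeft I) d).symm
    exact this.eq_of_src _ _
  have : IsIso (I ◁ d) := isIso_of_mono_of_epi _
  refine ⟨η_ I D ≫ inv (I ◁ d) ≫ (ρ_ I).hom, ?_⟩
  -- The two ways of absorbing `i` into `I ⊗ I` agree by `whiskerRight_self_eq`, so `i` followed by
  -- the coevaluation is `I ◁ d` up to the unitor. Inverting `I ◁ d` then gives the retraction.
  have key : i ≫ η_ I D = (ρ_ I).inv ≫ I ◁ d := by
    have h := whiskerRight_self_eq i
    have h' : i ▷ I = I ◁ i ≫ (ρ_ I).hom ≫ (λ_ I).inv := by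
      rw [← reassoc_of% h]; simp
    calc i ≫ η_ I D = (ρ_ I).inv ≫ I ◁ η_ I D ≫ i ▷ (I ⊗ D) ≫ (λ_ _).hom := by
          rw [whisker_exchange_assoc, ← rightUnitor_inv_naturality_assoc, ← unitors_inv_equal]
          simp
      _ = (ρ_ I).inv ≫ I ◁ η_ I D ≫ (α_ _ _ _).inv ≫ i ▷ I ▷ D ≫ (λ_ I).hom ▷ D := by
          simp
      _ = _ := by
          rw [h']
          simp [d]
  rw [reassoc_of% key]
  simp

end

/-- A decomposition of an object as a finite direct sum of simple objects. -/
def IsSumOfSimples {C : Type u} [Category.{v} C] [Preadditive C] (X : C) : Prop :=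
  ∃ (n : ℕ) (f : Fin n → C) (i : ∀ a, f a ⟶ X) (r : ∀ a, X ⟶ f a),
    (∀ a, Simple (f a)) ∧ (∀ a, i a ≫ r a = 𝟙 _) ∧ (∀ a b, a ≠ b → i a ≫ r b = 0) ∧
      ∑ a, r a ≫ i a = 𝟙 X

section

variable {C : Type u} [Category.{v} C] [Abelian C]

lemma IsSumOfSimples.of_splitting {X Y Z : C} (hY : IsSumOfSimples Y) (hZ : IsSumOfSimples Z)
    (s : Y ⟶ X) (t : X ⟶ Y) (s' : Z ⟶ X) (t' : X ⟶ Z) (h₁ : s ≫ t = 𝟙 _) (h₂ : s' ≫ t' = 𝟙 _)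
    (h₃ : s ≫ t' = 0) (h₄ : s' ≫ t = 0) (h : t ≫ s + t' ≫ s' = 𝟙 X) : IsSumOfSimples X := by
  obtain ⟨n, f, i, r, hf, hir, h0, hs⟩ := hY
  obtain ⟨m, g, j, q, hg, hjq, h0', hs'⟩ := hZ
  let F : Fin n ⊕ Fin m → C := Sum.elim f g
  let I : ∀ a, F a ⟶ X := fun a => match a with
    | .inl a => i a ≫ s
    | .inr a => j a ≫ s'
  let R : ∀ a, X ⟶ F a := fun a => match a with
    | .inl a => t ≫ r a
    | .inr a => t' ≫ q a
  have hF : ∀ a, Simple (F a) := by rintro (a | a); exacts [hf a, hg a]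
  have hIR : ∀ a, I a ≫ R a = 𝟙 _ := by
    rintro (a | a)
    · simp [I, R, F, reassoc_of% h₁, hir]
    · simp [I, R, F, reassoc_of% h₂, hjq]
  have hIR0 : ∀ a b, a ≠ b → I a ≫ R b = 0 := by
    rintro (a | a) (b | b) hab
    · change (i a ≫ s) ≫ t ≫ r b = 0
      simp [reassoc_of% h₁, h0 a b (by simpa using hab)]
    · change (i a ≫ s) ≫ t' ≫ q b = 0
      simp [reassoc_of% h₃]
    · change (j a ≫ s') ≫ t ≫ r b = 0
      simp [reassoc_of% h₄]
    · change (j a ≫ s') ≫ t' ≫ q b = 0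
      simp [reassoc_of% h₂, h0' a b (by simpa using hab)]
  have hS : ∑ a, R a ≫ I a = 𝟙 X := by
    rw [Fintype.sum_sum_type]
    have h1 : ∑ a, R (.inl a) ≫ I (.inl a) = t ≫ (∑ a, r a ≫ i a) ≫ s := by
      rw [Preadditive.sum_comp, Preadditive.comp_sum]
      exact Finset.sum_congr rfl fun a _ => show (t ≫ r a) ≫ i a ≫ s = _ by simp
    have h2 : ∑ a, R (.inr a) ≫ I (.inr a) = t' ≫ (∑ a, q a ≫ j a) ≫ s' := by
      rw [Preadditive.sum_comp, Preadditive.comp_sum]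
      exact Finset.sum_congr rfl fun a _ => show (t' ≫ q a) ≫ j a ≫ s' = _ by simp
    rw [h1, h2, hs, hs']
    simpa using h
  let e := finSumFinEquiv (m := n) (n := m)
  refine ⟨n + m, F ∘ e.symm, fun a => I (e.symm a), fun a => R (e.symm a), fun a => hF _,
    fun a => hIR _, fun a b hab => hIR0 _ _ (by simpa using hab), ?_⟩
  rw [← hS]
  exact Fintype.sum_equiv e.symm _ _ (fun _ => rfl)

lemma isSumOfSimples_of_isZero {X : C} (h : IsZero X) : IsSumOfSimples X :=
  ⟨0, fun a => a.elim0, fun a => a.elim0, fun a => a.elim0, fun a => a.elim0, fun a => a.elim0,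
    fun a => a.elim0, h.eq_of_src _ _⟩

lemma isSumOfSimples_of_simple {X : C} (h : Simple X) : IsSumOfSimples X :=
  ⟨1, fun _ => X, fun _ => 𝟙 X, fun _ => 𝟙 X, fun _ => h, fun _ => by simp,
    fun a b hab => (hab (Subsingleton.elim _ _)).elim, by simp⟩

lemma exists_mono_of_not_simple {X : C} (h0 : ¬ IsZero X) (h : ¬ Simple X) :
    ∃ (Y : C) (f : Y ⟶ X), Mono f ∧ f ≠ 0 ∧ ¬ IsIso f := by
  by_contra! hc
  refine h ⟨fun {Y} f hf => ⟨fun hi h0' => h0 ?_, fun hne => hc Y f hf hne⟩⟩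
  subst h0'
  exact (IsZero.of_epi_eq_zero (0 : Y ⟶ X) rfl)

end

variable {C : Type u} [Category.{v} C] [Abelian C] [MonoidalCategory C] [MonoidalPreadditive C]
  [RigidCategory C] {k : Type w} [Field k] [Linear k C]

/-- Induction on the dimension of the endomorphism space. A proper nonzero subobject `Y` of `X` is
also a subobject of the unit, so its retraction from the unit restricts to `X` and splits `X` as `Y
⊕ Z`. Block-diagonal endomorphisms show that the dimensions for `Y` and `Z`, both positive, add up
to at most that for `X`. -/
lemma isSumOfSimples_of_mono (hfin : ∀ X Y : C, Module.Finite k (X ⟶ Y)) (n : ℕ) {X : C}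
    (i : X ⟶ 𝟙_ C) [Mono i] (hn : Module.finrank k (X ⟶ X) ≤ n) : IsSumOfSimples X := by
  induction n using Nat.strong_induction_on generalizing X with
  | _ n ih =>
  by_cases h0 : IsZero X
  · exact isSumOfSimples_of_isZero h0
  by_cases hs : Simple X
  · exact isSumOfSimples_of_simple hs
  obtain ⟨Y, s, hsm, hs0, hsi⟩ := exists_mono_of_not_simple h0 hs
  obtain ⟨ρ, hρ⟩ := exists_retraction (s ≫ i)
  let t : X ⟶ Y := i ≫ ρ
  have h₁ : s ≫ t = 𝟙 Y := by simpa [t] using hρ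
  let Z := kernel t
  let s' : Z ⟶ X := kernel.ι t
  let t' : X ⟶ Z := kernel.lift t (𝟙 X - t ≫ s) (by simp [h₁])
  have ht's' : t' ≫ s' = 𝟙 X - t ≫ s := kernel.lift_ι _ _ _
  have hs't : s' ≫ t = 0 := kernel.condition t
  have h₂ : s' ≫ t' = 𝟙 Z := by
    rw [← cancel_mono s', Category.assoc, ht's']
    simp [reassoc_of% hs't]
  have h₃ : s ≫ t' = 0 := by
    rw [← cancel_mono s', Category.assoc, ht's']
    simp [reassoc_of% h₁]
  have htot : t ≫ s + t' ≫ s' = 𝟙 X := by rw [ht's']; abel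
  have hYz : ¬ IsZero Y := fun h => hs0 (h.eq_of_src _ _)
  have hZz : ¬ IsZero Z := by
    intro h
    have h5 : t ≫ s = 𝟙 X := by
      rw [← htot, h.eq_of_tgt t' 0]
      simp
    exact hsi ⟨t, h₁, h5⟩
  have pos : ∀ W : C, ¬ IsZero W → 0 < Module.finrank k (W ⟶ W) := by
    intro W hW
    have : Nontrivial (W ⟶ W) := ⟨𝟙 W, 0, fun h => hW ((IsZero.iff_id_eq_zero W).2 h)⟩
    have := hfin W W
    exact Module.finrank_pos
  have hle : Module.finrank k (Y ⟶ Y) + Module.finrank k (Z ⟶ Z) ≤ Module.finrank k (X ⟶ X) := by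
    have := hfin X X
    have := hfin Y Y
    have := hfin Z Z
    rw [← Module.finrank_prod]
    let φ : (Y ⟶ Y) × (Z ⟶ Z) →ₗ[k] (X ⟶ X) :=
      { toFun := fun p => t ≫ p.1 ≫ s + t' ≫ p.2 ≫ s'
        map_add' := fun p q => by simp; abel
        map_smul' := fun c p => by simp }
    refine LinearMap.finrank_le_finrank_of_injective (f := φ) ?_
    rw [← LinearMap.ker_eq_bot, LinearMap.ker_eq_bot']
    rintro ⟨f, g⟩ h
    have h' : t ≫ f ≫ s + t' ≫ g ≫ s' = 0 := h
    have hf := congrArg (fun m => s ≫ m ≫ t) h'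
    have hg := congrArg (fun m => s' ≫ m ≫ t') h'
    simp only [Preadditive.add_comp, Preadditive.comp_add, Category.assoc, reassoc_of% h₁,
      reassoc_of% h₃, h₁, hs't, zero_comp, comp_zero, add_zero, Category.comp_id] at hf
    simp only [Preadditive.add_comp, Preadditive.comp_add, Category.assoc, reassoc_of% h₂,
      reassoc_of% hs't, h₂, h₃, zero_comp, comp_zero, zero_add, Category.comp_id] at hg
    exact Prod.ext hf hg
  have hY := pos Y hYz
  have hZ := pos Z hZz
  exact (ih (n - 1) (by omega) (s ≫ i) (by omega)).of_splitting
    (ih (n - 1) (by omega) (s' ≫ i) (by omega)) s t s' t' h₁ h₂ h₃ hs't htot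

theorem exists_unitDecomposition (hfin : ∀ X Y : C, Module.Finite k (X ⟶ Y)) :
    ∃ n : ℕ, Nonempty (UnitDecomposition C (Fin n)) := by
  obtain ⟨n, f, i, r, hf, hir, h0, hs⟩ := isSumOfSimples_of_mono hfin _ (𝟙 (𝟙_ C)) le_rfl
  let b : Bicone f :=
    { pt := 𝟙_ C
      ι := i
      π := r
      ι_π := fun a c => by
        split_ifs with h
        · subst h; simpa using hir a
        · exact h0 a c h }
  exact ⟨n, ⟨⟨f, hf, b, isBilimitOfTotal b hs, Iso.refl _⟩⟩⟩

end UnitSemisimple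
/-! ### The two actions of the endomorphisms of the unit -/

namespace UnitSummand

section Act

variable {C : Type u} [Category.{v} C] [MonoidalCategory C]

/-- The action on `X` of an endomorphism of the unit, from the left. -/
def lact (p : 𝟙_ C ⟶ 𝟙_ C) (X : C) : X ⟶ X := (λ_ X).inv ≫ p ▷ X ≫ (λ_ X).hom

/-- The action on `X` of an endomorphism of the unit, from the right. -/
def ract (p : 𝟙_ C ⟶ 𝟙_ C) (X : C) : X ⟶ X := (ρ_ X).inv ≫ X ◁ p ≫ (ρ_ X).hom

lemma lact_naturality (p : 𝟙_ C ⟶ 𝟙_ C) {X Y : C} (f : X ⟶ Y) :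
    f ≫ lact p Y = lact p X ≫ f := by
  simp only [lact, Category.assoc]
  rw [leftUnitor_inv_naturality_assoc, whisker_exchange_assoc, leftUnitor_naturality]

lemma ract_naturality (p : 𝟙_ C ⟶ 𝟙_ C) {X Y : C} (f : X ⟶ Y) :
    f ≫ ract p Y = ract p X ≫ f := by
  simp only [ract, Category.assoc]
  rw [rightUnitor_inv_naturality_assoc, ← whisker_exchange_assoc, rightUnitor_naturality]

lemma lact_id (X : C) : lact (𝟙 (𝟙_ C)) X = 𝟙 X := by simp [lact]

lemma lact_comp (p q : 𝟙_ C ⟶ 𝟙_ C) (X : C) : lact (p ≫ q) X = lact p X ≫ lact q X := by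
  simp [lact]

lemma lact_tensor (p : 𝟙_ C ⟶ 𝟙_ C) (X Y : C) : lact p (X ⊗ Y) = lact p X ▷ Y := by
  simp [lact]

lemma ract_tensor (p : 𝟙_ C ⟶ 𝟙_ C) (X Y : C) : ract p (X ⊗ Y) = X ◁ ract p Y := by
  simp [ract]

/-- The triangle identity: an endomorphism of the unit inserted between two tensor factors can be
read as acting on either of them. -/
lemma whiskerRight_ract (p : 𝟙_ C ⟶ 𝟙_ C) (X Y : C) : ract p X ▷ Y = X ◁ lact p Y := by
  simp [ract, lact]

variable {e f : C}

/-- Membership becomes an equation between natural endomorphisms, and so passes to subobjects,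
quotients, limits and duals. -/
lemma row_iff (s : Retract e (𝟙_ C)) (X : C) : row s X ↔ lact (s.r ≫ s.i) X = 𝟙 X := by
  constructor
  · intro h
    simp [lact, idem_whiskerRight h]
  · intro h
    refine ⟨X, ⟨⟨(λ_ X).inv ≫ s.r ▷ X, s.i ▷ X ≫ (λ_ X).hom, ?_, ?_⟩⟩⟩
    · simpa [lact] using h
    · simp [← comp_whiskerRight]

lemma column_iff (s : Retract e (𝟙_ C)) (X : C) : column s X ↔ ract (s.r ≫ s.i) X = 𝟙 X := by
  constructor
  · intro h
    simp [ract, whiskerLeft_idem h]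
  · intro h
    refine ⟨X, ⟨⟨(ρ_ X).inv ≫ X ◁ s.r, X ◁ s.i ≫ (ρ_ X).hom, ?_, ?_⟩⟩⟩
    · simpa [ract] using h
    · simp [← MonoidalCategory.whiskerLeft_comp]

lemma unitMap_counitMap_eq (s : Retract e (𝟙_ C)) (t : Retract f (𝟙_ C)) (X : C) :
    unitMap s t X ≫ counitMap s t X = ract (t.r ≫ t.i) X ≫ lact (s.r ≫ s.i) X := by
  have h : X ◁ t.r ≫ lact (s.r ≫ s.i) (X ⊗ f) ≫ X ◁ t.i ≫ (ρ_ X).hom =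
      X ◁ (t.r ≫ t.i) ≫ (ρ_ X).hom ≫ lact (s.r ≫ s.i) X := by
    rw [lact_naturality, ← reassoc_of% (lact_naturality (s.r ≫ s.i) (X ◁ t.i))]
    simp [lact_naturality]
  simpa [lact, ract, unitMap, counitMap] using (ρ_ X).inv ≫= h

/-- Source of the orthogonality of distinct blocks: one of `s.i ≫ s'.r` and `t.i ≫ t'.r` vanishes
when the pairs of summands differ. -/
lemma counitMap_unitMap' {e' f' : C} (s : Retract e (𝟙_ C)) (t : Retract f (𝟙_ C))
    (s' : Retract e' (𝟙_ C)) (t' : Retract f' (𝟙_ C)) (X : C) :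
    counitMap s t X ≫ unitMap s' t' X = (s.i ≫ s'.r) ⊗ₘ (X ◁ (t.i ≫ t'.r)) := by
  simp only [counitMap, unitMap, MonoidalCategory.tensorHom_def', Category.assoc,
    Iso.hom_inv_id_assoc, MonoidalCategory.whiskerLeft_comp, comp_whiskerRight]
  rw [← leftUnitor_naturality_assoc, ← leftUnitor_naturality_assoc, Iso.hom_inv_id_assoc,
    whisker_exchange_assoc, whisker_exchange_assoc]

lemma corner_iff (s : Retract e (𝟙_ C)) (t : Retract f (𝟙_ C)) (X : C) :
    corner s t X ↔ ract (t.r ≫ t.i) X ≫ lact (s.r ≫ s.i) X = 𝟙 X := by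
  rw [← unitMap_counitMap_eq]
  exact ⟨fun h => unitMap_counitMap h,
    fun h => ⟨X, ⟨⟨unitMap s t X, counitMap s t X, h, counitMap_unitMap s t X⟩⟩⟩⟩

lemma corner_iff_row_column (s : Retract e (𝟙_ C)) (t : Retract f (𝟙_ C)) (X : C) :
    corner s t X ↔ row s X ∧ column t X := by
  refine ⟨fun h => ⟨corner_le_row s t X h, corner_le_column s t X h⟩, fun ⟨h, h'⟩ => ?_⟩
  rw [row_iff] at h
  rw [column_iff] at h'
  rw [corner_iff, h, h', Category.comp_id]

lemma row_self (s : Retract e (𝟙_ C)) : row s e := corner_le_row s s e (corner_self s)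

lemma column_self (s : Retract e (𝟙_ C)) : column s e := corner_le_column s s e (corner_self s)

lemma column_tensor {t : Retract f (𝟙_ C)} (X : C) {Y : C} (h : column t Y) :
    column t (X ⊗ Y) := by
  rw [column_iff] at h ⊢
  rw [ract_tensor, h, MonoidalCategory.whiskerLeft_id]

lemma row_tensor_self (s : Retract e (𝟙_ C)) (X : C) : row s (e ⊗ X) := row_tensor (row_self s) X

lemma column_tensor_self (s : Retract e (𝟙_ C)) (X : C) : column s (X ⊗ e) :=
  column_tensor X (column_self s)

variable {X Y : C} [ExactPairing X Y]

lemma evaluation_act (p : 𝟙_ C ⟶ 𝟙_ C) :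
    ract p Y ▷ X ≫ ε_ X Y = Y ◁ lact p X ≫ ε_ X Y := by
  rw [whiskerRight_ract]

lemma coevaluation_act (p : 𝟙_ C ⟶ 𝟙_ C) :
    η_ X Y ≫ ract p X ▷ Y = η_ X Y ≫ X ◁ lact p Y := by
  rw [whiskerRight_ract]

/-- The triangle identity recovers an endomorphism from its pairing with the evaluation. The three
variants that follow are the same statement for the other side and for the coevaluation. -/
lemma eq_of_evaluation_whiskerRight {f g : Y ⟶ Y}
    (h : f ▷ X ≫ ε_ X Y = g ▷ X ≫ ε_ X Y) : f = g := by
  have key : ∀ f : Y ⟶ Y, f = (ρ_ Y).inv ≫ Y ◁ η_ X Y ≫ (α_ _ _ _).inv ≫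
      (f ▷ X ≫ ε_ X Y) ▷ Y ≫ (λ_ Y).hom := fun f => by
    rw [comp_whiskerRight_assoc, ← associator_inv_naturality_left_assoc, whisker_exchange_assoc,
      ← rightUnitor_inv_naturality_assoc, ExactPairing.coevaluation_evaluation_assoc]
    simp
  rw [key f, key g, h]

lemma eq_of_evaluation_whiskerLeft {f g : X ⟶ X}
    (h : Y ◁ f ≫ ε_ X Y = Y ◁ g ≫ ε_ X Y) : f = g := by
  have key : ∀ f : X ⟶ X, f = (λ_ X).inv ≫ η_ X Y ▷ X ≫ (α_ _ _ _).hom ≫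
      X ◁ (Y ◁ f ≫ ε_ X Y) ≫ (ρ_ X).hom := fun f => by
    rw [MonoidalCategory.whiskerLeft_comp_assoc, ← associator_naturality_right_assoc,
      ← whisker_exchange_assoc, ← leftUnitor_inv_naturality_assoc,
      ExactPairing.evaluation_coevaluation_assoc]
    simp
  rw [key f, key g, h]

lemma eq_of_coevaluation_whiskerRight {f g : X ⟶ X}
    (h : η_ X Y ≫ f ▷ Y = η_ X Y ≫ g ▷ Y) : f = g := by
  have key : ∀ f : X ⟶ X, f = (λ_ X).inv ≫ (η_ X Y ≫ f ▷ Y) ▷ X ≫ (α_ _ _ _).hom ≫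
      X ◁ ε_ X Y ≫ (ρ_ X).hom := fun f => by
    rw [comp_whiskerRight_assoc, associator_naturality_left_assoc, ← whisker_exchange_assoc,
      ExactPairing.evaluation_coevaluation_assoc, rightUnitor_naturality]
    simp
  rw [key f, key g, h]

lemma eq_of_coevaluation_whiskerLeft {f g : Y ⟶ Y}
    (h : η_ X Y ≫ X ◁ f = η_ X Y ≫ X ◁ g) : f = g := by
  have key : ∀ f : Y ⟶ Y, f = (ρ_ Y).inv ≫ Y ◁ (η_ X Y ≫ X ◁ f) ≫ (α_ _ _ _).inv ≫
      ε_ X Y ▷ Y ≫ (λ_ Y).hom := fun f => by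
    rw [MonoidalCategory.whiskerLeft_comp_assoc, associator_inv_naturality_right_assoc,
      whisker_exchange_assoc, ExactPairing.coevaluation_evaluation_assoc, leftUnitor_naturality]
    simp
  rw [key f, key g, h]

variable (X Y)

/-- The evaluation exchanges the left action on `X` with the right action on `Y` (`evaluation_act`),
and an endomorphism is determined by its pairing with the evaluation. -/
lemma row_iff_column_dual (s : Retract e (𝟙_ C)) : row s X ↔ column s Y := by
  rw [row_iff, column_iff]
  constructor
  · intro h
    apply eq_of_evaluation_whiskerRight (X := X)
    rw [evaluation_act, h]
    simp
  · intro h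
    apply eq_of_evaluation_whiskerLeft (Y := Y)
    rw [← evaluation_act, h]
    simp

lemma column_iff_row_dual (s : Retract e (𝟙_ C)) : column s X ↔ row s Y := by
  rw [row_iff, column_iff]
  constructor
  · intro h
    apply eq_of_coevaluation_whiskerLeft (X := X)
    rw [← coevaluation_act, h]
    simp
  · intro h
    apply eq_of_coevaluation_whiskerRight (Y := Y)
    rw [coevaluation_act, h]
    simp

end Act

/-- A direct summand of the unit is self-dual. -/
abbrev exactPairingSelf {C : Type u} [Category.{v} C] [MonoidalCategory C] {e : C}
    (s : Retract e (𝟙_ C)) : ExactPairing e e where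
  coevaluation' := s.r ≫ (λ_ e).inv ≫ s.r ▷ e
  evaluation' := e ◁ s.i ≫ (ρ_ e).hom ≫ s.i
  coevaluation_evaluation' := by
    -- The idempotent of the unit cut out by `s` acts as the identity on `e`; this is what collapses
    -- both triangle identities.
    have h := idem_whiskerRight_self s
    rw [comp_whiskerRight] at h
    calc _ = e ◁ s.r ≫ e ◁ (λ_ e).inv ≫ e ◁ (s.r ▷ e ≫ s.i ▷ e) ≫ (α_ _ _ _).inv ≫
          (ρ_ e).hom ▷ e ≫ s.i ▷ e := by simp
      _ = e ◁ s.r ≫ s.i ▷ e := by rw [h]; simp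
      _ = _ := by
        have h3 : (ρ_ (𝟙_ C)).inv ≫ (λ_ (𝟙_ C)).hom = 𝟙 _ := by simp [unitors_equal]
        rw [whisker_exchange]
        simp [reassoc_of% h3]
  evaluation_coevaluation' := by
    have h := idem_whiskerRight_self s
    rw [comp_whiskerRight] at h
    have h1 : e ◁ s.i ≫ (ρ_ e).hom ≫ s.i = s.i ▷ e ≫ (λ_ e).hom ≫ s.i := by
      rw [← rightUnitor_naturality, whisker_exchange_assoc, ← leftUnitor_naturality, unitors_equal]
    have h2 : (s.r ≫ (λ_ e).inv ≫ s.r ▷ e) ▷ e ≫ (α_ _ _ _).hom ≫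
        e ◁ (s.i ▷ e ≫ (λ_ e).hom ≫ s.i) =
        s.r ▷ e ≫ (λ_ (e ⊗ e)).inv ≫ s.r ▷ (e ⊗ e) ≫ e ◁ s.i ▷ e ≫ e ◁ (λ_ e).hom ≫ e ◁ s.i := by
      simp
    have h3 : (λ_ (𝟙_ C)).inv ≫ (ρ_ (𝟙_ C)).hom = 𝟙 _ := by
      rw [← unitors_equal, Iso.inv_hom_id]
    rw [h1, h2, ← whisker_exchange_assoc, ← leftUnitor_inv_naturality_assoc, reassoc_of% h,
      ← whisker_exchange_assoc, ← leftUnitor_inv_naturality_assoc, Iso.hom_inv_id_assoc,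
      ← whisker_exchange]
    simp [reassoc_of% h3]

/-! ### Rows, columns and corners are abelian -/

section Fixed

variable {C : Type u} [Category.{v} C]

/-- A property of objects which says that an endomorphism of the identity functor acts as the
identity. -/
def IsFixedBy (P : ObjectProperty C) (θ : ∀ X : C, X ⟶ X) : Prop :=
  (∀ {X Y : C} (f : X ⟶ Y), f ≫ θ Y = θ X ≫ f) ∧ ∀ X, P X ↔ θ X = 𝟙 X

lemma IsFixedBy.isClosedUnderSubobjects {P : ObjectProperty C} {θ : ∀ X : C, X ⟶ X}
    (h : IsFixedBy P θ) : P.IsClosedUnderSubobjects where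
  prop_of_mono {X Y} f _ hY := by
    rw [h.2] at hY ⊢
    rw [← cancel_mono f, ← h.1, hY]
    simp

lemma IsFixedBy.isClosedUnderQuotients {P : ObjectProperty C} {θ : ∀ X : C, X ⟶ X}
    (h : IsFixedBy P θ) : P.IsClosedUnderQuotients where
  prop_of_epi {X Y} f _ hX := by
    rw [h.2] at hX ⊢
    rw [← cancel_epi f, h.1, hX]
    simp

lemma IsFixedBy.isClosedUnderLimitsOfShape {P : ObjectProperty C} {θ : ∀ X : C, X ⟶ X}
    (h : IsFixedBy P θ) (J : Type v₁) [Category.{u₁} J] : P.IsClosedUnderLimitsOfShape J where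
  limitsOfShape_le := by
    rintro X ⟨hX⟩
    rw [h.2]
    refine hX.isLimit.hom_ext fun j => ?_
    have hj := (h.2 _).1 (hX.prop_diag_obj j)
    have := h.1 (hX.π.app j)
    rw [hj] at this
    simpa using this.symm

lemma IsFixedBy.isClosedUnderFiniteProducts {P : ObjectProperty C} {θ : ∀ X : C, X ⟶ X}
    (h : IsFixedBy P θ) : P.IsClosedUnderFiniteProducts where
  isClosedUnderLimitsOfShape _ _ := h.isClosedUnderLimitsOfShape _

lemma IsFixedBy.prop_of_isZero {P : ObjectProperty C} {θ : ∀ X : C, X ⟶ X}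
    (h : IsFixedBy P θ) {X : C} (hX : IsZero X) : P X := by
  rw [h.2]
  exact hX.eq_of_src _ _

lemma IsFixedBy.containsZero [HasZeroObject C] {P : ObjectProperty C} {θ : ∀ X : C, X ⟶ X}
    (h : IsFixedBy P θ) : P.ContainsZero where
  exists_zero := ⟨_, isZero_zero C, h.prop_of_isZero (isZero_zero C)⟩

/-- The full subcategory on which an endomorphism of the identity functor acts as the identity is
abelian. -/
noncomputable abbrev IsFixedBy.abelian {C : Type u} [Category.{v} C] [Abelian C]
    {P : ObjectProperty C} {θ : ∀ X : C, X ⟶ X} (h : IsFixedBy P θ) :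
    Abelian P.FullSubcategory :=
  have := h.isClosedUnderSubobjects
  have := h.isClosedUnderQuotients
  have := h.isClosedUnderFiniteProducts
  have := h.containsZero
  inferInstance

end Fixed

section

variable {C : Type u} [Category.{v} C] [MonoidalCategory C] {e f : C}

lemma row_isFixedBy (s : Retract e (𝟙_ C)) : IsFixedBy (row s) (lact (s.r ≫ s.i)) :=
  ⟨lact_naturality _, row_iff s⟩

lemma column_isFixedBy (t : Retract f (𝟙_ C)) : IsFixedBy (column t) (ract (t.r ≫ t.i)) :=
  ⟨ract_naturality _, column_iff t⟩

lemma corner_isFixedBy (s : Retract e (𝟙_ C)) (t : Retract f (𝟙_ C)) :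
    IsFixedBy (corner s t) (fun X => ract (t.r ≫ t.i) X ≫ lact (s.r ≫ s.i) X) :=
  ⟨fun g => by rw [reassoc_of% (ract_naturality (t.r ≫ t.i) g), lact_naturality, Category.assoc], corner_iff s t⟩

end

noncomputable instance abelianRow {C : Type u} [Category.{v} C] [Abelian C] [MonoidalCategory C]
    {e : C} (s : Retract e (𝟙_ C)) : Abelian (Row s) := (row_isFixedBy s).abelian

noncomputable instance abelianCorner {C : Type u} [Category.{v} C] [Abelian C]
    [MonoidalCategory C] {e f : C} (s : Retract e (𝟙_ C)) (t : Retract f (𝟙_ C)) :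
    Abelian (Corner s t) := (corner_isFixedBy s t).abelian

end UnitSummand

/-! ### Decomposing a category along orthogonal idempotents of the identity functor -/

section Split

variable {C : Type u} [Category.{v} C] [Preadditive C] [HasFiniteBiproducts C] {Λ : Type u₁}
  [Finite Λ] {D : Λ → Type u₂} [∀ a, Category.{v₂} (D a)] (J : ∀ a, D a ⥤ C)
  [∀ a, (J a).Full] [∀ a, (J a).Faithful] (T : ∀ a, C ⥤ D a)
  (m : ∀ a (X : C), X ⟶ (J a).obj ((T a).obj X)) (c : ∀ a (X : C), (J a).obj ((T a).obj X) ⟶ X)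

/-- The maps `m a X ≫ c a X` are orthogonal natural idempotents with sum one, and the `a`-th one has
image `T a X`. A morphism is then the sum of its diagonal components, and a family of objects is
recovered from its biproduct. -/
theorem isEquivalence_pi'_of_splitting
    (hm : ∀ a {X Y : C} (f : X ⟶ Y), f ≫ m a Y = m a X ≫ (J a).map ((T a).map f))
    (hc : ∀ a {X Y : C} (f : X ⟶ Y), (J a).map ((T a).map f) ≫ c a Y = c a X ≫ f)
    (hcm : ∀ a X, c a X ≫ m a X = 𝟙 _) (h0 : ∀ a b X, a ≠ b → c a X ≫ m b X = 0)
    (hs : ∀ [Fintype Λ] (X : C), ∑ a, m a X ≫ c a X = 𝟙 X)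
    (hP : ∀ a (Y : D a), m a ((J a).obj Y) ≫ c a ((J a).obj Y) = 𝟙 _) :
    (Functor.pi' T).IsEquivalence := by
  classical
  have := Fintype.ofFinite Λ
  have faithful : (Functor.pi' T).Faithful := ⟨fun {X Y} f g h => by
    rw [← Category.id_comp f, ← Category.id_comp g, ← hs X, Preadditive.sum_comp,
      Preadditive.sum_comp]
    refine Finset.sum_congr rfl fun a _ => ?_
    have ha : (T a).map f = (T a).map g := congrFun h a
    rw [Category.assoc, Category.assoc, ← hc, ← hc, ha]⟩
  have full : (Functor.pi' T).Full := ⟨fun {X Y} φ => by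
    let ψ : ∀ a, (T a).obj X ⟶ (T a).obj Y := fun a => φ a
    refine ⟨∑ a, m a X ≫ (J a).map (ψ a) ≫ c a Y, funext fun a => (J a).map_injective ?_⟩
    have key : ∀ g : X ⟶ Y, (J a).map ((T a).map g) = c a X ≫ g ≫ m a Y := fun g => by
      rw [← reassoc_of% hc, hcm, Category.comp_id]
    change (J a).map ((T a).map (∑ a, m a X ≫ (J a).map (ψ a) ≫ c a Y)) = (J a).map (ψ a)
    rw [key, Preadditive.sum_comp, Preadditive.comp_sum, Finset.sum_eq_single a]
    · rw [Category.assoc, Category.assoc, reassoc_of% (hcm a X), hcm, Category.comp_id]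
    · intro b _ hb
      have := h0 a b X hb.symm
      simp [reassoc_of% this]
    · simp⟩
  have essSurj : (Functor.pi' T).EssSurj := ⟨fun Y => by
    let F : Λ → C := fun a => (J a).obj (Y a)
    let X : C := ⨁ F
    have htot : ∑ b, biproduct.π F b ≫ biproduct.ι F b = 𝟙 X :=
      IsBilimit.total (biproduct.isBilimit _)
    -- The `a`-part of the biproduct does not meet the other summands, since `c a` vanishes on the
    -- objects of `D b`.
    have hcπ : ∀ a b, a ≠ b → c a X ≫ biproduct.π F b = 0 := by
      intro a b hab
      rw [← hc a]
      have h1 : c a (F b) = 0 := by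
        rw [← Category.comp_id (c a (F b)), ← hP b (Y b), ← Category.assoc, h0 a b _ hab,
          zero_comp]
      rw [h1, comp_zero]
    have i : ∀ a, (T a).obj X ≅ Y a := fun a => (J a).preimageIso
      { hom := c a X ≫ biproduct.π F a
        inv := biproduct.ι F a ≫ m a X
        hom_inv_id := by
          have h1 : c a X ≫ (∑ b, biproduct.π F b ≫ biproduct.ι F b) ≫ m a X = 𝟙 _ := by
            rw [htot, Category.id_comp, hcm]
          rw [Preadditive.sum_comp, Preadditive.comp_sum, Finset.sum_eq_single a] at h1
          · simpa using h1
          · intro b _ hb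
            rw [Category.assoc, reassoc_of% (hcπ a b hb.symm), zero_comp]
          · simp
        inv_hom_id := by
          have h1 : (J a).map ((T a).map (biproduct.ι F a)) ≫
              (J a).map ((T a).map (biproduct.π F a)) = 𝟙 _ := by
            rw [← Functor.map_comp, ← Functor.map_comp, biproduct.ι_π_self]
            simp
          rw [Category.assoc, ← hc a, reassoc_of% hm a, reassoc_of% h1, hP a (Y a)] }
    exact ⟨X, ⟨Pi.isoMk i⟩⟩⟩
  exact { }

end Split
/-! ### The blocks of a decomposition of the unit -/

namespace UnitDecomposition

open UnitSummand

section

variable {C : Type u} [Category.{v} C] [Preadditive C] [MonoidalCategory C] {Λ : Type u₁}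
  (d : UnitDecomposition C Λ)

/-- The idempotent endomorphism of the unit which corresponds to the summand `e i`. -/
def idem (i : Λ) : 𝟙_ C ⟶ 𝟙_ C := (d.summand i).r ≫ (d.summand i).i

lemma summand_i_r {i j : Λ} (h : i ≠ j) : (d.summand i).i ≫ (d.summand j).r = 0 := by
  simp [d.bicone.ι_π, h]

lemma idem_comp_idem {i j : Λ} (h : i ≠ j) : d.idem i ≫ d.idem j = 0 := by
  have := d.summand_i_r h
  simp only [idem, Category.assoc, reassoc_of% this, zero_comp, comp_zero]

lemma sum_idem [Fintype Λ] : ∑ i, d.idem i = 𝟙 (𝟙_ C) := by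
  have h : ∀ i, d.idem i = d.iso.inv ≫ (d.bicone.π i ≫ d.bicone.ι i) ≫ d.iso.hom := fun i => by
    simp [idem]
  simp only [h]
  rw [← Preadditive.comp_sum, ← Preadditive.sum_comp, IsBilimit.total d.isBilimit]
  simp

variable [MonoidalPreadditive C]

lemma sum_lact [Fintype Λ] (X : C) : ∑ i, lact (d.idem i) X = 𝟙 X := by
  simp only [lact]
  rw [← Preadditive.comp_sum, ← Preadditive.sum_comp, ← sum_whiskerRight, sum_idem]
  simp

lemma sum_ract [Fintype Λ] (X : C) : ∑ i, ract (d.idem i) X = 𝟙 X := by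
  simp only [ract]
  rw [← Preadditive.comp_sum, ← Preadditive.sum_comp, ← whiskerLeft_sum, sum_idem]
  simp

lemma lact_zero (X : C) : lact 0 X = 0 := by simp [lact]

/-- `e i ⊗ e j` is a retract of `e j` whose idempotent is the left action of `d.idem i`. As `d.idem
j` acts on `e j` as the identity, this is the action of `d.idem i ≫ d.idem j = 0`. -/
lemma isZero_tensor {i j : Λ} (h : i ≠ j) : IsZero (d.e i ⊗ d.e j) := by
  let m : d.e i ⊗ d.e j ⟶ d.e j := (d.summand i).i ▷ d.e j ≫ (λ_ _).hom
  let m' : d.e j ⟶ d.e i ⊗ d.e j := (λ_ _).inv ≫ (d.summand i).r ▷ d.e j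
  have hm : m ≫ m' = 𝟙 _ := by
    simp only [m, m', Category.assoc, Iso.hom_inv_id_assoc, ← comp_whiskerRight, Retract.retract,
      id_whiskerRight]
  have h0 : m' ≫ m = 0 := by
    have hj := (row_iff _ _).1 (row_self (d.summand j))
    have : m' ≫ m = lact (d.idem i) (d.e j) := by simp [m, m', lact, idem]
    rw [this, ← Category.comp_id (lact _ _), ← hj, ← lact_comp]
    exact (congrArg (fun p => lact p (d.e j)) (d.idem_comp_idem h)).trans (lact_zero _)
  have h1 : m = 0 := by
    rw [← Category.id_comp m, ← hm, Category.assoc, h0, comp_zero]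
  rw [IsZero.iff_id_eq_zero, ← hm, h1, zero_comp]

/-- The identity of `X` is the sum of the right actions of the idempotents, the `i`-th of which
factors through `X ⊗ e i`. -/
lemma isZero_of_forall_tensorRight [Finite Λ] {X : C} (h : ∀ i, IsZero (X ⊗ d.e i)) :
    IsZero X := by
  have := Fintype.ofFinite Λ
  rw [IsZero.iff_id_eq_zero, ← d.sum_ract X]
  refine Finset.sum_eq_zero fun i _ => ?_
  have h0 : X ◁ (d.summand i).i = 0 := (h i).eq_of_src _ _
  simp only [ract, idem, MonoidalCategory.whiskerLeft_comp, h0, zero_comp, comp_zero]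

lemma counitMap_unitMap_ne {i j i' j' : Λ} (h : (i, j) ≠ (i', j')) (X : C) :
    counitMap (d.summand i) (d.summand j) X ≫ unitMap (d.summand i') (d.summand j') X = 0 := by
  rw [counitMap_unitMap']
  by_cases hi : i = i'
  · rw [d.summand_i_r (fun hj : j = j' => h (Prod.ext hi hj))]
    simp
  · rw [d.summand_i_r hi]
    simp

theorem isEquivalence_toCorner [HasFiniteBiproducts C] [Finite Λ] :
    (Functor.pi' fun p : Λ × Λ => toCorner (d.summand p.1) (d.summand p.2)).IsEquivalence := by
  refine isEquivalence_pi'_of_splitting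
    (fun p : Λ × Λ => (corner (d.summand p.1) (d.summand p.2)).ι) _
    (fun p X => unitMap (d.summand p.1) (d.summand p.2) X)
    (fun p X => counitMap (d.summand p.1) (d.summand p.2) X)
    (fun p _ _ f => unitMap_naturality _ _ f) (fun p _ _ f => counitMap_naturality _ _ f)
    (fun p X => counitMap_unitMap _ _ X) (fun p q X hpq => d.counitMap_unitMap_ne hpq X) ?_
    (fun p Y => unitMap_counitMap Y.property)
  intro _ X
  let _ : Fintype Λ := Fintype.ofFinite Λ
  have h : ∀ p : Λ × Λ, unitMap (d.summand p.1) (d.summand p.2) X ≫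
      counitMap (d.summand p.1) (d.summand p.2) X =
      ract (d.idem p.2) X ≫ lact (d.idem p.1) X := fun p => unitMap_counitMap_eq _ _ _
  refine (Fintype.sum_congr _ _ h).trans ?_
  have huniv : (Finset.univ : Finset (Λ × Λ)) = Finset.univ ×ˢ Finset.univ := by
    ext
    simp
  rw [huniv, Finset.sum_product_right]
  simp_rw [← Preadditive.comp_sum, sum_lact, Category.comp_id, sum_ract]

theorem isEquivalence_rowToCorner {C : Type u} [Category.{v} C] [Abelian C]
    [MonoidalCategory C] [MonoidalPreadditive C] {Λ : Type u₁} [Finite Λ]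
    (d : UnitDecomposition C Λ) (i : Λ) :
    (Functor.pi' fun j => rowToCorner (d.summand i) (d.summand j)).IsEquivalence := by
  have : HasFiniteBiproducts (Row (d.summand i)) := Abelian.hasFiniteBiproducts
  refine isEquivalence_pi'_of_splitting
    (fun j => ObjectProperty.ιOfLE (corner_le_row (d.summand i) (d.summand j))) _
    (fun j X => ObjectProperty.homMk ((ρ_ X.obj).inv ≫ X.obj ◁ (d.summand j).r))
    (fun j X => ObjectProperty.homMk (X.obj ◁ (d.summand j).i ≫ (ρ_ X.obj).hom))
    (fun j X Y f => ?_) (fun j X Y f => ?_) (fun j X => ?_) (fun j l X hjl => ?_) ?_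
    (fun j Y => ?_)
  · ext
    change f.hom ≫ (ρ_ _).inv ≫ _ ◁ (d.summand j).r =
      ((ρ_ _).inv ≫ _ ◁ (d.summand j).r) ≫ f.hom ▷ d.e j
    rw [rightUnitor_inv_naturality_assoc, ← whisker_exchange, Category.assoc]
  · ext
    change f.hom ▷ d.e j ≫ _ ◁ (d.summand j).i ≫ (ρ_ _).hom =
      (_ ◁ (d.summand j).i ≫ (ρ_ _).hom) ≫ f.hom
    rw [← whisker_exchange_assoc, rightUnitor_naturality, Category.assoc]
  · ext
    change (X.obj ◁ (d.summand j).i ≫ (ρ_ _).hom) ≫ (ρ_ _).inv ≫ X.obj ◁ (d.summand j).r = 𝟙 _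
    simp only [Category.assoc, Iso.hom_inv_id_assoc, ← MonoidalCategory.whiskerLeft_comp,
      Retract.retract, MonoidalCategory.whiskerLeft_id]
  · ext
    change (X.obj ◁ (d.summand j).i ≫ (ρ_ _).hom) ≫ (ρ_ _).inv ≫ X.obj ◁ (d.summand l).r = 0
    simp only [Category.assoc, Iso.hom_inv_id_assoc, ← MonoidalCategory.whiskerLeft_comp,
      d.summand_i_r hjl, MonoidalPreadditive.whiskerLeft_zero]
  · intro _ X
    ext
    refine Eq.trans ?_ (d.sum_ract X.obj)
    refine ((row (d.summand i)).ι.map_sum _ _).trans (Fintype.sum_congr _ _ fun j => ?_)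
    change ((ρ_ _).inv ≫ _ ◁ (d.summand j).r) ≫ _ ◁ (d.summand j).i ≫ (ρ_ _).hom = _
    simp [ract, idem]
  · ext
    change ((ρ_ _).inv ≫ _ ◁ (d.summand j).r) ≫ _ ◁ (d.summand j).i ≫ (ρ_ _).hom = 𝟙 _
    simpa [ract] using (column_iff _ _).1 (corner_le_column _ _ _ Y.property)

end

/-! ### Nonvanishing of tensor products and epimorphic evaluations. -/

variable {C : Type u} [Category.{v} C] [Abelian C] [MonoidalCategory C] [MonoidalPreadditive C]
  [RigidCategory C] {Λ : Type u₁} (d : UnitDecomposition C Λ)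

lemma not_isZero_e (i : Λ) : ¬ IsZero (d.e i) := by
  have := d.simple i
  exact Simple.not_isZero _

/-- Restrict the coevaluation of `X` to the simple object `e i`. If the restriction is zero, the
triangle identity kills the inclusion `X ⊗ e i ⟶ X`. Otherwise it is a monomorphism and embeds `e i
⊗ Y` into `ᘁX ⊗ (X ⊗ Y) = 0`. -/
lemma isZero_or_isZero_of_isZero_tensor (i : Λ) {X Y : C} (h : IsZero (X ⊗ Y)) :
    IsZero (X ⊗ d.e i) ∨ IsZero (d.e i ⊗ Y) := by
  have := d.simple i
  by_cases h0 : (d.summand i).i ≫ η_ (ᘁX) X = 0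
  · left
    let m : X ⊗ d.e i ⟶ X ⊗ 𝟙_ C := X ◁ (d.summand i).i
    have hm : Mono m := by
      have : Mono (d.summand i).i := inferInstance
      exact mono_whiskerLeft _ _
    have h1 : m ≫ X ◁ η_ (ᘁX) X = 0 := by
      rw [← MonoidalCategory.whiskerLeft_comp, h0,
        MonoidalPreadditive.whiskerLeft_zero]
    have h2 : m = 0 := by
      have h3 := h1 =≫ ((α_ _ _ _).inv ≫ ε_ (ᘁX) X ▷ X)
      rw [Category.assoc, ExactPairing.coevaluation_evaluation, zero_comp] at h3
      simpa using h3
    exact IsZero.of_mono_eq_zero _ h2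
  · right
    have : Mono ((d.summand i).i ≫ η_ (ᘁX) X) := Preadditive.mono_of_kernel_zero
      (kernel_zero_of_nonzero_from_simple h0)
    have h2 := (UnitSemisimple.isZero_tensor_right (ᘁX : C) h).of_iso (α_ (ᘁX : C) X Y)
    exact IsZero.of_mono (((d.summand i).i ≫ η_ (ᘁX) X) ▷ Y) h2

/-- If `e i ⊗ X` is nonzero, then evaluation on `X` is an epimorphism after tensoring with any
object of `e i ⊗ C`. -/
lemma isZero_cokernel_evaluation_tensor {i : Λ} {X X' : C} [ExactPairing X' X]
    (h : ¬ IsZero (d.e i ⊗ X)) : IsZero (cokernel (ε_ X' X) ⊗ d.e i) := by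
  refine (d.isZero_or_isZero_of_isZero_tensor i ?_).resolve_right h
  -- By the triangle identity `ε_ X' X ▷ X` is a split epimorphism, so `X` annihilates the cokernel
  -- of the evaluation.
  have h1 : cokernel.π (ε_ X' X) ▷ X = 0 := by
    have h2 : (X ◁ η_ X' X ≫ (α_ _ _ _).inv ≫ ε_ X' X ▷ X) ≫ cokernel.π (ε_ X' X) ▷ X = 0 := by
      simp only [Category.assoc, ← comp_whiskerRight, cokernel.condition,
        MonoidalPreadditive.zero_whiskerRight, comp_zero]
    rw [ExactPairing.coevaluation_evaluation] at h2
    simpa using h2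
  exact IsZero.of_epi_eq_zero _ h1

/-- Tensoring is exact and `Z` has the form `e i ⊗ W`, so the cokernel in question is a tensor
product with the factor `cokernel (ε_ X' X) ⊗ e i = 0`. -/
lemma epi_evaluation_whiskerRight {i : Λ} {X X' : C} [ExactPairing X' X]
    (h : ¬ IsZero (d.e i ⊗ X)) {Z : C} (hZ : row (d.summand i) Z) : Epi (ε_ X' X ▷ Z) := by
  obtain ⟨W, ⟨φ⟩⟩ := hZ
  have h1 : IsZero (cokernel (ε_ X' X) ⊗ Z) :=
    (UnitSemisimple.isZero_tensor_left (d.isZero_cokernel_evaluation_tensor h) W).of_iso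
      (whiskerLeftIso _ φ ≪≫ (α_ _ _ _).symm)
  exact Preadditive.epi_of_cokernel_zero
    ((h1.of_iso (PreservesCokernel.iso (tensorRight Z) (ε_ X' X)).symm).eq_of_tgt _ _)

lemma epi_evaluation [Finite Λ] {X X' : C} [ExactPairing X' X]
    (h : ∀ i, ¬ IsZero (d.e i ⊗ X)) : Epi (ε_ X' X) :=
  Preadditive.epi_of_cokernel_zero
    ((d.isZero_of_forall_tensorRight
      (fun i => d.isZero_cokernel_evaluation_tensor (h i))).eq_of_tgt _ _)

end UnitDecomposition

/-! ### Canonical presentations by a pointwise epimorphic transformation to the identity. -/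

section SelfCofork

variable {T : Type u} [Category.{v} T]

/-- The fork `E (E Z) ⇉ E Z ⟶ Z` of a natural transformation `E ⟶ 𝟭`. -/
abbrev selfCofork {E : T ⥤ T} (ε : E ⟶ 𝟭 T) (Z : T) :
    Cofork (E.map (ε.app Z)) (ε.app (E.obj Z)) :=
  Cofork.ofπ (ε.app Z) (ε.naturality (ε.app Z))

/-- A pointwise epimorphic natural transformation `E ⟶ 𝟭` on an abelian category presents every
object as a coequalizer. -/
lemma nonempty_isColimit_selfCofork [Abelian T] {E : T ⥤ T} (ε : E ⟶ 𝟭 T)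
    (h : ∀ Z, Epi (ε.app Z)) (Z : T) : Nonempty (IsColimit (selfCofork ε Z)) := by
  have hZ : Epi (ε.app Z) := h Z
  refine ⟨Cofork.IsColimit.ofExistsUnique fun s => ?_⟩
  -- Naturality of `ε` at `a`, then the cofork condition. The map depends on `a` only through `a ≫
  -- ε.app Z`, so the kernel inclusion may be compared with the zero map; `E` need not be additive
  -- for this.
  have aux {W : T} (a : W ⟶ E.obj Z) :
      ε.app W ≫ a ≫ s.π = E.map (a ≫ ε.app Z) ≫ s.π := by
    have h1 : E.map a ≫ ε.app (E.obj Z) = ε.app W ≫ a := ε.naturality a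
    rw [← reassoc_of% h1, Functor.map_comp, Category.assoc, s.condition]
  have key : kernel.ι (ε.app Z) ≫ s.π = 0 := by
    have := h (kernel (ε.app Z))
    rw [← cancel_epi (ε.app (kernel (ε.app Z)))]
    have h0 := aux (0 : kernel (ε.app Z) ⟶ E.obj Z)
    rw [zero_comp, zero_comp] at h0
    exact ((aux (kernel.ι (ε.app Z))).trans
      (congrArg (fun f => E.map f ≫ s.π) (kernel.condition (ε.app Z)))).trans h0.symm
  refine ⟨Abelian.epiDesc (ε.app Z) s.π key, Abelian.comp_epiDesc (ε.app Z) s.π key, fun l hl => ?_⟩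
  have := h Z
  refine (cancel_epi (ε.app Z)).1 ?_
  exact hl.trans (Abelian.comp_epiDesc (ε.app Z) s.π key).symm

end SelfCofork

/-! ### A criterion for a balanced functor to be a relative tensor product. -/

namespace BalancedFunctor

variable {B : Type u₁} [Category.{v₁} B] [MonoidalCategory B]
  {M : Type u₂} [Category.{v₂} M] [MonoidalRightAction B M]
  {N : Type u₃} [Category.{v₃} N] [MonoidalLeftAction B N]
  {T : Type u₅} [Category.{v₅} T]

/-- Data which exhibit `T` as the relative tensor product of `M` and `N`: every object of `T`
and of `M` is presented in terms of a single object `x₀` of `M`. -/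
structure PresentingObject (Φ : BalancedFunctor B M N T) where
  x₀ : M
  L : T ⥤ N
  rightExact : PreservesFiniteColimits L
  K : M ⥤ B
  κ (x : M) (y : N) : K.obj x ⊙ₗ y ≅ L.obj ((Φ.functor.obj x).obj y)
  κ_left {x x' : M} (f : x ⟶ x') (y : N) :
    K.map f ⊵ₗ y ≫ (κ x' y).hom = (κ x y).hom ≫ L.map ((Φ.functor.map f).app y)
  κ_right (x : M) {y y' : N} (h : y ⟶ y') :
    K.obj x ⊴ₗ h ≫ (κ x y').hom = (κ x y).hom ≫ L.map ((Φ.functor.obj x).map h)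
  ν (x : M) (b : B) : K.obj (x ⊙ᵣ b) ≅ K.obj x ⊗ b
  ε : L ⋙ Φ.functor.obj x₀ ⟶ 𝟭 T
  ε' : K ⋙ (MonoidalRightAction.curriedAction B M).flip.obj x₀ ⟶ 𝟭 M
  isColimit_ε (Z : T) : IsColimit (selfCofork ε Z)
  isColimit_ε' (x : M) : IsColimit (selfCofork ε' x)
  ε_κ (x : M) (y : N) :
    (Φ.balance x₀ (K.obj x) y).hom ≫ (Φ.functor.obj x₀).map (κ x y).hom ≫ ε.app _ =
      (Φ.functor.map (ε'.app x)).app y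
  ε'_ν (x : M) (b : B) :
    ε'.app (x ⊙ᵣ b) =
      x₀ ⊴ᵣ (ν x b).hom ≫ (αᵣ x₀ (K.obj x) b).hom ≫ (ε'.app x : x₀ ⊙ᵣ K.obj x ⟶ x) ⊵ᵣ b
  κ_balance (x : M) (b : B) (y : N) :
    (κ (x ⊙ᵣ b) y).hom ≫ L.map (Φ.balance x b y).hom =
      (ν x b).hom ⊵ₗ y ≫ (αₗ (K.obj x) b y).hom ≫ (κ x (b ⊙ₗ y)).hom

namespace PresentingObject

variable {Φ : BalancedFunctor B M N T} (P : PresentingObject Φ)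
  {D : Type u₄} [Category.{v₄} D] (F F' : BalancedFunctor B M N D)

/-- The isomorphism `F (x₀ ⊙ K x, y) ≅ F (x₀, L (x ⬝ y))`. -/
def θ (x : M) (y : N) :
    (F.functor.obj (P.x₀ ⊙ᵣ P.K.obj x)).obj y ≅
      (F.functor.obj P.x₀).obj (P.L.obj ((Φ.functor.obj x).obj y)) :=
  F.balance P.x₀ (P.K.obj x) y ≪≫ (F.functor.obj P.x₀).mapIso (P.κ x y)

/-- The map `x₀ ⬝ L Z ⟶ Z`. -/
def counit (Z : T) : (Φ.functor.obj P.x₀).obj (P.L.obj Z) ⟶ Z := P.ε.app Z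

/-- The map `x₀ ⊙ K x ⟶ x`. -/
def counit' (x : M) : P.x₀ ⊙ᵣ P.K.obj x ⟶ x := P.ε'.app x

lemma counit_naturality {Z Z' : T} (f : Z ⟶ Z') :
    (Φ.functor.obj P.x₀).map (P.L.map f) ≫ P.counit Z' = P.counit Z ≫ f :=
  P.ε.naturality f

lemma counit'_naturality {x x' : M} (f : x ⟶ x') :
    P.x₀ ⊴ᵣ P.K.map f ≫ P.counit' x' = P.counit' x ≫ f :=
  P.ε'.naturality f

lemma θ_counit (x : M) (y : N) :
    (P.θ Φ x y).hom ≫ P.counit ((Φ.functor.obj x).obj y) =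
      (Φ.functor.map (P.counit' x)).app y :=
  (Category.assoc _ _ _).trans (P.ε_κ x y)

/-- The map `F (x₀, L (x ⬝ y)) ⟶ F (x, y)`. -/
def ρ (x : M) (y : N) :
    (F.functor.obj P.x₀).obj (P.L.obj ((Φ.functor.obj x).obj y)) ⟶ (F.functor.obj x).obj y :=
  (P.θ F x y).inv ≫ (F.functor.map (P.counit' x)).app y

lemma θ_hom_ρ (x : M) (y : N) :
    (P.θ F x y).hom ≫ P.ρ F x y = (F.functor.map (P.counit' x)).app y := by
  simp [ρ]

lemma θ_left {x x' : M} (f : x ⟶ x') (y : N) :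
    (F.functor.map (P.x₀ ⊴ᵣ P.K.map f)).app y ≫ (P.θ F x' y).hom =
      (P.θ F x y).hom ≫
        (F.functor.obj P.x₀).map (P.L.map ((Φ.functor.map f).app y)) := by
  simp only [θ, Iso.trans_hom, Functor.mapIso_hom, Category.assoc]
  rw [← Category.assoc, F.balance_naturality_middle, Category.assoc, ← Functor.map_comp,
    ← Functor.map_comp, P.κ_left]

lemma θ_right (x : M) {y y' : N} (h : y ⟶ y') :
    (F.functor.obj (P.x₀ ⊙ᵣ P.K.obj x)).map h ≫ (P.θ F x y').hom =
      (P.θ F x y).hom ≫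
        (F.functor.obj P.x₀).map (P.L.map ((Φ.functor.obj x).map h)) := by
  simp only [θ, Iso.trans_hom, Functor.mapIso_hom, Category.assoc]
  rw [← Category.assoc, F.balance_naturality_right, Category.assoc, ← Functor.map_comp,
    ← Functor.map_comp, P.κ_right]

lemma ρ_left {x x' : M} (f : x ⟶ x') (y : N) :
    (F.functor.obj P.x₀).map (P.L.map ((Φ.functor.map f).app y)) ≫ P.ρ F x' y =
      P.ρ F x y ≫ (F.functor.map f).app y := by
  rw [← cancel_epi (P.θ F x y).hom, ← Category.assoc, ← θ_left, Category.assoc, θ_hom_ρ,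
    ← Category.assoc, θ_hom_ρ, ← NatTrans.comp_app, ← NatTrans.comp_app, ← Functor.map_comp,
    ← Functor.map_comp, counit'_naturality]

lemma ρ_right (x : M) {y y' : N} (h : y ⟶ y') :
    (F.functor.obj P.x₀).map (P.L.map ((Φ.functor.obj x).map h)) ≫ P.ρ F x y' =
      P.ρ F x y ≫ (F.functor.obj x).map h := by
  rw [← cancel_epi (P.θ F x y).hom, ← Category.assoc, ← θ_right, Category.assoc, θ_hom_ρ,
    ← Category.assoc, θ_hom_ρ, NatTrans.naturality]

variable {F F'} in
lemma ρ_comp (α : F ⟶ F') (x : M) (y : N) :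
    P.ρ F x y ≫ (α.nat.app x).app y = (α.nat.app P.x₀).app _ ≫ P.ρ F' x y := by
  have h : (P.θ F x y).hom ≫ (α.nat.app P.x₀).app _ =
      (α.nat.app _).app y ≫ (P.θ F' x y).hom := by
    simp only [θ, Iso.trans_hom, Functor.mapIso_hom, Category.assoc]
    rw [← Category.assoc ((α.nat.app _).app y), ← α.comm, Category.assoc,
      NatTrans.naturality]
  rw [← cancel_epi (P.θ F x y).hom, ← Category.assoc, θ_hom_ρ, reassoc_of% h, θ_hom_ρ,
    ← NatTrans.comp_app, ← NatTrans.comp_app, α.nat.naturality]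

/-- `ε'_ν` writes the counit at `x ⊙ b` as the counit at `x` acted on by `b`. The associativity
axiom of the balancing then moves `b` across, and `κ_balance` matches the outcome with the balancing
of `Φ`. -/
lemma ρ_balance (x : M) (b : B) (y : N) :
    (F.functor.obj P.x₀).map (P.L.map (Φ.balance x b y).hom) ≫ P.ρ F x (b ⊙ₗ y) =
      P.ρ F (x ⊙ᵣ b) y ≫ (F.balance x b y).hom := by
  have hε : P.counit' (x ⊙ᵣ b) =
      P.x₀ ⊴ᵣ (P.ν x b).hom ≫ (αᵣ P.x₀ (P.K.obj x) b).hom ≫ P.counit' x ⊵ᵣ b := P.ε'_ν x b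
  have h1 : (F.functor.map (P.counit' (x ⊙ᵣ b))).app y ≫ (F.balance x b y).hom =
      (F.balance P.x₀ (P.K.obj (x ⊙ᵣ b)) y).hom ≫
        (F.functor.obj P.x₀).map ((P.ν x b).hom ⊵ₗ y) ≫
        (F.functor.obj P.x₀).map (αₗ (P.K.obj x) b y).hom ≫
          (F.balance P.x₀ (P.K.obj x) (b ⊙ₗ y)).inv ≫
          (F.functor.map (P.counit' x)).app (b ⊙ₗ y) := by
    rw [hε]
    simp only [Functor.map_comp, NatTrans.comp_app, Category.assoc]
    rw [F.balance_naturality_left, ← Category.assoc ((F.functor.map (αᵣ _ _ _).hom).app y)]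
    have h2 : (F.functor.map (αᵣ P.x₀ (P.K.obj x) b).hom).app y ≫
        (F.balance (P.x₀ ⊙ᵣ P.K.obj x) b y).hom =
        (F.balance P.x₀ (P.K.obj x ⊗ b) y).hom ≫
          (F.functor.obj P.x₀).map (αₗ (P.K.obj x) b y).hom ≫
          (F.balance P.x₀ (P.K.obj x) (b ⊙ₗ y)).inv := by
      rw [← Category.assoc, F.balance_tensor]
      simp
    rw [h2]
    simp only [Category.assoc]
    rw [← Category.assoc, F.balance_naturality_middle]
    simp only [Category.assoc]
  rw [← cancel_epi (P.θ F (x ⊙ᵣ b) y).hom, ← Category.assoc ((P.θ F (x ⊙ᵣ b) y).hom) (P.ρ F _ _),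
    θ_hom_ρ, h1]
  simp only [ρ, θ, Iso.trans_hom, Functor.mapIso_hom, Category.assoc, Iso.trans_inv,
    Functor.mapIso_inv]
  rw [← Functor.map_comp_assoc, P.κ_balance]
  simp

/-- Together with `θ_counit'_self`, this identifies the two legs of the image under `F(-, y)` of the
presentation of `x` with the two legs of the cofork on `ρ`. -/
lemma θ_counit' (x : M) (y : N) :
    (P.θ F (P.x₀ ⊙ᵣ P.K.obj x) y ≪≫
      (F.functor.obj P.x₀).mapIso (P.L.mapIso (P.θ Φ x y))).hom ≫
        (F.functor.obj P.x₀).map (P.L.map (P.counit ((Φ.functor.obj x).obj y))) =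
      (F.functor.map (P.x₀ ⊴ᵣ P.K.map (P.counit' x))).app y ≫ (P.θ F x y).hom := by
  rw [θ_left, ← P.θ_counit]
  simp

lemma θ_counit'_self (x : M) (y : N) :
    (P.θ F (P.x₀ ⊙ᵣ P.K.obj x) y ≪≫
      (F.functor.obj P.x₀).mapIso (P.L.mapIso (P.θ Φ x y))).hom ≫
        P.ρ F P.x₀ (P.L.obj ((Φ.functor.obj x).obj y)) =
      (F.functor.map (P.counit' (P.x₀ ⊙ᵣ P.K.obj x))).app y ≫ (P.θ F x y).hom := by
  rw [← θ_hom_ρ, Category.assoc]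
  simp only [θ, Iso.trans_hom, Functor.mapIso_hom, Functor.map_comp, Category.assoc]
  rw [← reassoc_of% (P.ρ_balance F P.x₀ (P.K.obj x) y), P.ρ_right]

lemma ρ_condition (x : M) (y : N) :
    (F.functor.obj P.x₀).map (P.L.map (P.counit ((Φ.functor.obj x).obj y))) ≫ P.ρ F x y =
      P.ρ F P.x₀ (P.L.obj ((Φ.functor.obj x).obj y)) ≫ P.ρ F x y := by
  rw [← cancel_epi (P.θ F (P.x₀ ⊙ᵣ P.K.obj x) y ≪≫
      (F.functor.obj P.x₀).mapIso (P.L.mapIso (P.θ Φ x y))).hom, ← Category.assoc,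
    ← Category.assoc, θ_counit', θ_counit'_self, Category.assoc, Category.assoc, θ_hom_ρ,
    ← NatTrans.comp_app, ← NatTrans.comp_app, ← Functor.map_comp, ← Functor.map_comp,
    counit'_naturality]

/-- The map `ρ` is the coequalizer of its values on the canonical presentation. -/
noncomputable def isColimitρ (x : M) (y : N) : IsColimit (Cofork.ofπ (P.ρ F x y) (P.ρ_condition F x y)) := by
  -- `F(-, y)` preserves the presentation of `x` by `ε'`, and the isomorphisms `θ` carry it to the
  -- cofork on `ρ`.
  have := F.rightExact_left y
  refine Cofork.isColimitOfIsos _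
    (isColimitCoforkMapOfIsColimit (F.functor.flip.obj y) _ (P.isColimit_ε' x)) _
    (P.θ F (P.x₀ ⊙ᵣ P.K.obj x) y ≪≫
      (F.functor.obj P.x₀).mapIso (P.L.mapIso (P.θ Φ x y))) (P.θ F x y) (Iso.refl _)
    (P.θ_counit' F x y) (P.θ_counit'_self F x y) ?_
  change (P.θ F x y).inv ≫ (F.functor.map (P.counit' x)).app y ≫ 𝟙 _ = P.ρ F x y
  rw [Category.comp_id]; rfl

/-- By `θ_counit`, the map `ρ` of an induced balanced functor is the image of the counit of `T`.
This turns `ρ_comp` into a statement about the presentations of objects of `T`. -/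
lemma ρ_compObj (G : T ⥤ᵣ D) (x : M) (y : N) :
    P.ρ (Φ.compObj G) x y = G.obj.map (P.counit ((Φ.functor.obj x).obj y)) := by
  refine (cancel_epi (P.θ (Φ.compObj G) x y).hom).1 ((P.θ_hom_ρ (Φ.compObj G) x y).trans ?_)
  change G.obj.map ((Φ.functor.map (P.counit' x)).app y) =
    (G.obj.map (Φ.balance P.x₀ (P.K.obj x) y).hom ≫
      G.obj.map ((Φ.functor.obj P.x₀).map (P.κ x y).hom)) ≫ _
  rw [← P.θ_counit, ← Functor.map_comp, ← Functor.map_comp]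
  rfl

variable (G G' : T ⥤ᵣ D)

lemma map_counit_condition (Z : T) :
    G.obj.map ((Φ.functor.obj P.x₀).map (P.L.map (P.counit Z))) ≫ G.obj.map (P.counit Z) =
      G.obj.map (P.counit ((Φ.functor.obj P.x₀).obj (P.L.obj Z))) ≫
        G.obj.map (P.counit Z) := by
  rw [← Functor.map_comp, ← Functor.map_comp, counit_naturality]

/-- A right exact functor preserves the canonical presentation of an object. -/
noncomputable def isColimitMapCounit (Z : T) :
    IsColimit (Cofork.ofπ (G.obj.map (P.counit Z)) (P.map_counit_condition G Z)) := by
  have : PreservesFiniteColimits G.obj := G.property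
  exact isColimitCoforkMapOfIsColimit G.obj _ (P.isColimit_ε Z)

lemma epi_map_counit (Z : T) : Epi (G.obj.map (P.counit Z)) :=
  epi_of_isColimit_cofork (P.isColimitMapCounit G Z)

lemma map_counit_naturality {X Y : T} (f : X ⟶ Y) :
    G.obj.map ((Φ.functor.obj P.x₀).map (P.L.map f)) ≫ G.obj.map (P.counit Y) =
      G.obj.map (P.counit X) ≫ G.obj.map f := by
  rw [← Functor.map_comp, ← Functor.map_comp, counit_naturality]

-- The counit remains an epimorphism under `G`, so a transformation is determined by its components
-- at the objects `Φ(x₀, L Z)`, which the balanced functors see.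
include P in
lemma faithful_compFunctor : (Φ.compFunctor D).Faithful where
  map_injective {G G'} f g h := by
    ext Z
    have := P.epi_map_counit G Z
    have h' : f.hom.app ((Φ.functor.obj P.x₀).obj (P.L.obj Z)) = g.hom.app _ :=
      congrArg (fun a : Φ.compObj G ⟶ Φ.compObj G' => (a.nat.app P.x₀).app (P.L.obj Z)) h
    rw [← cancel_epi (G.obj.map (P.counit Z)), f.hom.naturality, g.hom.naturality, h']

section Full

variable {G G'} (α : Φ.compObj G ⟶ Φ.compObj G')

/-- The component at `x₀ ⬝ L Z` of a morphism of balanced functors. -/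
def component (Z : T) :
    G.obj.obj ((Φ.functor.obj P.x₀).obj (P.L.obj Z)) ⟶
      G'.obj.obj ((Φ.functor.obj P.x₀).obj (P.L.obj Z)) :=
  (α.nat.app P.x₀).app (P.L.obj Z)

lemma component_naturality {Z Z' : T} (f : Z ⟶ Z') :
    G.obj.map ((Φ.functor.obj P.x₀).map (P.L.map f)) ≫ P.component α Z' =
      P.component α Z ≫ G'.obj.map ((Φ.functor.obj P.x₀).map (P.L.map f)) :=
  (α.nat.app P.x₀).naturality (P.L.map f)

lemma map_counit_comp (x : M) (y : N) :
    G.obj.map (P.counit ((Φ.functor.obj x).obj y)) ≫ (α.nat.app x).app y =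
      P.component α ((Φ.functor.obj x).obj y) ≫
        G'.obj.map (P.counit ((Φ.functor.obj x).obj y)) := by
  rw [← ρ_compObj, ← ρ_compObj]
  exact P.ρ_comp α x y

/-- The natural transformation which induces a given morphism of balanced functors. -/
noncomputable def desc (Z : T) : G.obj.obj Z ⟶ G'.obj.obj Z :=
  Cofork.IsColimit.desc (P.isColimitMapCounit G Z) (P.component α Z ≫ G'.obj.map (P.counit Z)) (by
    -- The component commutes with the second leg of the presentation of `Z` because of
    -- `map_counit_comp` at `x₀` and `L Z`; with the first leg it commutes by naturality.
    have h : G.obj.map (P.counit ((Φ.functor.obj P.x₀).obj (P.L.obj Z))) ≫ P.component α Z =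
      P.component α _ ≫ G'.obj.map (P.counit ((Φ.functor.obj P.x₀).obj (P.L.obj Z))) :=
        P.map_counit_comp α P.x₀ (P.L.obj Z)
    rw [← Category.assoc, component_naturality, Category.assoc, map_counit_naturality,
      ← Category.assoc, ← Category.assoc, h])

lemma map_counit_desc (Z : T) :
    G.obj.map (P.counit Z) ≫ P.desc α Z = P.component α Z ≫ G'.obj.map (P.counit Z) :=
  Cofork.IsColimit.π_desc' (P.isColimitMapCounit G Z) _ _

end Full

include P in
lemma full_compFunctor : (Φ.compFunctor D).Full where
  map_surjective {G G'} α := by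
    let α' : Φ.compObj G ⟶ Φ.compObj G' := α
    refine ⟨ObjectProperty.homMk
      { app := P.desc α'
        naturality := fun Z Z' f => ?_ }, ?_⟩
    · have := P.epi_map_counit G Z
      rw [← cancel_epi (G.obj.map (P.counit Z)), ← Category.assoc, ← map_counit_naturality,
        Category.assoc, map_counit_desc, ← Category.assoc, component_naturality, Category.assoc,
        map_counit_naturality, ← Category.assoc, ← map_counit_desc, Category.assoc]
    · refine BalancedFunctor.Hom.ext ?_
      ext x y
      have := P.epi_map_counit G ((Φ.functor.obj x).obj y)
      refine (cancel_epi (G.obj.map (P.counit ((Φ.functor.obj x).obj y)))).1 ?_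
      exact (P.map_counit_desc α' _).trans (P.map_counit_comp α' x y).symm

section EssSurj

variable [HasFiniteColimits D]

/-- The right exact functor which induces a given balanced functor is the coequalizer of this
transformation and `ε`. -/
noncomputable def ρNat : (P.L ⋙ Φ.functor.obj P.x₀) ⋙ (P.L ⋙ F.functor.obj P.x₀) ⟶
    P.L ⋙ F.functor.obj P.x₀ where
  app Z := P.ρ F P.x₀ (P.L.obj Z)
  naturality _ _ f := P.ρ_right F P.x₀ (P.L.map f)

/-- The transformation induced by `ε`. -/
noncomputable def εNat : (P.L ⋙ Φ.functor.obj P.x₀) ⋙ (P.L ⋙ F.functor.obj P.x₀) ⟶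
    P.L ⋙ F.functor.obj P.x₀ :=
  Functor.whiskerRight P.ε (P.L ⋙ F.functor.obj P.x₀)

/-- The right exact functor which induces a given balanced functor. -/
noncomputable def inducedFunctor : T ⥤ D := coequalizer (P.εNat F) (P.ρNat F)

/-- The projection onto the right exact functor which induces a given balanced functor. -/
noncomputable def proj : P.L ⋙ F.functor.obj P.x₀ ⟶ P.inducedFunctor F := coequalizer.π _ _

lemma proj_condition (Z : T) : (F.functor.obj P.x₀).map (P.L.map (P.counit Z)) ≫
    (P.proj F).app Z = P.ρ F P.x₀ (P.L.obj Z) ≫ (P.proj F).app Z :=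
  congrArg (fun f : _ ⟶ P.inducedFunctor F => f.app Z)
    (coequalizer.condition (P.εNat F) (P.ρNat F))

/-- The values of the induced functor are coequalizers. -/
noncomputable def isColimitProj (Z : T) : IsColimit (Cofork.ofπ ((P.proj F).app Z) (P.proj_condition F Z)) :=
  isColimitCoforkMapOfIsColimit ((evaluation T D).obj Z)
    (coequalizer.condition (P.εNat F) (P.ρNat F)) (coequalizerIsCoequalizer _ _)

instance (Z : T) : Epi ((P.proj F).app Z) := epi_of_isColimit_cofork (P.isColimitProj F Z)

/-- Colimits commute with colimits: the functor is a pointwise coequalizer of right exact functors,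
that is, `K.flip` followed by the left adjoint `colim`. -/
lemma inducedFunctor_rightExact : PreservesFiniteColimits (P.inducedFunctor F) := by
  have h1 := P.rightExact
  have h2 := F.rightExact_right P.x₀
  have h3 := Φ.rightExact_right P.x₀
  let K := parallelPair (P.εNat F) (P.ρNat F)
  have h4 : PreservesFiniteColimits (P.L ⋙ F.functor.obj P.x₀) := inferInstance
  have hK (i : WalkingParallelPair) : PreservesFiniteColimits (K.obj i) := by
    cases i
    · exact inferInstanceAs
        (PreservesFiniteColimits ((P.L ⋙ Φ.functor.obj P.x₀) ⋙ (P.L ⋙ F.functor.obj P.x₀)))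
    · exact h4
  have hflip : PreservesFiniteColimits K.flip :=
    ⟨fun J _ _ => preservesColimitsOfShape_of_evaluation _ J fun i =>
      inferInstanceAs (PreservesColimitsOfShape J (K.obj i))⟩
  have hcolim : PreservesFiniteColimits (colim (J := WalkingParallelPair) (C := D)) := by
    have := (colimConstAdj (J := WalkingParallelPair) (C := D)).leftAdjoint_preservesColimits
    infer_instance
  let e : K.flip ⋙ colim ≅ P.inducedFunctor F :=
    NatIso.ofComponents
      (fun Z => (colimit.isColimit (K.flip.obj Z)).coconePointUniqueUpToIso
        (isColimitOfPreserves ((evaluation _ _).obj Z) (colimit.isColimit K)))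
      (fun {Z Z'} f => by
        refine colimit.hom_ext fun i => ?_
        have h (Z : T) := (colimit.isColimit (K.flip.obj Z)).comp_coconePointUniqueUpToIso_hom
          (isColimitOfPreserves ((evaluation _ _).obj Z) (colimit.isColimit K)) i
        have h1 : colimit.ι (K.flip.obj Z) i ≫ (K.flip ⋙ colim).map f =
            (K.obj i).map f ≫ colimit.ι (K.flip.obj Z') i := ι_colimMap _ _
        refine ((Category.assoc _ _ _).symm.trans
          ((congrArg (· ≫ _) h1).trans (Category.assoc _ _ _))).trans ?_
        refine (congrArg ((K.obj i).map f ≫ ·) (h Z')).trans ?_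
        refine Eq.trans ?_ ((Category.assoc _ _ _).trans rfl)
        refine Eq.trans ?_ (congrArg (· ≫ _) (h Z).symm)
        exact (colimit.ι K i).naturality f)
  exact preservesFiniteColimits_of_natIso e

/-- The comparison of the induced functor with the given balanced functor. -/
noncomputable def comparison (x : M) (y : N) :
    (P.inducedFunctor F).obj ((Φ.functor.obj x).obj y) ≅ (F.functor.obj x).obj y :=
  (P.isColimitProj F ((Φ.functor.obj x).obj y)).coconePointUniqueUpToIso (P.isColimitρ F x y)

lemma proj_comparison (x : M) (y : N) :
    (P.proj F).app ((Φ.functor.obj x).obj y) ≫ (P.comparison F x y).hom = P.ρ F x y :=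
  (P.isColimitProj F _).comp_coconePointUniqueUpToIso_hom (P.isColimitρ F x y)
    WalkingParallelPair.one

-- By `isColimitProj` and `isColimitρ`, the induced functor at `Φ(x, y)` and the value `F(x, y)` are
-- coequalizers of the same pair. The comparison inherits naturality and balancing from `ρ_left`,
-- `ρ_right` and `ρ_balance`, because the projection is an epimorphism.
include P in
lemma essSurj_compFunctor : (Φ.compFunctor D).EssSurj where
  mem_essImage F := by
    let G : T ⥤ᵣ D := ⟨P.inducedFunctor F, P.inducedFunctor_rightExact F⟩
    have hl {x x' : M} (f : x ⟶ x') (y : N) :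
        (P.inducedFunctor F).map ((Φ.functor.map f).app y) ≫ (P.comparison F x' y).hom =
          (P.comparison F x y).hom ≫ (F.functor.map f).app y := by
      rw [← cancel_epi ((P.proj F).app _), ← NatTrans.naturality_assoc, proj_comparison,
        reassoc_of% (P.proj_comparison F x y)]
      exact P.ρ_left F f y
    have hr (x : M) {y y' : N} (h : y ⟶ y') :
        (P.inducedFunctor F).map ((Φ.functor.obj x).map h) ≫ (P.comparison F x y').hom =
          (P.comparison F x y).hom ≫ (F.functor.obj x).map h := by
      rw [← cancel_epi ((P.proj F).app _), ← NatTrans.naturality_assoc, proj_comparison,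
        reassoc_of% (P.proj_comparison F x y)]
      exact P.ρ_right F x h
    have hb (x : M) (b : B) (y : N) :
        (P.inducedFunctor F).map (Φ.balance x b y).hom ≫ (P.comparison F x (b ⊙ₗ y)).hom =
          (P.comparison F (x ⊙ᵣ b) y).hom ≫ (F.balance x b y).hom := by
      rw [← cancel_epi ((P.proj F).app _), ← NatTrans.naturality_assoc, proj_comparison,
        reassoc_of% (P.proj_comparison F (x ⊙ᵣ b) y)]
      exact P.ρ_balance F x b y
    let e : (Φ.compObj G).functor ≅ F.functor :=
      NatIso.ofComponents (fun x => NatIso.ofComponents (fun y => P.comparison F x y)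
        (fun h => hr x h)) (fun f => by ext y; exact hl f y)
    refine ⟨G, ⟨⟨⟨e.hom, fun x b y => hb x b y⟩, ⟨e.inv, fun x b y => ?_⟩, ?_, ?_⟩⟩⟩
    · exact ((Iso.eq_inv_comp (P.comparison F (x ⊙ᵣ b) y)).2
        (((Category.assoc _ _ _).symm.trans ((Iso.comp_inv_eq _).2 (hb x b y).symm))))
    · exact BalancedFunctor.Hom.ext e.hom_inv_id
    · exact BalancedFunctor.Hom.ext e.inv_hom_id

include P in
lemma isEquivalence_compFunctor : (Φ.compFunctor D).IsEquivalence where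
  faithful := P.faithful_compFunctor
  full := P.full_compFunctor
  essSurj := P.essSurj_compFunctor

end EssSurj

end PresentingObject
end BalancedFunctor

/-! ### Columns `C ⊗ e`, and the tensor product between rows and columns. -/

namespace UnitSummand

section Column

variable {C : Type u} [Category.{v} C] [MonoidalCategory C] {e : C}

/-- The full subcategory `C ⊗ e` of `C`. -/
abbrev Column (s : Retract e (𝟙_ C)) : Type u := (column s).FullSubcategory

lemma corner_of_row_column {f : C} {s : Retract e (𝟙_ C)} {t : Retract f (𝟙_ C)} {X Y : C}
    (hX : row s X) (hY : column t Y) : corner s t (X ⊗ Y) :=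
  (corner_iff_row_column s t _).2 ⟨row_tensor hX Y, column_tensor X hY⟩

/-- The left action of `C` on `C ⊗ e` by the tensor product. -/
instance columnLeftAction (s : Retract e (𝟙_ C)) : MonoidalLeftAction C (Column s) where
  actionObj X Y := ⟨X ⊗ Y.obj, column_tensor X Y.property⟩
  actionHomLeft φ Y := ObjectProperty.homMk (φ ▷ Y.obj)
  actionHomRight X _ _ φ := ObjectProperty.homMk (X ◁ φ.hom)
  actionHom φ ψ := ObjectProperty.homMk (φ ⊗ₘ ψ.hom)
  actionAssocIso X X' Y := ObjectProperty.isoMk _ (α_ X X' Y.obj)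
  actionUnitIso Y := ObjectProperty.isoMk _ (λ_ Y.obj)
  actionHom_def _ _ := by ext; simp [MonoidalCategory.tensorHom_def]
  actionHomRight_id _ _ := by ext; simp
  id_actionHomLeft _ _ := by ext; simp
  actionHom_comp _ _ _ _ := by ext; simp
  actionAssocIso_hom_naturality _ _ _ := by
    ext
    exact associator_naturality _ _ _
  actionUnitIso_hom_naturality φ := by ext; simp
  whiskerLeft_actionHomLeft X _ _ φ Y := by ext; simp
  whiskerRight_actionHomLeft X φ Y := by ext; simp
  associator_actionHom _ _ _ _ := by
    ext
    exact pentagon _ _ _ _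
  leftUnitor_actionHom X Y := by ext; simp
  rightUnitor_actionHom X Y := by ext; simp

/-- The right action of `e ⊗ C ⊗ e` on `C ⊗ e` by the tensor product of `C`. -/
instance columnRightAction (s : Retract e (𝟙_ C)) :
    MonoidalRightAction (Corner s s) (Column s) where
  actionObj Y X := ⟨Y.obj ⊗ X.obj, column_tensor Y.obj (corner_le_column s s _ X.property)⟩
  actionHomLeft φ X := ObjectProperty.homMk (φ.hom ▷ X.obj)
  actionHomRight Y _ _ φ := ObjectProperty.homMk (Y.obj ◁ φ.hom)
  actionHom φ ψ := ObjectProperty.homMk (φ.hom ⊗ₘ ψ.hom)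
  actionAssocIso Y X X' := ObjectProperty.isoMk _ (α_ Y.obj X.obj X'.obj).symm
  actionUnitIso Y := ObjectProperty.isoMk _ (rightIso s Y.property)
  actionHom_def _ _ := by ext; simp [MonoidalCategory.tensorHom_def]
  actionHomRight_id _ _ := by ext; simp
  id_actionHomLeft _ _ := by ext; simp
  actionHom_comp _ _ _ _ := by ext; simp
  actionAssocIso_hom_naturality _ _ _ := by
    ext
    exact associator_inv_naturality _ _ _
  actionUnitIso_hom_naturality φ := by
    ext
    change (_ ◁ s.i ≫ (ρ_ _).hom) ≫ φ.hom = φ.hom ▷ e ≫ _ ◁ s.i ≫ (ρ_ _).hom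
    simp [← whisker_exchange_assoc]
  actionHomRight_whiskerRight φ X Y := by
    ext
    change Y.obj ◁ (φ.hom ▷ X.obj) = (α_ _ _ _).inv ≫ (Y.obj ◁ φ.hom) ▷ X.obj ≫ (α_ _ _ _).hom
    simp
  whiskerRight_actionHomLeft X _ _ φ Y := by
    ext
    change Y.obj ◁ X.obj ◁ φ.hom = (α_ _ _ _).inv ≫ (Y.obj ⊗ X.obj) ◁ φ.hom ≫ (α_ _ _ _).hom
    simp
  actionHom_associator X X' X'' Y := by
    ext
    change Y.obj ◁ (α_ X.obj X'.obj X''.obj).hom ≫ (α_ _ _ _).inv ≫ (α_ _ _ _).inv =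
      (α_ _ _ _).inv ≫ (α_ _ _ _).inv ▷ _
    simp
  actionHom_leftUnitor X Y := by
    ext
    change Y.obj ◁ (s.i ▷ X.obj ≫ (λ_ _).hom) =
      (α_ _ _ _).inv ≫ (Y.obj ◁ s.i ≫ (ρ_ _).hom) ▷ X.obj
    simp
  actionHom_rightUnitor X Y := by
    ext
    change Y.obj ◁ (X.obj ◁ s.i ≫ (ρ_ _).hom) =
      (α_ _ _ _).inv ≫ (Y.obj ⊗ X.obj) ◁ s.i ≫ (ρ_ _).hom
    simp

/-- `C ⊗ e` as a bimodule over `C` and `e ⊗ C ⊗ e`. -/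
instance columnBimodule (s : Retract e (𝟙_ C)) :
    BimoduleCategory C (Corner s s) (Column s) where
  middle X Y Z := ObjectProperty.isoMk _ (α_ X Y.obj Z.obj)
  middle_naturality _ _ _ := by
    ext
    exact associator_naturality _ _ _
  middle_tensor_left _ _ _ _ := by
    ext
    exact (pentagon _ _ _ _).symm
  middle_tensor_right X Y Z Z' := by
    ext
    change (α_ X Y.obj (Z.obj ⊗ Z'.obj)).hom ≫ X ◁ (α_ _ _ _).inv =
      (α_ _ _ _).inv ≫ (α_ _ _ _).hom ▷ _ ≫ (α_ _ _ _).hom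
    simp
  middle_unit_left Y Z := by
    ext
    change (α_ (𝟙_ C) Y.obj Z.obj).hom ≫ (λ_ _).hom = (λ_ _).hom ▷ Z.obj
    simp
  middle_unit_right X Y := by
    ext
    change (α_ X Y.obj e).hom ≫ X ◁ (Y.obj ◁ s.i ≫ (ρ_ _).hom) =
      (X ⊗ Y.obj) ◁ s.i ≫ (ρ_ _).hom
    simp

lemma preservesFiniteColimits_of_comp_ι {P : ObjectProperty C} {D : Type u₁} [Category.{v₁} D]
    (F : D ⥤ P.FullSubcategory) (h : PreservesFiniteColimits (F ⋙ P.ι)) :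
    PreservesFiniteColimits F :=
  preservesFiniteColimits_of_reflects_of_preserves _ P.ι

/-- The inclusion of `e ⊗ C` is left adjoint to `X ↦ e ⊗ X`. -/
def rowAdjunction (s : Retract e (𝟙_ C)) :
    (row s).ι ⊣ (row s).lift (tensorLeft e) (row_tensor_self s) :=
  Adjunction.mkOfUnitCounit
    { unit :=
        { app := fun X => ObjectProperty.homMk (leftIso s X.property).inv
          naturality := fun _ _ φ => by
            ext
            change φ.hom ≫ (λ_ _).inv ≫ s.r ▷ _ = ((λ_ _).inv ≫ s.r ▷ _) ≫ e ◁ φ.hom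
            simp [← whisker_exchange] }
      counit :=
        { app := fun X => s.i ▷ X ≫ (λ_ X).hom
          naturality := fun _ _ φ => by
            change e ◁ φ ≫ s.i ▷ _ ≫ (λ_ _).hom = (s.i ▷ _ ≫ (λ_ _).hom) ≫ φ
            simp [whisker_exchange_assoc] }
      left_triangle := by
        ext X
        change (leftIso s X.property).inv ≫ 𝟙 _ ≫ (leftIso s X.property).hom = 𝟙 _
        rw [Category.id_comp, Iso.inv_hom_id]
      right_triangle := by
        ext X
        change ((λ_ (e ⊗ X)).inv ≫ s.r ▷ (e ⊗ X)) ≫ 𝟙 _ ≫ e ◁ (s.i ▷ X ≫ (λ_ X).hom) = 𝟙 _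
        rw [Category.id_comp, Category.assoc, ← whisker_exchange,
          ← leftUnitor_inv_naturality_assoc, Category.assoc, Iso.hom_inv_id_assoc,
          ← comp_whiskerRight, s.retract, id_whiskerRight] }

/-- The inclusion of `C ⊗ e` is left adjoint to `X ↦ X ⊗ e`. -/
def columnAdjunction (s : Retract e (𝟙_ C)) :
    (column s).ι ⊣ (column s).lift (tensorRight e) (column_tensor_self s) :=
  Adjunction.mkOfUnitCounit
    { unit :=
        { app := fun X => ObjectProperty.homMk (rightIso s X.property).inv
          naturality := fun _ _ φ => by
            ext
            change φ.hom ≫ (ρ_ _).inv ≫ _ ◁ s.r = ((ρ_ _).inv ≫ _ ◁ s.r) ≫ φ.hom ▷ e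
            simp [whisker_exchange] }
      counit :=
        { app := fun X => X ◁ s.i ≫ (ρ_ X).hom
          naturality := fun _ _ φ => by
            change φ ▷ e ≫ _ ◁ s.i ≫ (ρ_ _).hom = (_ ◁ s.i ≫ (ρ_ _).hom) ≫ φ
            simp [← whisker_exchange_assoc] }
      left_triangle := by
        ext X
        change (rightIso s X.property).inv ≫ 𝟙 _ ≫ (rightIso s X.property).hom = 𝟙 _
        rw [Category.id_comp, Iso.inv_hom_id]
      right_triangle := by
        ext X
        change ((ρ_ (X ⊗ e)).inv ≫ (X ⊗ e) ◁ s.r) ≫ 𝟙 _ ≫ (X ◁ s.i ≫ (ρ_ X).hom) ▷ e = 𝟙 _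
        rw [Category.id_comp, Category.assoc, whisker_exchange,
          ← rightUnitor_inv_naturality_assoc, Category.assoc, Iso.hom_inv_id_assoc,
          ← MonoidalCategory.whiskerLeft_comp, s.retract, MonoidalCategory.whiskerLeft_id] }

instance row_ι_preservesFiniteColimits (s : Retract e (𝟙_ C)) :
    PreservesFiniteColimits (row s).ι := by
  have := (rowAdjunction s).leftAdjoint_preservesColimits
  infer_instance

instance column_ι_preservesFiniteColimits (s : Retract e (𝟙_ C)) :
    PreservesFiniteColimits (column s).ι := by
  have := (columnAdjunction s).leftAdjoint_preservesColimits
  infer_instance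

end Column

section BalancedFunctors

variable {C : Type u} [Category.{v} C] [MonoidalCategory C] {e : C}

/-- The tensor product of `C`, as a functor `(e ⊗ C) × (C ⊗ e) ⥤ e ⊗ C ⊗ e`. -/
def rowColumnTensorFunctor (s : Retract e (𝟙_ C)) : Row s ⥤ Column s ⥤ Corner s s where
  obj X :=
    { obj := fun Y => ⟨X.obj ⊗ Y.obj, corner_of_row_column X.property Y.property⟩
      map := fun φ => ObjectProperty.homMk (X.obj ◁ φ.hom)
      map_id := fun _ => by ext; simp
      map_comp := fun _ _ => by ext; simp }
  map φ :=
    { app := fun Y => ObjectProperty.homMk (φ.hom ▷ Y.obj)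
      naturality := fun _ _ _ => by ext; simp [whisker_exchange] }
  map_id _ := by ext; simp
  map_comp _ _ := by ext; simp

/-- The tensor product of `C`, as a functor `(C ⊗ e) × (e ⊗ C) ⥤ C`. -/
def columnRowTensorFunctor (s : Retract e (𝟙_ C)) : Column s ⥤ Row s ⥤ C where
  obj X := (row s).ι ⋙ tensorLeft X.obj
  map φ := Functor.whiskerLeft (row s).ι ((curriedTensor C).map φ.hom)
  map_id _ := by ext; simp
  map_comp _ _ := by ext; simp

/-- The tensor product of `C`, as a balanced bimodule functor
`(e ⊗ C) × (C ⊗ e) ⥤ e ⊗ C ⊗ e` over `e ⊗ C ⊗ e`, `C` and `e ⊗ C ⊗ e`. -/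
def rowColumnTensor (hl : ∀ X : C, PreservesFiniteColimits (tensorLeft X))
    (hr : ∀ X : C, PreservesFiniteColimits (tensorRight X)) (s : Retract e (𝟙_ C)) :
    BalancedBimoduleFunctor (Corner s s) C (Corner s s) (Row s) (Column s) (Corner s s) where
  functor := rowColumnTensorFunctor s
  rightExact_left Y := by
    have := hr Y.obj
    exact preservesFiniteColimits_of_comp_ι _
      (inferInstanceAs (PreservesFiniteColimits ((row s).ι ⋙ tensorRight Y.obj)))
  rightExact_right X := by
    have := hl X.obj
    exact preservesFiniteColimits_of_comp_ι _
      (inferInstanceAs (PreservesFiniteColimits ((column s).ι ⋙ tensorLeft X.obj)))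
  balance X Z Y := ObjectProperty.isoMk _ (α_ X.obj Z Y.obj)
  balance_naturality_left φ Z Y := by
    ext
    exact associator_naturality_left _ _ _
  balance_naturality_middle X _ _ φ Y := by
    ext
    exact associator_naturality_middle _ _ _
  balance_naturality_right X Z _ _ φ := by
    ext
    exact associator_naturality_right _ _ _
  balance_unit X Y := by
    ext
    change (α_ X.obj (𝟙_ C) Y.obj).hom ≫ X.obj ◁ (λ_ _).hom = (ρ_ _).hom ▷ Y.obj
    simp
  balance_tensor X Z Z' Y := by
    ext
    change (α_ X.obj (Z ⊗ Z') Y.obj).hom ≫ X.obj ◁ (α_ _ _ _).hom =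
      (α_ _ _ _).inv ▷ _ ≫ (α_ _ _ _).hom ≫ (α_ _ _ _).hom
    simp
  left Z X Y := ObjectProperty.isoMk _ (α_ Z.obj X.obj Y.obj)
  left_naturality {Z Z' X X' Y Y'} φ ψ χ := by
    ext
    change (φ.hom ⊗ₘ ψ.hom) ▷ Y.obj ≫ (Z'.obj ⊗ X'.obj) ◁ χ.hom ≫ (α_ _ _ _).hom =
      (α_ _ _ _).hom ≫ (φ.hom ⊗ₘ (ψ.hom ▷ Y.obj ≫ X'.obj ◁ χ.hom))
    rw [← MonoidalCategory.tensorHom_def, ← MonoidalCategory.tensorHom_def_assoc,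
      associator_naturality]
  left_tensor Z Z' X Y := by
    ext
    exact (pentagon _ _ _ _).symm
  left_unit X Y := by
    ext
    change (α_ e X.obj Y.obj).hom ≫ s.i ▷ _ ≫ (λ_ _).hom = (s.i ▷ X.obj ≫ (λ_ _).hom) ▷ Y.obj
    simp
  right X Y Z := ObjectProperty.isoMk _ (α_ X.obj Y.obj Z.obj).symm
  right_naturality {X X' Y Y' Z Z'} φ ψ χ := by
    ext
    change φ.hom ▷ (Y.obj ⊗ Z.obj) ≫ X'.obj ◁ (ψ.hom ⊗ₘ χ.hom) ≫ (α_ _ _ _).inv =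
      (α_ _ _ _).inv ≫ ((φ.hom ▷ Y.obj ≫ X'.obj ◁ ψ.hom) ⊗ₘ χ.hom)
    rw [← MonoidalCategory.tensorHom_def, ← MonoidalCategory.tensorHom_def_assoc,
      associator_inv_naturality]
  right_tensor X Y Z Z' := by
    ext
    change (α_ X.obj Y.obj (Z.obj ⊗ Z'.obj)).inv ≫ (α_ _ _ _).inv =
      X.obj ◁ (α_ _ _ _).inv ≫ (α_ _ _ _).inv ≫ (α_ _ _ _).inv ▷ _
    simp
  right_unit X Y := by
    ext
    change (α_ X.obj Y.obj e).inv ≫ (X.obj ⊗ Y.obj) ◁ s.i ≫ (ρ_ _).hom =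
      X.obj ◁ (Y.obj ◁ s.i ≫ (ρ_ _).hom)
    simp
  left_right Z X Y Z' := by
    ext
    change (α_ (Z.obj ⊗ X.obj) Y.obj Z'.obj).inv ≫ (α_ _ _ _).hom ▷ _ ≫ (α_ _ _ _).hom =
      (α_ _ _ _).hom ≫ _ ◁ (α_ _ _ _).inv
    simp
  left_balance Z X Z' Y := by
    ext
    exact (pentagon _ _ _ _).symm
  right_balance X Z Y Z' := by
    ext
    change (α_ (X.obj ⊗ Z) Y.obj Z'.obj).inv ≫ (α_ _ _ _).hom ▷ _ =
      (α_ _ _ _).hom ≫ _ ◁ (α_ _ _ _).inv ≫ (α_ _ _ _).inv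
    simp

/-- The tensor product of `C`, as a balanced bimodule functor `(C ⊗ e) × (e ⊗ C) ⥤ C` over
`C`, `e ⊗ C ⊗ e` and `C`. -/
def columnRowTensor (hl : ∀ X : C, PreservesFiniteColimits (tensorLeft X))
    (hr : ∀ X : C, PreservesFiniteColimits (tensorRight X)) (s : Retract e (𝟙_ C)) :
    BalancedBimoduleFunctor C (Corner s s) C (Column s) (Row s) C where
  functor := columnRowTensorFunctor s
  rightExact_left Y := by
    have := hr Y.obj
    exact inferInstanceAs (PreservesFiniteColimits ((column s).ι ⋙ tensorRight Y.obj))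
  rightExact_right X := by
    have := hl X.obj
    exact inferInstanceAs (PreservesFiniteColimits ((row s).ι ⋙ tensorLeft X.obj))
  balance X Z Y := α_ X.obj Z.obj Y.obj
  balance_naturality_left φ Z Y := associator_naturality_left φ.hom Z.obj Y.obj
  balance_naturality_middle X _ _ φ Y := associator_naturality_middle X.obj φ.hom Y.obj
  balance_naturality_right X Z _ _ φ := associator_naturality_right X.obj Z.obj φ.hom
  balance_unit X Y := by
    change (α_ X.obj e Y.obj).hom ≫ X.obj ◁ (s.i ▷ Y.obj ≫ (λ_ _).hom) =
      (X.obj ◁ s.i ≫ (ρ_ _).hom) ▷ Y.obj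
    simp
  balance_tensor X Z Z' Y := by
    change (α_ X.obj (Z.obj ⊗ Z'.obj) Y.obj).hom ≫ X.obj ◁ (α_ _ _ _).hom =
      (α_ _ _ _).inv ▷ _ ≫ (α_ _ _ _).hom ≫ (α_ _ _ _).hom
    simp
  left Z X Y := α_ Z X.obj Y.obj
  left_naturality {Z Z' X X' Y Y'} φ ψ χ := by
    change (φ ⊗ₘ ψ.hom) ▷ Y.obj ≫ (Z' ⊗ X'.obj) ◁ χ.hom ≫ (α_ _ _ _).hom =
      (α_ _ _ _).hom ≫ (φ ⊗ₘ (ψ.hom ▷ Y.obj ≫ X'.obj ◁ χ.hom))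
    rw [← MonoidalCategory.tensorHom_def, ← MonoidalCategory.tensorHom_def_assoc,
      associator_naturality]
  left_tensor Z Z' X Y := (pentagon Z Z' X.obj Y.obj).symm
  left_unit X Y := by
    change (α_ (𝟙_ C) X.obj Y.obj).hom ≫ (λ_ _).hom = (λ_ _).hom ▷ Y.obj
    simp
  right X Y Z := (α_ X.obj Y.obj Z).symm
  right_naturality {X X' Y Y' Z Z'} φ ψ χ := by
    change φ.hom ▷ (Y.obj ⊗ Z) ≫ X'.obj ◁ (ψ.hom ⊗ₘ χ) ≫ (α_ _ _ _).inv =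
      (α_ _ _ _).inv ≫ ((φ.hom ▷ Y.obj ≫ X'.obj ◁ ψ.hom) ⊗ₘ χ)
    rw [← MonoidalCategory.tensorHom_def, ← MonoidalCategory.tensorHom_def_assoc,
      associator_inv_naturality]
  right_tensor X Y Z Z' := by
    change (α_ X.obj Y.obj (Z ⊗ Z')).inv ≫ (α_ _ _ _).inv =
      X.obj ◁ (α_ _ _ _).inv ≫ (α_ _ _ _).inv ≫ (α_ _ _ _).inv ▷ _
    simp
  right_unit X Y := by
    change (α_ X.obj Y.obj (𝟙_ C)).inv ≫ (ρ_ _).hom = X.obj ◁ (ρ_ _).hom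
    simp
  left_right Z X Y Z' := by
    change (α_ (Z ⊗ X.obj) Y.obj Z').inv ≫ (α_ _ _ _).hom ▷ _ ≫ (α_ _ _ _).hom =
      (α_ _ _ _).hom ≫ _ ◁ (α_ _ _ _).inv
    simp
  left_balance Z X Z' Y := (pentagon Z X.obj Z'.obj Y.obj).symm
  right_balance X Z Y Z' := by
    change (α_ (X.obj ⊗ Z.obj) Y.obj Z').inv ≫ (α_ _ _ _).hom ▷ _ =
      (α_ _ _ _).hom ≫ _ ◁ (α_ _ _ _).inv ≫ (α_ _ _ _).inv
    simp

end BalancedFunctors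

noncomputable instance abelianColumn {C : Type u} [Category.{v} C] [Abelian C]
    [MonoidalCategory C] {e : C} (s : Retract e (𝟙_ C)) : Abelian (Column s) :=
  (column_isFixedBy s).abelian

section EvaluationMap

variable {C : Type u} [Category.{v} C] [MonoidalCategory C]

/-- The map `X ⊗ X' ⊗ Z ⟶ Z` given by evaluation. -/
def evaluationMap (X X' Z : C) [ExactPairing X' X] : X ⊗ (X' ⊗ Z) ⟶ Z :=
  (α_ X X' Z).inv ≫ ε_ X' X ▷ Z ≫ (λ_ Z).hom

variable (X X' : C) [ExactPairing X' X]

lemma evaluationMap_naturality {Z Z' : C} (f : Z ⟶ Z') :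
    X ◁ X' ◁ f ≫ evaluationMap X X' Z' = evaluationMap X X' Z ≫ f := by
  simp only [evaluationMap, Category.assoc]
  rw [← leftUnitor_naturality, ← whisker_exchange_assoc]
  simp

lemma evaluationMap_tensor (Z W : C) :
    evaluationMap X X' (Z ⊗ W) =
      X ◁ (α_ X' Z W).inv ≫ (α_ X (X' ⊗ Z) W).inv ≫ evaluationMap X X' Z ▷ W := by
  simp [evaluationMap]

lemma associator_evaluationMap (Z W : C) :
    (α_ X (X' ⊗ Z) W).hom ≫ X ◁ (α_ X' Z W).hom ≫ evaluationMap X X' (Z ⊗ W) =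
      evaluationMap X X' Z ▷ W := by
  simp [evaluationMap]

lemma epi_evaluationMap {Z : C} (h : Epi (ε_ X' X ▷ Z)) : Epi (evaluationMap X X' Z) := by
  unfold evaluationMap
  infer_instance

end EvaluationMap

end UnitSummand

/-! ### Presenting objects from epimorphic evaluations. -/

namespace UnitSummand

open BalancedFunctor

variable {C : Type u} [Category.{v} C] [Abelian C] [MonoidalCategory C] [MonoidalPreadditive C]
  [RigidCategory C] {e f g : C}
  (hl : ∀ X : C, PreservesFiniteColimits (tensorLeft X))
  (hr : ∀ X : C, PreservesFiniteColimits (tensorRight X))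

lemma epi_of_epi_hom {P : ObjectProperty C} {X Y : P.FullSubcategory} (φ : X ⟶ Y)
    (h : Epi φ.hom) : Epi φ :=
  P.ι.epi_of_epi_map (f := φ) h

lemma isZero_of_isZero_obj {P : ObjectProperty C} {X : P.FullSubcategory} (h : IsZero X.obj) :
    IsZero X where
  unique_to Y := ⟨⟨⟨ObjectProperty.homMk (h.to_ Y.obj)⟩, fun _ => by
    ext; exact h.eq_of_src _ _⟩⟩
  unique_from Y := ⟨⟨⟨ObjectProperty.homMk (h.from_ Y.obj)⟩, fun _ => by
    ext; exact h.eq_of_tgt _ _⟩⟩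

/-- An object of `e ⊗ C ⊗ f` whose evaluation is epimorphic on `e ⊗ C` presents the objects of
`e ⊗ C ⊗ g`. -/
noncomputable def cornerPresentingObject (s : Retract e (𝟙_ C)) (t : Retract f (𝟙_ C))
    (r : Retract g (𝟙_ C)) (X X' : C) [ExactPairing X' X] (hX : corner s t X)
    (hX' : corner t s X') (hε : ∀ Z, row s Z → Epi (ε_ X' X ▷ Z)) :
    PresentingObject (cornerTensor hl hr s t r).toBalancedFunctor where
  x₀ := ⟨X, hX⟩
  -- Both `L` and `K` tensor with the dual `X'` on the left; both counits are given by the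
  -- evaluation, and the remaining isomorphisms are associators.
  L := (corner t r).lift ((corner s r).ι ⋙ tensorLeft X')
    (fun Z => corner_tensor hX' Z.property)
  rightExact := by
    have := hl X'
    exact preservesFiniteColimits_of_comp_ι _
      (inferInstanceAs (PreservesFiniteColimits ((corner s r).ι ⋙ tensorLeft X')))
  K := (corner t t).lift ((corner s t).ι ⋙ tensorLeft X')
    (fun Z => corner_tensor hX' Z.property)
  κ x y := ObjectProperty.isoMk _ (α_ X' x.obj y.obj)
  κ_left f y := by ext; exact associator_naturality_middle _ _ _
  κ_right x _ _ h := by ext; exact associator_naturality_right _ _ _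
  ν x b := ObjectProperty.isoMk _ (α_ X' x.obj b.obj).symm
  ε :=
    { app := fun Z => ObjectProperty.homMk (evaluationMap X X' Z.obj)
      naturality := fun _ _ f => by ext; exact evaluationMap_naturality X X' f.hom }
  ε' :=
    { app := fun Z => ObjectProperty.homMk (evaluationMap X X' Z.obj)
      naturality := fun _ _ f => by ext; exact evaluationMap_naturality X X' f.hom }
  isColimit_ε Z := (nonempty_isColimit_selfCofork _ (fun Z => epi_of_epi_hom _
    (epi_evaluationMap X X' (hε _ (corner_le_row s r _ Z.property)))) Z).some
  isColimit_ε' Z := (nonempty_isColimit_selfCofork _ (fun Z => epi_of_epi_hom _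
    (epi_evaluationMap X X' (hε _ (corner_le_row s t _ Z.property)))) Z).some
  ε_κ x y := by ext; exact associator_evaluationMap X X' x.obj y.obj
  ε'_ν x b := by ext; exact evaluationMap_tensor X X' x.obj b.obj
  κ_balance x b y := by
    ext
    change (α_ X' (x.obj ⊗ b.obj) y.obj).hom ≫ X' ◁ (α_ _ _ _).hom =
      (α_ _ _ _).inv ▷ _ ≫ (α_ _ _ _).hom ≫ (α_ _ _ _).hom
    simp

/-- An object of `C ⊗ e` whose evaluation is epimorphic presents the objects of `C`. -/
noncomputable def columnRowPresentingObject (s : Retract e (𝟙_ C)) (X X' : C)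
    [ExactPairing X' X] (hX : column s X) (hX' : row s X') (hε : Epi (ε_ X' X)) :
    PresentingObject (columnRowTensor hl hr s).toBalancedFunctor where
  x₀ := ⟨X, hX⟩
  L := (row s).lift (tensorLeft X') (fun Z => row_tensor hX' Z)
  rightExact := by
    have := hl X'
    exact preservesFiniteColimits_of_comp_ι _
      (inferInstanceAs (PreservesFiniteColimits (tensorLeft X')))
  K := (corner s s).lift ((column s).ι ⋙ tensorLeft X')
    (fun Z => corner_of_row_column hX' Z.property)
  κ x y := ObjectProperty.isoMk _ (α_ X' x.obj y.obj)
  κ_left f y := by ext; exact associator_naturality_middle _ _ _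
  κ_right x _ _ h := by ext; exact associator_naturality_right _ _ _
  ν x b := ObjectProperty.isoMk _ (α_ X' x.obj b.obj).symm
  ε :=
    { app := fun Z => evaluationMap X X' Z
      naturality := fun _ _ f => evaluationMap_naturality X X' f }
  ε' :=
    { app := fun Z => ObjectProperty.homMk (evaluationMap X X' Z.obj)
      naturality := fun _ _ f => by ext; exact evaluationMap_naturality X X' f.hom }
  isColimit_ε Z := (nonempty_isColimit_selfCofork _
    (fun Z => epi_evaluationMap X X' inferInstance) Z).some
  isColimit_ε' Z := (nonempty_isColimit_selfCofork _ (fun Z => epi_of_epi_hom _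
    (epi_evaluationMap X X' inferInstance)) Z).some
  ε_κ x y := associator_evaluationMap X X' x.obj y.obj
  ε'_ν x b := by ext; exact evaluationMap_tensor X X' x.obj b.obj
  κ_balance x b y := by
    ext
    change (α_ X' (x.obj ⊗ b.obj) y.obj).hom ≫ X' ◁ (α_ _ _ _).hom =
      (α_ _ _ _).inv ▷ _ ≫ (α_ _ _ _).hom ≫ (α_ _ _ _).hom
    simp

/-- An object of `e ⊗ C` whose evaluation is epimorphic on `e ⊗ C` presents the objects of
`e ⊗ C ⊗ e`. -/
noncomputable def rowColumnPresentingObject (s : Retract e (𝟙_ C)) (X X' : C)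
    [ExactPairing X' X] (hX : row s X)
    (hε : ∀ Z, row s Z → Epi (ε_ X' X ▷ Z)) :
    PresentingObject (rowColumnTensor hl hr s).toBalancedFunctor where
  x₀ := ⟨X, hX⟩
  L := (column s).lift ((corner s s).ι ⋙ tensorLeft X')
    (fun Z => column_tensor X' (corner_le_column s s _ Z.property))
  rightExact := by
    have := hl X'
    exact preservesFiniteColimits_of_comp_ι _
      (inferInstanceAs (PreservesFiniteColimits ((corner s s).ι ⋙ tensorLeft X')))
  K := (row s).ι ⋙ tensorLeft X'
  κ x y := ObjectProperty.isoMk _ (α_ X' x.obj y.obj)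
  κ_left f y := by ext; exact associator_naturality_middle _ _ _
  κ_right x _ _ h := by ext; exact associator_naturality_right _ _ _
  ν x b := (α_ X' x.obj b).symm
  ε :=
    { app := fun Z => ObjectProperty.homMk (evaluationMap X X' Z.obj)
      naturality := fun _ _ f => by ext; exact evaluationMap_naturality X X' f.hom }
  ε' :=
    { app := fun Z => ObjectProperty.homMk (evaluationMap X X' Z.obj)
      naturality := fun _ _ f => by ext; exact evaluationMap_naturality X X' f.hom }
  isColimit_ε Z := (nonempty_isColimit_selfCofork _ (fun Z => epi_of_epi_hom _
    (epi_evaluationMap X X' (hε _ (corner_le_row s s _ Z.property)))) Z).some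
  isColimit_ε' Z := (nonempty_isColimit_selfCofork _ (fun Z => epi_of_epi_hom _
    (epi_evaluationMap X X' (hε _ Z.property))) Z).some
  ε_κ x y := by ext; exact associator_evaluationMap X X' x.obj y.obj
  ε'_ν x b := by ext; exact evaluationMap_tensor X X' x.obj b
  κ_balance x b y := by
    ext
    change (α_ X' (x.obj ⊗ b) y.obj).hom ≫ X' ◁ (α_ _ _ _).hom =
      (α_ _ _ _).inv ▷ _ ≫ (α_ _ _ _).hom ≫ (α_ _ _ _).hom
    simp

include hl in
lemma preservesFiniteColimits_lift_tensorLeft {P Q : ObjectProperty C}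
    (hP : PreservesFiniteColimits P.ι) (F : P.FullSubcategory ⥤ Q.FullSubcategory) (X : C)
    (hF : F ⋙ Q.ι = P.ι ⋙ tensorLeft X) : PreservesFiniteColimits F := by
  have := hl X
  exact preservesFiniteColimits_of_comp_ι _ (hF ▸ inferInstance)

include hr in
lemma preservesFiniteColimits_lift_tensorRight {P Q : ObjectProperty C}
    (hP : PreservesFiniteColimits P.ι) (F : P.FullSubcategory ⥤ Q.FullSubcategory) (X : C)
    (hF : F ⋙ Q.ι = P.ι ⋙ tensorRight X) : PreservesFiniteColimits F := by
  have := hr X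
  exact preservesFiniteColimits_of_comp_ι _ (hF ▸ inferInstance)

/-- The exactness conditions hold in `C`, and the inclusions of the corners preserve and reflect
finite colimits. Only the universal property needs the presenting object. -/
lemma isTensorProduct_cornerTensor (s : Retract e (𝟙_ C)) (t : Retract f (𝟙_ C))
    (r : Retract g (𝟙_ C))
    (h : Nonempty (PresentingObject (cornerTensor hl hr s t r).toBalancedFunctor)) :
    BalancedBimoduleFunctor.IsTensorProduct.{u', v'} (cornerTensor hl hr s t r) where
  hasFiniteColimits_base := inferInstance
  hasFiniteColimits_left := inferInstance
  hasFiniteColimits_right := inferInstance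
  rightExact_tensorLeft c :=
    preservesFiniteColimits_lift_tensorLeft hl inferInstance _ c.obj rfl
  rightExact_tensorRight c :=
    preservesFiniteColimits_lift_tensorRight hr inferInstance _ c.obj rfl
  rightExact_rightAction x :=
    preservesFiniteColimits_lift_tensorLeft hl inferInstance _ x.obj rfl
  rightExact_rightAction' c :=
    preservesFiniteColimits_lift_tensorRight hr inferInstance _ c.obj rfl
  rightExact_leftAction c :=
    preservesFiniteColimits_lift_tensorLeft hl inferInstance _ c.obj rfl
  rightExact_leftAction' y :=
    preservesFiniteColimits_lift_tensorRight hr inferInstance _ y.obj rfl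
  hasFiniteColimits := inferInstance
  isEquivalence _ := h.some.isEquivalence_compFunctor

lemma isTensorProduct_columnRowTensor (s : Retract e (𝟙_ C))
    (h : Nonempty (PresentingObject (columnRowTensor hl hr s).toBalancedFunctor)) :
    BalancedBimoduleFunctor.IsTensorProduct.{u', v'} (columnRowTensor hl hr s) where
  hasFiniteColimits_base := inferInstance
  hasFiniteColimits_left := inferInstance
  hasFiniteColimits_right := inferInstance
  rightExact_tensorLeft c :=
    preservesFiniteColimits_lift_tensorLeft hl inferInstance _ c.obj rfl
  rightExact_tensorRight c :=
    preservesFiniteColimits_lift_tensorRight hr inferInstance _ c.obj rfl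
  rightExact_rightAction x :=
    preservesFiniteColimits_lift_tensorLeft hl inferInstance _ x.obj rfl
  rightExact_rightAction' c :=
    preservesFiniteColimits_lift_tensorRight hr inferInstance _ c.obj rfl
  rightExact_leftAction c :=
    preservesFiniteColimits_lift_tensorLeft hl inferInstance _ c.obj rfl
  rightExact_leftAction' y :=
    preservesFiniteColimits_lift_tensorRight hr inferInstance _ y.obj rfl
  hasFiniteColimits := inferInstance
  isEquivalence _ := h.some.isEquivalence_compFunctor

lemma isTensorProduct_rowColumnTensor (s : Retract e (𝟙_ C))
    (h : Nonempty (PresentingObject (rowColumnTensor hl hr s).toBalancedFunctor)) :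
    BalancedBimoduleFunctor.IsTensorProduct.{u', v'} (rowColumnTensor hl hr s) where
  hasFiniteColimits_base := inferInstance
  hasFiniteColimits_left := inferInstance
  hasFiniteColimits_right := inferInstance
  rightExact_tensorLeft := hl
  rightExact_tensorRight := hr
  rightExact_rightAction x := by
    have := hl x.obj
    exact preservesFiniteColimits_of_comp_ι _
      (inferInstanceAs (PreservesFiniteColimits (tensorLeft x.obj)))
  rightExact_rightAction' c :=
    preservesFiniteColimits_lift_tensorRight hr inferInstance _ c rfl
  rightExact_leftAction c :=
    preservesFiniteColimits_lift_tensorLeft hl inferInstance _ c rfl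
  rightExact_leftAction' y := by
    have := hr y.obj
    exact preservesFiniteColimits_of_comp_ι _
      (inferInstanceAs (PreservesFiniteColimits (tensorRight y.obj)))
  hasFiniteColimits := inferInstance
  isEquivalence _ := h.some.isEquivalence_compFunctor

end UnitSummand

/-! ### Blocks and rows as invertible bimodules. -/

namespace UnitDecomposition

open UnitSummand BalancedFunctor

variable {C : Type u} [Category.{v} C] [Abelian C] [MonoidalCategory C] [MonoidalPreadditive C]
  [RigidCategory C] {Λ : Type u₁} (d : UnitDecomposition C Λ)
  (hl : ∀ X : C, PreservesFiniteColimits (tensorLeft X))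
  (hr : ∀ X : C, PreservesFiniteColimits (tensorRight X))

lemma not_isZero_tensor_of_row {i : Λ} {X : C} (hX : row (d.summand i) X) (h : ¬ IsZero X) :
    ¬ IsZero (d.e i ⊗ X) :=
  fun h' => h (h'.of_iso (leftIso (d.summand i) hX).symm)

lemma corner_leftDual {i j : Λ} {X : C} (hX : corner (d.summand i) (d.summand j) X) :
    corner (d.summand j) (d.summand i) (ᘁX) := by
  rw [corner_iff_row_column] at hX ⊢
  exact ⟨(row_iff_column_dual (ᘁX) X _).2 hX.2, (column_iff_row_dual (ᘁX) X _).2 hX.1⟩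

/-- Any nonzero object of `C_ij` is a presenting object: it is isomorphic to its tensor product with
`e i`, so its evaluation is epimorphic on `e i ⊗ C`. -/
lemma isTensorProduct_cornerTensor (h : ∀ i j, IsNonzeroCategory (d.Block i j)) (i j l : Λ) :
    BalancedBimoduleFunctor.IsTensorProduct.{u', v'}
      (cornerTensor hl hr (d.summand i) (d.summand j) (d.summand l)) := by
  obtain ⟨X, hX⟩ := h i j
  have hX0 : ¬ IsZero X.obj := fun h0 => hX (isZero_of_isZero_obj h0)
  exact UnitSummand.isTensorProduct_cornerTensor hl hr _ _ _
    ⟨cornerPresentingObject hl hr _ _ _ X.obj (ᘁX.obj) X.property (d.corner_leftDual X.property)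
      fun Z hZ => d.epi_evaluation_whiskerRight
        (d.not_isZero_tensor_of_row (corner_le_row _ _ _ X.property) hX0) hZ⟩

-- The inverse of `C_ij` is `C_ji`.
include hl hr in
lemma isInvertibleBimodule_block (h : ∀ i j, IsNonzeroCategory (d.Block i j)) (i j : Λ) :
    IsInvertibleBimodule.{u', v'} (d.Block i i) (d.Block j j) (d.Block i j) :=
  ⟨d.Block j i, inferInstance, inferInstance, inferInstance, inferInstance,
    ⟨_, d.isTensorProduct_cornerTensor hl hr h i j i⟩,
    ⟨_, d.isTensorProduct_cornerTensor hl hr h j i j⟩⟩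

/-- The witness is the direct sum over `j` of nonzero objects of `C_ji`, which no `e j ⊗ -` kills.
-/
lemma exists_column_epi_evaluation [Finite Λ] (h : ∀ i j, IsNonzeroCategory (d.Block i j))
    (i : Λ) : ∃ X : C, column (d.summand i) X ∧ Epi (ε_ (ᘁX) X) := by
  have := Fintype.ofFinite Λ
  have : HasFiniteBiproducts C := Abelian.hasFiniteBiproducts
  choose x hx using fun j => h j i
  have hx0 : ∀ j, ¬ IsZero (x j).obj :=
    fun j h0 => hx j (isZero_of_isZero_obj h0)
  refine ⟨⨁ fun j => (x j).obj, ?_, d.epi_evaluation fun j hj => ?_⟩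
  · rw [column_iff]
    refine biproduct.hom_ext' _ _ fun j => ?_
    rw [ract_naturality, (column_iff _ _).1 (corner_le_column _ _ _ (x j).property)]
    simp
  · refine d.not_isZero_tensor_of_row (corner_le_row _ _ _ (x j).property) (hx0 j) ?_
    exact IsZero.of_mono (d.e j ◁ biproduct.ι (fun j => (x j).obj) j) hj

include hl hr in
lemma isInvertibleBimodule_rowBlock [Finite Λ] (h : ∀ i j, IsNonzeroCategory (d.Block i j))
    (i : Λ) : IsInvertibleBimodule.{u', v'} (d.Block i i) C (d.RowBlock i) := by
  obtain ⟨X, hX, hε⟩ := d.exists_column_epi_evaluation h i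
  -- The inverse bimodule is the column `C ⊗ e i`. The self-dual object `e i` presents the product
  -- of row and column; the product of column and row is all of `C` and needs the object `X`, which
  -- meets every block.
  have := exactPairingSelf (d.summand i)
  refine ⟨Column (d.summand i), inferInstance, inferInstance, inferInstance, inferInstance,
    ⟨_, UnitSummand.isTensorProduct_rowColumnTensor hl hr _
      ⟨rowColumnPresentingObject hl hr _ (d.e i) (d.e i) (row_self _)
        fun Z hZ => d.epi_evaluation_whiskerRight
          (d.not_isZero_tensor_of_row (row_self _) (d.not_isZero_e i)) hZ⟩⟩,
    ⟨_, UnitSummand.isTensorProduct_columnRowTensor hl hr _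
      ⟨columnRowPresentingObject hl hr _ X (ᘁX) hX ((row_iff_column_dual (ᘁX) X _).2 hX) hε⟩⟩⟩

end UnitDecomposition

/-! ### Finite categories: abelian structure, finite-dimensional morphism spaces, and fixed
subcategories. -/

section FiniteCategory

open scoped ModuleCat

/-- A finite-dimensional algebra is Noetherian, so its finitely generated modules form an abelian
category, and the structure transports along the equivalence. The equation ensures that the
preadditive structure is the given one. -/
lemma IsFiniteCategory.exists_abelian {k : Type w} [Field k] {C : Type u} [Category.{v} C]
    [P : Preadditive C] [Linear k C] (h : IsFiniteCategory k C) :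
    ∃ a : Abelian C, a.toPreadditive = P := by
  obtain ⟨A, _, _, _, F, _, _, _⟩ := h
  have : IsNoetherianRing Aᵐᵒᵖ := isNoetherian_of_tower k inferInstance
  have : HasFiniteProducts C :=
    ⟨fun n => Adjunction.hasLimitsOfShape_of_equivalence F⟩
  exact ⟨abelianOfEquivalence F, rfl⟩

lemma ModuleCat.finite_hom {k : Type w} [Field k] {A : Type w} [Ring A] [Algebra k A]
    [Module.Finite k A] (M N : ModuleCat.{w} A) [Module.Finite A M] [Module.Finite A N] :
    Module.Finite k (M ⟶ N) := by
  have : Module.Finite k M := Module.Finite.trans A M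
  have : Module.Finite k N := Module.Finite.trans A N
  let f : (M ⟶ N) →ₗ[k] (M →ₗ[k] N) :=
    { toFun := fun φ => φ.hom.restrictScalars k
      map_add' := fun _ _ => rfl
      map_smul' := fun _ _ => rfl }
  exact Module.Finite.of_injective f fun φ ψ h => by
    ext x
    exact LinearMap.congr_fun h x

lemma IsFiniteCategory.finite_hom {k : Type w} [Field k] {C : Type u} [Category.{v} C]
    [Preadditive C] [Linear k C] (h : IsFiniteCategory k C) (X Y : C) :
    Module.Finite k (X ⟶ Y) := by
  obtain ⟨A, _, _, _, F, _, _, _⟩ := h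
  have : Module.Finite k ((F.obj X).obj ⟶ (F.obj Y).obj) :=
    ModuleCat.finite_hom (F.obj X).obj (F.obj Y).obj
  let f : (X ⟶ Y) →ₗ[k] ((F.obj X).obj ⟶ (F.obj Y).obj) :=
    { toFun := fun φ => (F.map φ).hom
      map_add' := fun _ _ => by rw [F.map_add]; rfl
      map_smul' := fun _ _ => by rw [F.map_smul]; rfl }
  refine Module.Finite.of_injective f fun φ ψ h => F.map_injective ?_
  exact ObjectProperty.hom_ext _ h

section Restrict

variable {R S : Type w} [Ring R] [Ring S] (φ : R →+* S) (hφ : Function.Surjective φ)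

include hφ in
lemma ModuleCat.finite_restrictScalars_of_surjective (N : ModuleCat.{w} S)
    [Module.Finite S N] : Module.Finite R ((ModuleCat.restrictScalars φ).obj N) := by
  obtain ⟨s, hs⟩ := (inferInstance : Module.Finite S N).fg_top
  let s' : Finset ((ModuleCat.restrictScalars φ).obj N) := s
  have key : ∀ x : N, x ∈ Submodule.span S (s : Set N) →
      (show (ModuleCat.restrictScalars φ).obj N from x) ∈
        Submodule.span R (s' : Set ((ModuleCat.restrictScalars φ).obj N)) := fun x hx => by
    induction hx using Submodule.span_induction with
    | mem x h => exact Submodule.subset_span h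
    | zero => exact Submodule.zero_mem _
    | add x y _ _ hx hy => exact Submodule.add_mem _ hx hy
    | smul a x _ hx =>
      obtain ⟨r, rfl⟩ := hφ a
      exact Submodule.smul_mem _ r hx
  exact ⟨⟨s', eq_top_iff.2 fun x _ => key x (hs ▸ Submodule.mem_top)⟩⟩

/-- A module whose scalar multiplication is induced by another one is a restriction of scalars. -/
noncomputable def ModuleCat.restrictScalarsOfIso (M : ModuleCat.{w} R) [Module S M]
    (h : ∀ (r : R) (m : M), φ r • m = r • m) :
    (ModuleCat.restrictScalars φ).obj (ModuleCat.of S M) ≅ M :=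
  let e : (ModuleCat.restrictScalars φ).obj (ModuleCat.of S M) ≃ₗ[R] M :=
    { toFun := fun x => x
      invFun := fun x => x
      map_add' := fun _ _ => rfl
      map_smul' := h
      left_inv := fun _ => rfl
      right_inv := fun _ => rfl }
  e.toModuleIso

/-- Restriction of scalars of finitely generated modules along a surjective ring homomorphism. -/
noncomputable def FGModuleCat.restrictScalars : FGModuleCat.{w} S ⥤ FGModuleCat.{w} R :=
  (ModuleCat.isFG R).lift ((ModuleCat.isFG S).ι ⋙ ModuleCat.restrictScalars φ) fun N =>
    have : Module.Finite S N.obj := N.property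
    ModuleCat.finite_restrictScalars_of_surjective φ hφ N.obj

instance : (FGModuleCat.restrictScalars φ hφ).Faithful where
  map_injective {N N'} f g h := by
    refine ObjectProperty.hom_ext _ ((ModuleCat.restrictScalars φ).map_injective ?_)
    exact congrArg (fun h => h.hom) h

instance : (FGModuleCat.restrictScalars φ hφ).Full where
  map_surjective {N N'} f := by
    let f' : (ModuleCat.restrictScalars φ).obj N.obj ⟶ (ModuleCat.restrictScalars φ).obj N'.obj :=
      f.hom
    let g : N.obj ⟶ N'.obj := ModuleCat.ofHom
      { toFun := fun x => f'.hom x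
        map_add' := fun x y => f'.hom.map_add x y
        map_smul' := fun a x => by
          obtain ⟨r, rfl⟩ := hφ a
          exact f'.hom.map_smul r x }
    exact ⟨ObjectProperty.homMk g, rfl⟩

-- On a module killed by the kernel of `φ`, the action map to additive endomorphisms factors through
-- `S`, and generators over `R` remain generators over `S`.
include hφ in
lemma FGModuleCat.exists_restrictScalars_iso (M : FGModuleCat.{w} R)
    (hM : ∀ r, φ r = 0 → ∀ m : M.obj, r • m = 0) :
    ∃ N : FGModuleCat.{w} S, Nonempty ((FGModuleCat.restrictScalars φ hφ).obj N ≅ M) := by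
  let ψ : S →+* AddMonoid.End M.obj :=
    RingHom.liftOfSurjective φ hφ ⟨Module.toAddMonoidEnd R M.obj, fun r hr => by
      ext m
      exact hM r hr m⟩
  have hψ (r : R) : ψ (φ r) = Module.toAddMonoidEnd R M.obj r :=
    RingHom.liftOfRightInverse_comp_apply _ _ _ _ _
  let _ : Module S M.obj := Module.compHom M.obj ψ
  have hsmul (r : R) (m : M.obj) : φ r • m = r • m := congrArg (fun f => f m) (hψ r)
  have : Module.Finite S M.obj := by
    obtain ⟨s, hs⟩ := (inferInstance : Module.Finite R M.obj).fg_top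
    refine ⟨⟨s, eq_top_iff.2 fun x _ => ?_⟩⟩
    have hx : x ∈ Submodule.span R (s : Set M.obj) := hs ▸ Submodule.mem_top
    induction hx using Submodule.span_induction with
    | mem x h => exact Submodule.subset_span h
    | zero => exact Submodule.zero_mem _
    | add x y _ _ hx hy => exact Submodule.add_mem _ (hx trivial) (hy trivial)
    | smul a x _ hx =>
      rw [← hsmul]
      exact Submodule.smul_mem _ _ (hx trivial)
  exact ⟨FGModuleCat.of S M.obj,
    ⟨ObjectProperty.isoMk _ (ModuleCat.restrictScalarsOfIso φ M.obj hsmul)⟩⟩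

end Restrict

/-- The objects of a finite category on which an endomorphism of the identity functor acts as the
identity form a finite category. -/
lemma IsFiniteCategory.fullSubcategory_isFixedBy {k : Type w} [Field k] {C : Type u}
    [Category.{v} C] [Preadditive C] [Linear k C] (h : IsFiniteCategory k C)
    {P : ObjectProperty C} {θ : ∀ X : C, X ⟶ X} (hP : UnitSummand.IsFixedBy P θ) :
    IsFiniteCategory k P.FullSubcategory := by
  obtain ⟨A, _, _, _, F, _, _, _⟩ := h
  obtain ⟨E, rfl⟩ : ∃ E : C ≌ FGModuleCat.{w} Aᵐᵒᵖ, E.functor = F := ⟨F.asEquivalence, rfl⟩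
  -- Transport of `θ` to a natural endomorphism of the identity functor on modules.
  let θ' (M : FGModuleCat.{w} Aᵐᵒᵖ) : M ⟶ M :=
    E.counitInv.app M ≫ E.functor.map (θ (E.inverse.obj M)) ≫ E.counit.app M
  have hθ' {M M' : FGModuleCat.{w} Aᵐᵒᵖ} (f : M ⟶ M') : f ≫ θ' M' = θ' M ≫ f := by
    have h1 : f ≫ E.counitInv.app M' = E.counitInv.app M ≫ E.functor.map (E.inverse.map f) :=
      E.counitInv.naturality f
    have h2 : E.functor.map (E.inverse.map f) ≫ E.counit.app M' = E.counit.app M ≫ f :=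
      E.counit.naturality f
    have h3 := congrArg (fun g => E.functor.map g) (hP.1 (E.inverse.map f))
    simp only [Functor.map_comp] at h3
    simp only [θ', Category.assoc]
    rw [reassoc_of% h1, reassoc_of% h3, h2]
  have hθX (X : C) : θ' (E.functor.obj X) = E.functor.map (θ X) := by
    have h3 : E.unit.app X ≫ θ (E.inverse.obj (E.functor.obj X)) = θ X ≫ E.unit.app X :=
      hP.1 (E.unit.app X)
    simp only [θ', E.counitInv_app_functor]
    rw [← Functor.map_comp_assoc, h3, Functor.map_comp_assoc, E.functor_unit_comp,
      Category.comp_id]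
  have hθ'1 (M : FGModuleCat.{w} Aᵐᵒᵖ) (h : θ' M = 𝟙 M) : θ (E.inverse.obj M) = 𝟙 _ := by
    apply E.functor.map_injective
    rw [← cancel_mono (E.counit.app M), ← cancel_epi (E.counitInv.app M)]
    exact h.trans (by simp)
  let U : FGModuleCat.{w} Aᵐᵒᵖ := FGModuleCat.of Aᵐᵒᵖ Aᵐᵒᵖ
  -- The value at the generator of the free module of rank one; by naturality the transported
  -- endomorphism is multiplication by `z`, and `z` is central.
  let z : Aᵐᵒᵖ := (θ' U).hom.hom (1 : Aᵐᵒᵖ)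
  have hz (M : FGModuleCat.{w} Aᵐᵒᵖ) (m : M.obj) : (θ' M).hom.hom m = z • m := by
    let f : U ⟶ M := FGModuleCat.ofHom (LinearMap.toSpanSingleton Aᵐᵒᵖ M.obj m)
    have h1 := congrArg (fun g => g.hom.hom (1 : Aᵐᵒᵖ)) (hθ' f)
    have h2 : f.hom.hom (1 : Aᵐᵒᵖ) = m := one_smul _ m
    exact (congrArg (θ' M).hom.hom h2).symm.trans h1
  have hz' (r : Aᵐᵒᵖ) : z * r = r * z := by
    have h1 : (θ' U).hom.hom r = z * r := hz U r
    have h2 : (θ' U).hom.hom (r * 1 : Aᵐᵒᵖ) = r * z := (θ' U).hom.hom.map_smul r (1 : Aᵐᵒᵖ)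
    rw [mul_one] at h2
    exact h1.symm.trans h2
  -- A module is fixed exactly when `1 - z` kills it, that is, when it is a module over the quotient
  -- of `A` by the two-sided ideal generated by `1 - z`. This quotient is the algebra sought.
  let y : A := 1 - z.unop
  have hy (a : A) : a * y = y * a := by
    have := congrArg MulOpposite.unop (hz' (MulOpposite.op a))
    simp only [MulOpposite.unop_mul, MulOpposite.unop_op] at this
    simp only [y, mul_sub, sub_mul, this, mul_one, one_mul]
  let J : Ideal A := Ideal.span {y}
  have : J.IsTwoSided := ⟨fun {a} b ha => by
    obtain ⟨c, rfl⟩ := Ideal.mem_span_singleton'.1 ha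
    exact Ideal.mem_span_singleton'.2 ⟨c * b, by rw [mul_assoc, mul_assoc, hy]⟩⟩
  let φ : Aᵐᵒᵖ →+* (A ⧸ J)ᵐᵒᵖ := (Ideal.Quotient.mk J).op
  have hφ : Function.Surjective φ := fun x => by
    obtain ⟨a, ha⟩ := Ideal.Quotient.mk_surjective x.unop
    exact ⟨MulOpposite.op a, MulOpposite.unop_injective ha⟩
  have hφz : φ z = 1 := by
    apply MulOpposite.unop_injective
    change Ideal.Quotient.mk J z.unop = Ideal.Quotient.mk J 1
    rw [eq_comm, Ideal.Quotient.eq]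
    exact Ideal.subset_span rfl
  let H : FGModuleCat.{w} (A ⧸ J)ᵐᵒᵖ ⥤ P.FullSubcategory :=
    P.lift (FGModuleCat.restrictScalars φ hφ ⋙ E.inverse) (fun N => by
      rw [hP.2]
      refine hθ'1 _ (ObjectProperty.hom_ext _ (ModuleCat.hom_ext (LinearMap.ext fun m => ?_)))
      refine (hz _ m).trans ?_
      let m' : N.obj := m
      change φ z • m' = m'
      rw [hφz, one_smul])
  have hEa : E.inverse.Additive := inferInstance
  have hEl : E.inverse.Linear k := inferInstance
  have : (FGModuleCat.restrictScalars φ hφ).Additive := ⟨rfl⟩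
  have : (FGModuleCat.restrictScalars φ hφ).Linear k := ⟨fun f r => by
    refine ObjectProperty.hom_ext _ (ModuleCat.hom_ext (LinearMap.ext fun m => ?_))
    rfl⟩
  have : H.Additive := ⟨fun {_ _ f g} => ObjectProperty.hom_ext _
    ((FGModuleCat.restrictScalars φ hφ ⋙ E.inverse).map_add)⟩
  have : H.Linear k := ⟨fun {_ _} f r => ObjectProperty.hom_ext _
    ((FGModuleCat.restrictScalars φ hφ ⋙ E.inverse).map_smul r f)⟩
  have : H.Full := inferInstanceAs (P.lift _ _).Full
  have : H.Faithful := inferInstanceAs (P.lift _ _).Faithful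
  have : H.EssSurj := ⟨fun X => by
    have h1 : θ' (E.functor.obj X.obj) = 𝟙 _ := by
      rw [hθX, (hP.2 _).1 X.property, CategoryTheory.Functor.map_id]
    obtain ⟨N, ⟨e⟩⟩ := FGModuleCat.exists_restrictScalars_iso φ hφ (E.functor.obj X.obj) (fun r hr m => by
      have h2 : z • m = m := (hz _ m).symm.trans (by rw [h1]; rfl)
      have h3 : Ideal.Quotient.mk J r.unop = 0 := congrArg MulOpposite.unop hr
      rw [Ideal.Quotient.eq_zero_iff_mem] at h3
      obtain ⟨c, hc⟩ := Ideal.mem_span_singleton'.1 h3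
      have h4 : r = (1 - z) * MulOpposite.op c := by
        apply MulOpposite.unop_injective
        simp [← hc, y]
      have h5 : r = MulOpposite.op c * (1 - z) := by rw [h4, sub_mul, mul_sub, hz']; simp
      rw [h5, mul_smul, sub_smul, one_smul, h2, sub_self, smul_zero])
    exact ⟨N, ⟨ObjectProperty.isoMk _ (E.inverse.mapIso e ≪≫ (E.unitIso.app X.obj).symm)⟩⟩⟩
  have : H.IsEquivalence := {}
  let E' := H.asEquivalence
  have : E'.functor.Additive := ‹H.Additive›
  have : E'.functor.Linear k := ‹H.Linear k›
  exact ⟨A ⧸ J, inferInstance, inferInstance, inferInstance, E'.inverse, inferInstance,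
    inferInstance, inferInstance⟩

end FiniteCategory

/-! ### Central summands of the unit split a multi-tensor category. -/

namespace UnitSummand

section Truncation

variable {C : Type u} [Category.{v} C] [MonoidalCategory C] {e : C} (s : Retract e (𝟙_ C))

/-- The canonical map `e ⊗ X ⟶ X`. -/
def rowIncl (X : C) : e ⊗ X ⟶ X := s.i ▷ X ≫ (λ_ X).hom

/-- The canonical map `X ⟶ e ⊗ X`. -/
def rowProj (X : C) : X ⟶ e ⊗ X := (λ_ X).inv ≫ s.r ▷ X

lemma rowIncl_rowProj (X : C) : rowIncl s X ≫ rowProj s X = 𝟙 _ := by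
  simp [rowIncl, rowProj, ← comp_whiskerRight]

lemma rowProj_rowIncl (X : C) : rowProj s X ≫ rowIncl s X = lact (s.r ≫ s.i) X := by
  simp [rowIncl, rowProj, lact]

instance (X : C) : Mono (rowIncl s X) := mono_of_mono_fac (rowIncl_rowProj s X)

instance (X : C) : Epi (rowProj s X) := epi_of_epi_fac (rowIncl_rowProj s X)

lemma rowIncl_naturality {X Y : C} (f : X ⟶ Y) :
    e ◁ f ≫ rowIncl s Y = rowIncl s X ≫ f := by
  simp [rowIncl, whisker_exchange_assoc]

lemma rowIncl_tensor (X Y : C) : rowIncl s (X ⊗ Y) = (α_ e X Y).inv ≫ rowIncl s X ▷ Y := by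
  simp [rowIncl]

lemma inv_rightUnitor_rowIncl : (ρ_ e).inv ≫ rowIncl s (𝟙_ C) = s.i := by
  simp [rowIncl, unitors_equal]

/-- The canonical map `(e ⊗ X) ⊗ (e ⊗ Y) ⟶ e ⊗ (X ⊗ Y)`. -/
def rowMul (X Y : C) : (e ⊗ X) ⊗ (e ⊗ Y) ⟶ e ⊗ (X ⊗ Y) :=
  (rowIncl s X ⊗ₘ rowIncl s Y) ≫ rowProj s (X ⊗ Y)

/-- The canonical map `e ⊗ (X ⊗ Y) ⟶ (e ⊗ X) ⊗ (e ⊗ Y)`. -/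
def rowComul (X Y : C) : e ⊗ (X ⊗ Y) ⟶ (e ⊗ X) ⊗ (e ⊗ Y) :=
  rowIncl s (X ⊗ Y) ≫ (rowProj s X ⊗ₘ rowProj s Y)

/-- The idempotent acts as the identity on `(e ⊗ X) ⊗ (e ⊗ Y)`. Since `rowIncl` is a monomorphism,
the equation characterizes `rowMul`, and the coherence identities below are verified after composing
with `rowIncl`. -/
lemma rowMul_rowIncl (X Y : C) :
    rowMul s X Y ≫ rowIncl s (X ⊗ Y) = rowIncl s X ⊗ₘ rowIncl s Y := by
  have h := lact_naturality (s.r ≫ s.i) (rowIncl s X ⊗ₘ rowIncl s Y)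
  have h' : row s ((e ⊗ X) ⊗ (e ⊗ Y)) := row_tensor (row_tensor_self s X) _
  rw [rowMul, Category.assoc, rowProj_rowIncl, h, (row_iff s _).1 h', Category.id_comp]

lemma rowMul_rowComul (X Y : C) : rowMul s X Y ≫ rowComul s X Y = 𝟙 _ := by
  rw [rowComul, reassoc_of% (rowMul_rowIncl s X Y), tensorHom_comp_tensorHom, rowIncl_rowProj,
    rowIncl_rowProj, id_tensorHom_id]

/-- Centrality lets the left action on `Y` slide to the right action on `X` and become a second copy
of the left action on `X`; the idempotent absorbs it. -/
lemma rowComul_rowMul {X : C} (Y : C) (h : lact (s.r ≫ s.i) X = ract (s.r ≫ s.i) X) :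
    rowComul s X Y ≫ rowMul s X Y = 𝟙 _ := by
  have h1 : lact (s.r ≫ s.i) X ⊗ₘ lact (s.r ≫ s.i) Y = lact (s.r ≫ s.i) (X ⊗ Y) := by
    rw [MonoidalCategory.tensorHom_def, ← whiskerRight_ract, ← h, ← comp_whiskerRight,
      ← lact_comp, lact_tensor]
    simp
  rw [← cancel_mono (rowIncl s _), Category.assoc, rowMul_rowIncl, rowComul, Category.assoc,
    tensorHom_comp_tensorHom, rowProj_rowIncl, rowProj_rowIncl, h1, ← rowProj_rowIncl,
    reassoc_of% (rowIncl_rowProj s (X ⊗ Y)), Category.id_comp]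

/-- Centrality turns the right action on `X` into the left one, which slides onto `e` and is trivial
there. -/
lemma corner_tensor_of_central {X : C} (h : lact (s.r ≫ s.i) X = ract (s.r ≫ s.i) X) :
    corner s s (e ⊗ X) := by
  refine (corner_iff_row_column s s _).2 ⟨row_tensor_self s X, ?_⟩
  rw [column_iff, ract_tensor, ← h, ← whiskerRight_ract, (column_iff s e).1 (column_self s),
    id_whiskerRight]

variable (hs : ∀ X : C, lact (s.r ≫ s.i) X = ract (s.r ≫ s.i) X)

/-- For a central summand `e` of the unit, the functor `X ↦ e ⊗ X`. -/
def truncation : C ⥤ Corner s s :=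
  (corner s s).lift (tensorLeft e) fun X => corner_tensor_of_central s (hs X)

lemma rowMul_natural_left {X Y : C} (f : X ⟶ Y) (X' : C) :
    (e ◁ f) ▷ (e ⊗ X') ≫ rowMul s Y X' = rowMul s X X' ≫ e ◁ (f ▷ X') := by
  rw [← cancel_mono (rowIncl s _), Category.assoc, Category.assoc, rowMul_rowIncl,
    rowIncl_naturality, reassoc_of% (rowMul_rowIncl s X X'), ← tensorHom_id, ← tensorHom_id,
    tensorHom_comp_tensorHom, tensorHom_comp_tensorHom, rowIncl_naturality]
  simp

lemma rowMul_natural_right {X Y : C} (X' : C) (f : X ⟶ Y) :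
    (e ⊗ X') ◁ (e ◁ f) ≫ rowMul s X' Y = rowMul s X' X ≫ e ◁ (X' ◁ f) := by
  rw [← cancel_mono (rowIncl s _), Category.assoc, Category.assoc, rowMul_rowIncl,
    rowIncl_naturality, reassoc_of% (rowMul_rowIncl s X' X), ← id_tensorHom (e ⊗ X'), ← id_tensorHom X',
    tensorHom_comp_tensorHom, tensorHom_comp_tensorHom, rowIncl_naturality]
  simp

lemma rowMul_associativity (X Y Z : C) :
    rowMul s X Y ▷ (e ⊗ Z) ≫ rowMul s (X ⊗ Y) Z ≫ e ◁ (α_ X Y Z).hom =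
      (α_ _ _ _).hom ≫ (e ⊗ X) ◁ rowMul s Y Z ≫ rowMul s X (Y ⊗ Z) := by
  rw [← cancel_mono (rowIncl s _)]
  simp only [Category.assoc]
  rw [rowMul_rowIncl, rowIncl_naturality, reassoc_of% (rowMul_rowIncl s (X ⊗ Y) Z),
    ← tensorHom_id, ← id_tensorHom, tensorHom_comp_tensorHom, tensorHom_comp_tensorHom_assoc,
    rowMul_rowIncl, rowMul_rowIncl, Category.id_comp, Category.id_comp, associator_naturality]

lemma rowMul_left_unitality (X : C) :
    s.i ▷ (e ⊗ X) ≫ (λ_ (e ⊗ X)).hom =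
      (ρ_ e).inv ▷ (e ⊗ X) ≫ rowMul s (𝟙_ C) X ≫ e ◁ (λ_ X).hom := by
  rw [← cancel_mono (rowIncl s _)]
  simp only [Category.assoc]
  rw [rowIncl_naturality, reassoc_of% (rowMul_rowIncl s (𝟙_ C) X), ← tensorHom_id (ρ_ e).inv,
    tensorHom_comp_tensorHom_assoc, inv_rightUnitor_rowIncl, Category.id_comp,
    MonoidalCategory.tensorHom_def, Category.assoc, leftUnitor_naturality]

lemma rowMul_right_unitality (X : C) :
    (e ⊗ X) ◁ s.i ≫ (ρ_ (e ⊗ X)).hom =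
      (e ⊗ X) ◁ (ρ_ e).inv ≫ rowMul s X (𝟙_ C) ≫ e ◁ (ρ_ X).hom := by
  rw [← cancel_mono (rowIncl s _)]
  simp only [Category.assoc]
  rw [rowIncl_naturality, reassoc_of% (rowMul_rowIncl s X (𝟙_ C)), ← id_tensorHom _ (ρ_ e).inv,
    tensorHom_comp_tensorHom_assoc, inv_rightUnitor_rowIncl, Category.id_comp,
    MonoidalCategory.tensorHom_def', Category.assoc, rightUnitor_naturality]

/-- For a central summand `e` of the unit, the functor `X ↦ e ⊗ X` is monoidal. -/
def truncationCoreMonoidal : (truncation s hs).CoreMonoidal where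
  εIso := ObjectProperty.isoMk _ (ρ_ e).symm
  μIso X Y := ObjectProperty.isoMk _
    { hom := rowMul s X Y
      inv := rowComul s X Y
      hom_inv_id := rowMul_rowComul s X Y
      inv_hom_id := rowComul_rowMul s Y (hs X) }
  μIso_hom_natural_left f X' := by ext; exact rowMul_natural_left s f X'
  μIso_hom_natural_right X' f := by ext; exact rowMul_natural_right s X' f
  associativity X Y Z := by ext; exact rowMul_associativity s X Y Z
  left_unitality X := by ext; exact rowMul_left_unitality s X
  right_unitality X := by ext; exact rowMul_right_unitality s X

end Truncation

section CornerRigid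

variable {C : Type u} [Category.{v} C] [MonoidalCategory C] {e : C} (s : Retract e (𝟙_ C))

/-- Objects of `e ⊗ C ⊗ e` which are dual to each other in `C` are so in `e ⊗ C ⊗ e`. -/
abbrev cornerExactPairing (X Y : Corner s s) [ExactPairing X.obj Y.obj] : ExactPairing X Y where
  coevaluation' := ObjectProperty.homMk (s.i ≫ η_ X.obj Y.obj)
  evaluation' := ObjectProperty.homMk (ε_ X.obj Y.obj ≫ s.r)
  coevaluation_evaluation' := by
    ext
    change Y.obj ◁ (s.i ≫ η_ X.obj Y.obj) ≫ (α_ _ _ _).inv ≫ (ε_ X.obj Y.obj ≫ s.r) ▷ Y.obj =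
      (Y.obj ◁ s.i ≫ (ρ_ _).hom) ≫ (λ_ _).inv ≫ s.r ▷ Y.obj
    simp [ExactPairing.coevaluation_evaluation_assoc]
  evaluation_coevaluation' := by
    ext
    change (s.i ≫ η_ X.obj Y.obj) ▷ X.obj ≫ (α_ _ _ _).hom ≫ X.obj ◁ (ε_ X.obj Y.obj ≫ s.r) =
      (s.i ▷ X.obj ≫ (λ_ _).hom) ≫ (ρ_ _).inv ≫ X.obj ◁ s.r
    simp [ExactPairing.evaluation_coevaluation_assoc]

/-- Duality exchanges rows and columns, so duals taken in `C` stay in `e ⊗ C ⊗ e`. -/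
lemma nonempty_rigidCategory_corner [RigidCategory C] : Nonempty (RigidCategory (Corner s s)) := by
  refine ⟨{ rightDual := fun X => ?_, leftDual := fun X => ?_ }⟩
  · have h : corner s s (X.obj)ᘁ := by
      have := X.property
      rw [corner_iff_row_column] at this ⊢
      exact ⟨(column_iff_row_dual X.obj (X.obj)ᘁ s).1 this.2,
        (row_iff_column_dual X.obj (X.obj)ᘁ s).1 this.1⟩
    exact { rightDual := ⟨_, h⟩, exact := cornerExactPairing s X ⟨_, h⟩ }
  · have h : corner s s (ᘁ(X.obj)) := by
      have := X.property
      rw [corner_iff_row_column] at this ⊢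
      exact ⟨(row_iff_column_dual (ᘁ(X.obj)) X.obj s).2 this.2,
        (column_iff_row_dual (ᘁ(X.obj)) X.obj s).2 this.1⟩
    exact { leftDual := ⟨_, h⟩, exact := cornerExactPairing s ⟨_, h⟩ X }

end CornerRigid

instance {C : Type u} [Category.{v} C] [Preadditive C] [MonoidalCategory C]
    [MonoidalPreadditive C] {e : C} (s : Retract e (𝟙_ C)) :
    MonoidalPreadditive (Corner s s) where
  whiskerLeft_zero := by intros; ext; exact MonoidalPreadditive.whiskerLeft_zero
  zero_whiskerRight := by intros; ext; exact MonoidalPreadditive.zero_whiskerRight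
  whiskerLeft_add _ _ := by ext; exact MonoidalPreadditive.whiskerLeft_add _ _
  add_whiskerRight _ _ := by ext; exact MonoidalPreadditive.add_whiskerRight _ _

instance {k : Type w} [Field k] {C : Type u} [Category.{v} C] [Preadditive C] [Linear k C]
    [MonoidalCategory C] [MonoidalPreadditive C] [MonoidalLinear k C] {e : C}
    (s : Retract e (𝟙_ C)) : MonoidalLinear k (Corner s s) where
  whiskerLeft_smul _ _ _ _ _ := by ext; exact MonoidalLinear.whiskerLeft_smul _ _ _
  smul_whiskerRight _ _ _ _ _ := by ext; exact MonoidalLinear.smul_whiskerRight _ _ _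

lemma isMultiTensorCategory_corner {k : Type w} [Field k] {C : Type u} [Category.{v} C]
    [Abelian C] [Linear k C] [MonoidalCategory C] [h : IsMultiTensorCategory k C] {e : C}
    (s : Retract e (𝟙_ C)) : IsMultiTensorCategory k (Corner s s) where
  finite := h.finite.fullSubcategory_isFixedBy (corner_isFixedBy s s)
  rightExact_tensorLeft X :=
    have := h.rigid.some
    preservesFiniteColimits_lift_tensorLeft h.rightExact_tensorLeft inferInstance _ X.obj rfl
  rightExact_tensorRight X :=
    have := h.rigid.some
    preservesFiniteColimits_lift_tensorRight h.rightExact_tensorRight inferInstance _ X.obj rfl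
  rigid :=
    have := h.rigid.some
    nonempty_rigidCategory_corner s

section DirectSum

variable {C : Type u} [Category.{v} C] [Abelian C] [MonoidalCategory C] [MonoidalPreadditive C]
  {e f : C} (s : Retract e (𝟙_ C)) (t : Retract f (𝟙_ C))
  (hs : ∀ X : C, lact (s.r ≫ s.i) X = ract (s.r ≫ s.i) X)
  (ht : ∀ X : C, lact (t.r ≫ t.i) X = ract (t.r ≫ t.i) X)
  (h : s.r ≫ s.i + t.r ≫ t.i = 𝟙 _)

include h in
lemma lact_add_lact (X : C) : lact (s.r ≫ s.i) X + lact (t.r ≫ t.i) X = 𝟙 X := by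
  have : lact (s.r ≫ s.i + t.r ≫ t.i) X = lact (s.r ≫ s.i) X + lact (t.r ≫ t.i) X := by
    simp [lact, MonoidalPreadditive.add_whiskerRight]
  rw [← this, h, lact_id]

include h in
lemma lact_eq_zero_of_row {X : C} (hX : row t X) : lact (s.r ≫ s.i) X = 0 := by
  have := lact_add_lact s t h X
  rwa [(row_iff t X).1 hX, add_eq_right] at this

lemma rowIncl_comp_rowProj (h' : s.i ≫ t.r = 0) (X : C) : rowIncl s X ≫ rowProj t X = 0 := by
  simp [rowIncl, rowProj, ← comp_whiskerRight, h']

include h in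
lemma summand_i_comp_r : s.i ≫ t.r = 0 := by
  have h1 := congrArg (fun φ => s.i ≫ φ) h
  simp only [Preadditive.comp_add, s.retract_assoc, Category.comp_id, add_eq_left] at h1
  have h2 := congrArg (fun φ => φ ≫ t.r) h1
  simpa using h2

/-- If `X` in `e ⊗ C` is a summand of `Z` whose complement is not in `e ⊗ C`, then `e ⊗ Z` is
isomorphic to `X`. -/
def rowIsoOfSplit {X Z : C} (hX : row s X) (a : X ⟶ Z) (b : Z ⟶ X) (hab : a ≫ b = 𝟙 X)
    (hba : lact (s.r ≫ s.i) Z ≫ b ≫ a = lact (s.r ≫ s.i) Z) : e ⊗ Z ≅ X where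
  hom := rowIncl s Z ≫ b
  inv := a ≫ rowProj s Z
  hom_inv_id := by
    rw [← cancel_epi (rowProj s Z), Category.assoc, reassoc_of% (rowProj_rowIncl s Z),
      reassoc_of% hba, ← reassoc_of% (rowProj_rowIncl s Z), rowIncl_rowProj]
  inv_hom_id := by
    rw [Category.assoc, reassoc_of% (rowProj_rowIncl s Z),
      reassoc_of% (lact_naturality (s.r ≫ s.i) a), (row_iff s X).1 hX, Category.id_comp, hab]

-- Every morphism is the sum of its two truncations, the mixed terms vanish because `s.i ≫ t.r` and
-- `t.i ≫ s.r` are zero, and a pair of objects is the truncation of its biproduct.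
include h in
lemma isEquivalence_truncation_prod :
    ((truncation s hs).prod' (truncation t ht)).IsEquivalence := by
  have h' : t.r ≫ t.i + s.r ≫ s.i = 𝟙 _ := by rw [add_comm, h]
  have hst := summand_i_comp_r s t h
  have hts := summand_i_comp_r t s h'
  have key {X Y : C} (φ : X ⟶ Y) : φ =
      rowProj s X ≫ e ◁ φ ≫ rowIncl s Y + rowProj t X ≫ f ◁ φ ≫ rowIncl t Y := by
    rw [rowIncl_naturality, rowIncl_naturality, reassoc_of% (rowProj_rowIncl s X),
      reassoc_of% (rowProj_rowIncl t X), ← Preadditive.add_comp, lact_add_lact s t h,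
      Category.id_comp]
  refine { faithful := ⟨fun {X Y φ ψ} hφ => ?_⟩, full := ⟨fun {X Y} g => ?_⟩, essSurj := ⟨fun X => ?_⟩ }
  · have h1 : e ◁ φ = e ◁ ψ := congrArg (fun g => g.1.hom) hφ
    have h2 : f ◁ φ = f ◁ ψ := congrArg (fun g => g.2.hom) hφ
    rw [key φ, key ψ, h1, h2]
  · let g₁ : e ⊗ X ⟶ e ⊗ Y := g.1.hom
    let g₂ : f ⊗ X ⟶ f ⊗ Y := g.2.hom
    refine ⟨rowProj s X ≫ g₁ ≫ rowIncl s Y + rowProj t X ≫ g₂ ≫ rowIncl t Y, Prod.ext ?_ ?_⟩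
    · ext
      change e ◁ _ = g₁
      rw [← cancel_mono (rowIncl s Y), rowIncl_naturality, Preadditive.comp_add,
        reassoc_of% (rowIncl_rowProj s X), reassoc_of% (rowIncl_comp_rowProj s t hst X),
        zero_comp, add_zero]
    · ext
      change f ◁ _ = g₂
      rw [← cancel_mono (rowIncl t Y), rowIncl_naturality, Preadditive.comp_add,
        reassoc_of% (rowIncl_rowProj t X), reassoc_of% (rowIncl_comp_rowProj t s hts X),
        zero_comp, zero_add]
  · have : HasFiniteBiproducts C := Abelian.hasFiniteBiproducts
    have := hasBinaryBiproducts_of_finite_biproducts C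
    have hX := corner_le_row s s _ X.1.property
    have hY := corner_le_row t t _ X.2.property
    have h1 : lact (s.r ≫ s.i) (X.1.obj ⊞ X.2.obj) ≫ biprod.fst ≫ biprod.inl =
        lact (s.r ≫ s.i) _ := by
      have h2 : lact (s.r ≫ s.i) (X.1.obj ⊞ X.2.obj) ≫ biprod.snd = 0 := by
        rw [← lact_naturality, lact_eq_zero_of_row s t h hY, comp_zero]
      rw [eq_sub_of_add_eq (biprod.total (X := X.1.obj) (Y := X.2.obj)), Preadditive.comp_sub,
        reassoc_of% h2, zero_comp, sub_zero, Category.comp_id]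
    have h2 : lact (t.r ≫ t.i) (X.1.obj ⊞ X.2.obj) ≫ biprod.snd ≫ biprod.inr =
        lact (t.r ≫ t.i) _ := by
      have h2 : lact (t.r ≫ t.i) (X.1.obj ⊞ X.2.obj) ≫ biprod.fst = 0 := by
        rw [← lact_naturality, lact_eq_zero_of_row t s h' hX, comp_zero]
      rw [eq_sub_of_add_eq' (biprod.total (X := X.1.obj) (Y := X.2.obj)), Preadditive.comp_sub,
        reassoc_of% h2, zero_comp, sub_zero, Category.comp_id]
    exact ⟨X.1.obj ⊞ X.2.obj, ⟨Iso.prod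
      (ObjectProperty.isoMk _ (rowIsoOfSplit s hX biprod.inl biprod.fst (by simp) h1))
      (ObjectProperty.isoMk _ (rowIsoOfSplit t hY biprod.inr biprod.snd (by simp) h2))⟩⟩

lemma not_isIndecomposableMultiTensor {k : Type w} [Field k] {C : Type u} [Category.{v} C]
    [Abelian C] [Linear k C] [MonoidalCategory C] [IsMultiTensorCategory k C] {e f : C}
    (s : Retract e (𝟙_ C)) (t : Retract f (𝟙_ C))
    (hs : ∀ X : C, lact (s.r ≫ s.i) X = ract (s.r ≫ s.i) X)
    (ht : ∀ X : C, lact (t.r ≫ t.i) X = ract (t.r ≫ t.i) X)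
    (h : s.r ≫ s.i + t.r ≫ t.i = 𝟙 _) (he : ¬ IsZero e) (hf : ¬ IsZero f) :
    ¬ IsIndecomposableMultiTensor k C := fun hC => by
  have := isMultiTensorCategory_corner (k := k) s
  have := isMultiTensorCategory_corner (k := k) t
  refine hC.2 (Corner s s) (Corner t t) ⟨⟨e, corner_self s⟩, fun h0 => he ?_⟩
    ⟨⟨f, corner_self t⟩, fun h0 => hf ?_⟩
    ⟨truncation s hs, truncation t ht, (truncationCoreMonoidal s hs).toMonoidal,
      (truncationCoreMonoidal t ht).toMonoidal, ⟨?_⟩, ⟨?_⟩, ⟨?_⟩, ⟨?_⟩,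
      isEquivalence_truncation_prod s t hs ht h⟩
  · exact (corner s s).ι.map_isZero h0
  · exact (corner t t).ι.map_isZero h0
  · intros; ext; exact MonoidalPreadditive.whiskerLeft_add _ _
  · intros; ext; exact MonoidalLinear.whiskerLeft_smul _ _ _
  · intros; ext; exact MonoidalPreadditive.whiskerLeft_add _ _
  · intros; ext; exact MonoidalLinear.whiskerLeft_smul _ _ _

end DirectSum

end UnitSummand

/-! ### Indecomposability forces every block to be nonzero. -/

namespace UnitDecomposition

open UnitSummand

variable {C : Type u} [Category.{v} C] [Abelian C] [MonoidalCategory C] [MonoidalPreadditive C]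
  [RigidCategory C] {Λ : Type u₁} (d : UnitDecomposition C Λ)

lemma isNonzeroCategory_block_iff {i j : Λ} : IsNonzeroCategory (d.Block i j) ↔
    ∃ X : C, corner (d.summand i) (d.summand j) X ∧ ¬ IsZero X :=
  ⟨fun ⟨X, hX⟩ => ⟨X.obj, X.property, fun h => hX (isZero_of_isZero_obj h)⟩,
    fun ⟨X, h, hX⟩ => ⟨⟨X, h⟩, fun h => hX ((corner _ _).ι.map_isZero h)⟩⟩

lemma isNonzeroCategory_block_self (i : Λ) : IsNonzeroCategory (d.Block i i) :=
  d.isNonzeroCategory_block_iff.2 ⟨d.e i, corner_self _, d.not_isZero_e i⟩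

/-- The left dual of `X` lies in `C_ji`. It is nonzero because the identity of `X` factors through
the coevaluation, whose target has the dual as a tensor factor. -/
lemma isNonzeroCategory_block_symm {i j : Λ} (h : IsNonzeroCategory (d.Block i j)) :
    IsNonzeroCategory (d.Block j i) := by
  rw [isNonzeroCategory_block_iff] at h ⊢
  obtain ⟨X, hX, h⟩ := h
  refine ⟨ᘁX, d.corner_leftDual hX, fun h' => h ?_⟩
  have h1 : IsZero ((ᘁX) ⊗ X) := UnitSemisimple.isZero_tensor_left h' X
  rw [IsZero.iff_id_eq_zero]
  have h2 : 𝟙 X = (ρ_ X).inv ≫ (X ◁ η_ (ᘁX) X ≫ (α_ _ _ _).inv ≫ ε_ (ᘁX) X ▷ X) ≫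
      (λ_ X).hom := by
    rw [ExactPairing.coevaluation_evaluation]
    simp
  rw [h2, h1.eq_of_tgt (η_ (ᘁX) X) 0]
  simp

/-- The tensor product of nonzero objects is nonzero here: at the middle index, `X ⊗ e j ≅ X` and `e
j ⊗ Y ≅ Y`. -/
lemma isNonzeroCategory_block_trans {i j l : Λ} (h : IsNonzeroCategory (d.Block i j))
    (h' : IsNonzeroCategory (d.Block j l)) : IsNonzeroCategory (d.Block i l) := by
  rw [isNonzeroCategory_block_iff] at h h' ⊢
  obtain ⟨X, hX, h⟩ := h
  obtain ⟨Y, hY, h'⟩ := h'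
  refine ⟨X ⊗ Y, corner_tensor hX hY, fun h0 => ?_⟩
  rcases d.isZero_or_isZero_of_isZero_tensor j h0 with h0 | h0
  · exact h (h0.of_iso (rightIso _ (corner_le_column _ _ _ hX)).symm)
  · exact h' (h0.of_iso (leftIso _ (corner_le_row _ _ _ hY)).symm)

/-- A direct sum of some of the summands of the unit is a direct summand. -/
lemma exists_retract_sum (S : Finset Λ) : ∃ (e : C) (s : Retract e (𝟙_ C)),
    s.r ≫ s.i = ∑ j ∈ S, d.idem j := by
  classical
  have : HasFiniteBiproducts C := Abelian.hasFiniteBiproducts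
  refine ⟨⨁ fun j : S => d.e j,
    { i := biproduct.desc fun j => (d.summand j).i
      r := biproduct.lift fun j => (d.summand j).r
      retract := ?_ }, ?_⟩
  · refine biproduct.hom_ext' _ _ fun j => biproduct.hom_ext _ _ fun l => ?_
    rw [biproduct.ι_desc_assoc, Category.assoc, biproduct.lift_π, Category.comp_id]
    by_cases h : j = l
    · subst h
      rw [(d.summand j).retract, biproduct.ι_π_self]
    · rw [d.summand_i_r (fun h' => h (Subtype.ext h')), biproduct.ι_π_ne _ h]
  · let F : S → C := fun j => d.e j
    let a : 𝟙_ C ⟶ ⨁ F := biproduct.lift fun j => (d.summand j).r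
    let b : ⨁ F ⟶ 𝟙_ C := biproduct.desc fun j => (d.summand j).i
    have h : ∑ j, biproduct.π F j ≫ biproduct.ι F j = 𝟙 (⨁ F) :=
      IsBilimit.total (biproduct.isBilimit _)
    calc a ≫ b = a ≫ (∑ j, biproduct.π F j ≫ biproduct.ι F j) ≫ b := by
          rw [h, Category.id_comp]
      _ = ∑ j : S, (d.summand j).r ≫ (d.summand j).i := by
          rw [Preadditive.sum_comp, Preadditive.comp_sum]
          refine Finset.sum_congr rfl fun j _ => ?_
          rw [Category.assoc, biproduct.ι_desc, ← Category.assoc, biproduct.lift_π]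
      _ = _ := Finset.sum_coe_sort S d.idem

lemma sum_idem_ne_zero {S : Finset Λ} {i : Λ} (hi : i ∈ S) : ∑ j ∈ S, d.idem j ≠ 0 := fun h => by
  classical
  have h1 : d.idem i ≫ ∑ j ∈ S, d.idem j = d.idem i ≫ d.idem i := by
    rw [Preadditive.comp_sum]
    exact Finset.sum_eq_single i (fun j _ hj => d.idem_comp_idem hj.symm) (fun h => (h hi).elim)
  rw [h, comp_zero] at h1
  refine d.not_isZero_e i ((IsZero.iff_id_eq_zero _).2 ?_)
  have h2 : (d.summand i).i ≫ (d.idem i ≫ d.idem i) ≫ (d.summand i).r = 𝟙 _ := by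
    simp only [idem, Category.assoc, Retract.retract, Retract.retract_assoc, Category.comp_id]
  rw [← h2, ← h1, zero_comp, comp_zero]

/-- The composite factors through `e i ⊗ (X ⊗ e j)`, an object of the block `C_ij`. -/
lemma ract_comp_lact_eq_zero {i j : Λ} (h : ¬ IsNonzeroCategory (d.Block i j)) (X : C) :
    ract (d.idem j) X ≫ lact (d.idem i) X = 0 := by
  have h1 : IsZero (d.e i ⊗ (X ⊗ d.e j)) := by
    by_contra h'
    exact h (d.isNonzeroCategory_block_iff.2 ⟨_, corner_tensor_tensor _ _ X, h'⟩)
  have h2 := unitMap_counitMap_eq (d.summand i) (d.summand j) X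
  rw [h1.eq_of_tgt (unitMap (d.summand i) (d.summand j) X) 0, zero_comp] at h2
  exact h2.symm

lemma lact_sum (S : Finset Λ) (p : Λ → (𝟙_ C ⟶ 𝟙_ C)) (X : C) :
    lact (∑ j ∈ S, p j) X = ∑ j ∈ S, lact (p j) X := by
  simp only [lact, sum_whiskerRight, Preadditive.comp_sum, Preadditive.sum_comp]

lemma ract_sum (S : Finset Λ) (p : Λ → (𝟙_ C ⟶ 𝟙_ C)) (X : C) :
    ract (∑ j ∈ S, p j) X = ∑ j ∈ S, ract (p j) X := by
  simp only [ract, whiskerLeft_sum, Preadditive.comp_sum, Preadditive.sum_comp]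

/-- Expanded along blocks, the left action lives on pairs with row index in `S` and the right action
on pairs with column index in `S`. No nonzero block links `S` to its complement, so both are the sum
over `S × S`. -/
lemma lact_sum_eq_ract_sum [Fintype Λ] (S : Finset Λ)
    (h : ∀ i j, IsNonzeroCategory (d.Block i j) → (i ∈ S ↔ j ∈ S)) (X : C) :
    lact (∑ j ∈ S, d.idem j) X = ract (∑ j ∈ S, d.idem j) X := by
  have h1 : lact (∑ j ∈ S, d.idem j) X =
      ∑ l ∈ S, ∑ j ∈ S, ract (d.idem l) X ≫ lact (d.idem j) X := by
    rw [← Category.id_comp (lact _ X), ← d.sum_ract X, lact_sum, Preadditive.sum_comp]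
    simp only [Preadditive.comp_sum]
    refine (Finset.sum_subset S.subset_univ fun l _ hl => Finset.sum_eq_zero fun j hj => ?_).symm
    exact d.ract_comp_lact_eq_zero (fun h' => hl ((h j l h').1 hj)) X
  have h2 : ract (∑ j ∈ S, d.idem j) X =
      ∑ l ∈ S, ∑ j ∈ S, ract (d.idem l) X ≫ lact (d.idem j) X := by
    rw [← Category.comp_id (ract _ X), ← d.sum_lact X, ract_sum, Preadditive.sum_comp]
    simp only [Preadditive.comp_sum]
    refine Finset.sum_congr rfl fun l hl => (Finset.sum_subset S.subset_univ fun j _ hj => ?_).symm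
    exact d.ract_comp_lact_eq_zero (fun h' => hj ((h j l h').2 hl)) X
  rw [h1, h2]

lemma isNonzeroCategory_block {k : Type w} [Field k] {C : Type u} [Category.{v} C]
    [Abelian C] [Linear k C] [MonoidalCategory C] [IsMultiTensorCategory k C] {Λ : Type u₁}
    [Finite Λ] (d : UnitDecomposition C Λ) (h : IsIndecomposableMultiTensor k C) (i j : Λ) :
    IsNonzeroCategory (d.Block i j) := by
  classical
  have hC := ‹IsMultiTensorCategory k C›
  have : MonoidalPreadditive C := hC.toMonoidalPreadditive
  have : RigidCategory C := hC.rigid.some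
  have := Fintype.ofFinite Λ
  by_contra hij
  -- The class of `i` under the relation that a block is nonzero. If it misses `j`, the class and
  -- its complement give two nonzero complementary central summands of the unit.
  let S : Finset Λ := Finset.univ.filter fun l => IsNonzeroCategory (d.Block i l)
  have hS (l m : Λ) (hlm : IsNonzeroCategory (d.Block l m)) : l ∈ S ↔ m ∈ S := by
    simp only [S, Finset.mem_filter, Finset.mem_univ, true_and]
    exact ⟨fun hl => d.isNonzeroCategory_block_trans hl hlm,
      fun hm => d.isNonzeroCategory_block_trans hm (d.isNonzeroCategory_block_symm hlm)⟩
  obtain ⟨e, s, hs⟩ := d.exists_retract_sum S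
  obtain ⟨f, t, ht⟩ := d.exists_retract_sum Sᶜ
  refine not_isIndecomposableMultiTensor (k := k) s t ?_ ?_ ?_ ?_ ?_ h
  · rw [hs]
    exact d.lact_sum_eq_ract_sum S hS
  · rw [ht]
    exact d.lact_sum_eq_ract_sum Sᶜ fun l m hlm => by
      rw [Finset.mem_compl, Finset.mem_compl, hS l m hlm]
  · rw [hs, ht, Finset.sum_add_sum_compl, sum_idem]
  · refine fun h0 => d.sum_idem_ne_zero
      (Finset.mem_filter.2 ⟨Finset.mem_univ i, d.isNonzeroCategory_block_self i⟩ : i ∈ S) ?_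
    rw [← hs, h0.eq_of_tgt s.r 0, zero_comp]
  · have hj : j ∉ S := fun hj => hij (Finset.mem_filter.1 hj).2
    refine fun h0 => d.sum_idem_ne_zero (Finset.mem_compl.2 hj) ?_
    rw [← ht, h0.eq_of_tgt t.r 0, zero_comp]

end UnitDecomposition
/-! ### The Drinfeld center of `C` acts on `e ⊗ C` through that of `e ⊗ C ⊗ e` -/

namespace UnitSummand

section CenterTruncation

variable {C : Type u} [Category.{v} C] [MonoidalCategory C] {e : C} (s : Retract e (𝟙_ C))

/-- Compare the monoidal axiom at two copies of the unit with naturality at the unitor, and cancel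
one copy of the invertible half braiding. -/
lemma halfBraiding_unit {X : C} (b : HalfBraiding X) :
    (b.β (𝟙_ C)).hom = (ρ_ X).hom ≫ (λ_ X).inv := by
  have h1 := b.monoidal (𝟙_ C) (𝟙_ C)
  have h2 := b.naturality (λ_ (𝟙_ C)).hom
  have h3 : (b.β (𝟙_ C)).hom ▷ 𝟙_ C ≫ (α_ _ _ _).hom ≫ 𝟙_ C ◁ (b.β (𝟙_ C)).hom ≫
      (α_ _ _ _).inv ≫ (λ_ (𝟙_ C)).hom ▷ X =
      (b.β (𝟙_ C)).hom ▷ 𝟙_ C ≫ (ρ_ _).hom := by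
    have h4 := (α_ X (𝟙_ C) (𝟙_ C)).hom ≫= h2
    rw [h1] at h4
    simp only [Category.assoc, Iso.hom_inv_id_assoc] at h4
    rw [← h4, rightUnitor_naturality]
    simp [unitors_equal]
  rw [cancel_epi, ← leftUnitor_tensor_hom, leftUnitor_naturality, rightUnitor_tensor_hom,
    cancel_epi] at h3
  have h4 : (α_ (𝟙_ C) X (𝟙_ C)).inv ≫ (ρ_ (𝟙_ C ⊗ X)).hom = (λ_ _).hom ≫ (ρ_ X).hom ≫ (λ_ X).inv := by
    rw [← leftUnitor_naturality_assoc, Iso.hom_inv_id, Category.comp_id, rightUnitor_tensor_hom,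
      Iso.inv_hom_id_assoc]
  rw [← cancel_epi (λ_ _).hom, h3, ← h4, rightUnitor_tensor_hom, Iso.inv_hom_id_assoc]

/-- Naturality of the half braiding at `p`. Thus every summand of the unit is central as far as
central objects are concerned, and `e ⊗ Z` lies in `e ⊗ C ⊗ e`. -/
lemma lact_eq_ract_of_halfBraiding {X : C} (b : HalfBraiding X) (p : 𝟙_ C ⟶ 𝟙_ C) :
    lact p X = ract p X := by
  have h := b.naturality p
  rw [halfBraiding_unit] at h
  rw [lact, ract, ← cancel_epi (ρ_ X).hom, ← cancel_mono (λ_ X).inv]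
  simpa using h.symm

/-- The isomorphism `(e ⊗ Z) ⊗ x ≅ x ⊗ Z`, for `x` in `e ⊗ C`, given by a half braiding of `Z`. -/
@[simps]
def rowBraiding {Z : C} (b : HalfBraiding Z) {x : C} (hx : row s x) : (e ⊗ Z) ⊗ x ≅ x ⊗ Z where
  hom := rowIncl s Z ▷ x ≫ (b.β x).hom
  inv := (b.β x).inv ≫ rowProj s Z ▷ x
  hom_inv_id := by
    rw [Category.assoc, Iso.hom_inv_id_assoc, ← comp_whiskerRight, rowIncl_rowProj,
      id_whiskerRight]
  inv_hom_id := by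
    have h := lact_naturality (s.r ≫ s.i) (b.β x).hom
    rw [(row_iff s _).1 (row_tensor hx Z), Category.comp_id] at h
    rw [Category.assoc, ← comp_whiskerRight_assoc, rowProj_rowIncl, ← lact_tensor, ← h,
      Iso.inv_hom_id]

/-- The isomorphism `c ⊗ (e ⊗ Z) ≅ c ⊗ Z`, for `c` in `C ⊗ e`. -/
def columnRowInclIso (Z : C) {c : C} (hc : column s c) :
    c ⊗ (e ⊗ Z) ≅ c ⊗ Z where
  hom := c ◁ rowIncl s Z
  inv := c ◁ rowProj s Z
  hom_inv_id := by
    rw [← MonoidalCategory.whiskerLeft_comp, rowIncl_rowProj, MonoidalCategory.whiskerLeft_id]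
  inv_hom_id := by
    rw [← MonoidalCategory.whiskerLeft_comp, rowProj_rowIncl, ← whiskerRight_ract,
      (column_iff s c).1 hc, id_whiskerRight]

/-- The half braiding of `e ⊗ Z` with an object of `e ⊗ C ⊗ e`. -/
def truncBraiding {Z : C} (b : HalfBraiding Z) {c : C} (hc : corner s s c) :
    (e ⊗ Z) ⊗ c ≅ c ⊗ (e ⊗ Z) :=
  rowBraiding s b (corner_le_row s s c hc) ≪≫
    (columnRowInclIso s Z (corner_le_column s s c hc)).symm

/-- As `c ◁ rowIncl s Z` is a monomorphism, this equation characterizes `truncBraiding` as the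
restriction of the half braiding of `Z`; its axioms follow from those of `b`. -/
lemma truncBraiding_rowIncl {Z : C} (b : HalfBraiding Z) {c : C} (hc : corner s s c) :
    (truncBraiding s b hc).hom ≫ c ◁ rowIncl s Z = rowIncl s Z ▷ c ≫ (b.β c).hom :=
  (Category.assoc _ _ _).trans
    ((cancel_epi _).2 (columnRowInclIso s Z (corner_le_column s s c hc)).inv_hom_id |>.trans
      (Category.comp_id _))

instance (c X : C) : Mono (c ◁ rowIncl s X) :=
  mono_of_mono_fac (h := 𝟙 _) (by
    rw [← MonoidalCategory.whiskerLeft_comp, rowIncl_rowProj, MonoidalCategory.whiskerLeft_id])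

lemma truncBraiding_monoidal {Z : C} (b : HalfBraiding Z) {c c' : C} (hc : corner s s c)
    (hc' : corner s s c') (h : corner s s (c ⊗ c')) :
    (truncBraiding s b h).hom = (α_ _ _ _).inv ≫ (truncBraiding s b hc).hom ▷ c' ≫
      (α_ _ _ _).hom ≫ c ◁ (truncBraiding s b hc').hom ≫ (α_ _ _ _).inv := by
  rw [← cancel_mono ((c ⊗ c') ◁ rowIncl s Z), truncBraiding_rowIncl, b.monoidal]
  simp only [Category.assoc]
  rw [tensor_whiskerLeft, Iso.inv_hom_id_assoc, ← MonoidalCategory.whiskerLeft_comp_assoc,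
    truncBraiding_rowIncl, MonoidalCategory.whiskerLeft_comp_assoc,
    ← associator_naturality_middle_assoc, ← comp_whiskerRight_assoc, truncBraiding_rowIncl]
  simp

lemma truncBraiding_naturality {Z : C} (b : HalfBraiding Z) {c c' : C} (hc : corner s s c)
    (hc' : corner s s c') (f : c ⟶ c') :
    (e ⊗ Z) ◁ f ≫ (truncBraiding s b hc').hom = (truncBraiding s b hc).hom ≫ f ▷ (e ⊗ Z) := by
  rw [← cancel_mono (c' ◁ rowIncl s Z), Category.assoc, truncBraiding_rowIncl, Category.assoc,
    ← whisker_exchange, reassoc_of% (truncBraiding_rowIncl s b hc), ← b.naturality,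
    whisker_exchange_assoc]

/-- The half braiding of `e ⊗ Z` in `e ⊗ C ⊗ e` induced by a half braiding of `Z`. -/
def truncHalfBraiding {Z : C} (b : HalfBraiding Z) (h : corner s s (e ⊗ Z)) :
    HalfBraiding (C := Corner s s) ⟨e ⊗ Z, h⟩ where
  β c := ObjectProperty.isoMk _ (truncBraiding s b c.property)
  monoidal c c' := by
    ext
    exact truncBraiding_monoidal s b c.property c'.property (corner_tensor c.property c'.property)
  naturality {c c'} f := by
    ext
    exact truncBraiding_naturality s b c.property c'.property f.hom

lemma corner_tensor_center (Z : Center C) : corner s s (e ⊗ Z.1) :=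
  corner_tensor_of_central s (lact_eq_ract_of_halfBraiding Z.2 _)

lemma whiskerLeft_comm_truncBraiding {Z Z' : C} (b : HalfBraiding Z) (b' : HalfBraiding Z')
    (f : Z ⟶ Z') (hf : ∀ U, f ▷ U ≫ (b'.β U).hom = (b.β U).hom ≫ U ◁ f) {c : C}
    (hc : corner s s c) :
    (e ◁ f) ▷ c ≫ (truncBraiding s b' hc).hom = (truncBraiding s b hc).hom ≫ c ◁ (e ◁ f) := by
  rw [← cancel_mono (c ◁ rowIncl s Z'), Category.assoc, truncBraiding_rowIncl, Category.assoc,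
    ← MonoidalCategory.whiskerLeft_comp, rowIncl_naturality, MonoidalCategory.whiskerLeft_comp,
    reassoc_of% (truncBraiding_rowIncl s b hc), ← comp_whiskerRight_assoc, rowIncl_naturality,
    comp_whiskerRight_assoc, hf]

/-- The functor `Z ↦ e ⊗ Z` from the center of `C` to the center of `e ⊗ C ⊗ e`. -/
def centerTruncation : Center C ⥤ Center (Corner s s) where
  obj Z := ⟨⟨e ⊗ Z.1, corner_tensor_center s Z⟩, truncHalfBraiding s Z.2 _⟩
  map {Z Z'} f :=
    { f := ObjectProperty.homMk (e ◁ f.f)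
      comm := fun c => by
        ext
        exact whiskerLeft_comm_truncBraiding s Z.2 Z'.2 f.f f.comm c.property }
  map_id Z := by
    ext
    exact MonoidalCategory.whiskerLeft_id _ _
  map_comp f g := by
    ext
    exact MonoidalCategory.whiskerLeft_comp _ _ _

/-- `b''` stands for the half braiding of a tensor product in the center; the identity makes
`rowMul` a morphism of central objects. -/
lemma rowMul_truncBraiding {Z Z' : C} (b : HalfBraiding Z) (b' : HalfBraiding Z')
    (b'' : HalfBraiding (Z ⊗ Z')) (h : ∀ U, (b''.β U).hom = (α_ _ _ _).hom ≫ Z ◁ (b'.β U).hom ≫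
      (α_ _ _ _).inv ≫ (b.β U).hom ▷ Z' ≫ (α_ _ _ _).hom) {c : C} (hc : corner s s c) :
    rowMul s Z Z' ▷ c ≫ (truncBraiding s b'' hc).hom =
      ((α_ _ _ _).hom ≫ (e ⊗ Z) ◁ (truncBraiding s b' hc).hom ≫ (α_ _ _ _).inv ≫
        (truncBraiding s b hc).hom ▷ (e ⊗ Z') ≫ (α_ _ _ _).hom) ≫ c ◁ rowMul s Z Z' := by
  rw [← cancel_mono (c ◁ rowIncl s (Z ⊗ Z')), Category.assoc, truncBraiding_rowIncl, h,
    ← comp_whiskerRight_assoc, rowMul_rowIncl]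
  simp only [Category.assoc]
  rw [← MonoidalCategory.whiskerLeft_comp, rowMul_rowIncl, MonoidalCategory.tensorHom_def,
    MonoidalCategory.whiskerLeft_comp, ← whisker_exchange (rowIncl s Z) (rowIncl s Z'),
    ← associator_naturality_middle_assoc, ← comp_whiskerRight_assoc, truncBraiding_rowIncl,
    ← associator_naturality_right, ← whisker_exchange_assoc,
    ← associator_inv_naturality_right_assoc, ← MonoidalCategory.whiskerLeft_comp_assoc,
    truncBraiding_rowIncl, MonoidalCategory.whiskerLeft_comp_assoc, comp_whiskerRight_assoc,
    comp_whiskerRight_assoc, ← associator_inv_naturality_left_assoc, whisker_exchange_assoc]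
  simp

lemma unit_truncBraiding (b : HalfBraiding (𝟙_ C)) (h : ∀ U, (b.β U).hom = (λ_ U).hom ≫ (ρ_ U).inv)
    {c : C} (hc : corner s s c) :
    (ρ_ e).inv ▷ c ≫ (truncBraiding s b hc).hom =
      ((s.i ▷ c ≫ (λ_ c).hom) ≫ (ρ_ c).inv ≫ c ◁ s.r) ≫ c ◁ (ρ_ e).inv := by
  rw [← cancel_mono (c ◁ rowIncl s (𝟙_ C)), Category.assoc, truncBraiding_rowIncl,
    ← comp_whiskerRight_assoc, inv_rightUnitor_rowIncl, h]
  simp only [Category.assoc]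
  rw [← MonoidalCategory.whiskerLeft_comp, inv_rightUnitor_rowIncl,
    ← MonoidalCategory.whiskerLeft_comp, whiskerLeft_idem (corner_le_column s s c hc)]
  simp

/-- The map `(e ⊗ Z) ⊗ (e ⊗ Z') ⟶ e ⊗ (Z ⊗ Z')` for central objects `Z`, `Z'`. -/
noncomputable def centerMu (Z Z' : Center C) :
    (centerTruncation s).obj Z ⊗ (centerTruncation s).obj Z' ⟶
      (centerTruncation s).obj (Z ⊗ Z') where
  f := ObjectProperty.homMk (rowMul s Z.1 Z'.1)
  comm := fun c => by
    ext
    exact rowMul_truncBraiding s Z.2 Z'.2 (Z ⊗ Z').2 (fun _ => rfl) c.property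

instance (Z Z' : Center C) : IsIso (centerMu s Z Z').f :=
  ⟨ObjectProperty.homMk (rowComul s Z.1 Z'.1), by
    ext
    exact rowMul_rowComul s _ _, by
    ext
    exact rowComul_rowMul s _ (lact_eq_ract_of_halfBraiding Z.2 _)⟩

/-- The map `e ⟶ e ⊗ 𝟙` of central objects. -/
noncomputable def centerEps : 𝟙_ (Center (Corner s s)) ⟶ (centerTruncation s).obj (𝟙_ (Center C)) where
  f := ObjectProperty.homMk (ρ_ e).inv
  comm := fun c => by
    ext
    exact unit_truncBraiding s (𝟙_ (Center C)).2 (fun _ => rfl) c.property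

instance : IsIso (centerEps s).f :=
  ⟨ObjectProperty.homMk (ρ_ e).hom, by
    ext
    exact (ρ_ e).inv_hom_id, by
    ext
    exact (ρ_ e).hom_inv_id⟩

/-- The functor `Z ↦ e ⊗ Z` between the centers is monoidal. -/
noncomputable def centerCoreMonoidal : (centerTruncation s).CoreMonoidal where
  εIso := Center.isoMk (centerEps s)
  μIso Z Z' := Center.isoMk (centerMu s Z Z')
  μIso_hom_natural_left f Z' := by ext; exact rowMul_natural_left s f.f Z'.1
  μIso_hom_natural_right Z' f := by ext; exact rowMul_natural_right s Z'.1 f.f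
  associativity X Y Z := by ext; exact rowMul_associativity s X.1 Y.1 Z.1
  left_unitality X := by ext; exact rowMul_left_unitality s X.1
  right_unitality X := by ext; exact rowMul_right_unitality s X.1

/-- Along `rowIncl`, both sides become the tensor product of the two inclusions followed by the half
braiding of `Z`. -/
lemma rowMul_whiskerLeft_braiding {Z Z' : C} (b : HalfBraiding Z) (h : corner s s (e ⊗ Z')) :
    rowMul s Z Z' ≫ e ◁ (b.β Z').hom = (truncBraiding s b h).hom ≫ rowMul s Z' Z := by
  rw [← cancel_mono (rowIncl s _), Category.assoc, rowIncl_naturality, Category.assoc,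
    rowMul_rowIncl, reassoc_of% (rowMul_rowIncl s Z Z'), MonoidalCategory.tensorHom_def,
    MonoidalCategory.tensorHom_def', reassoc_of% (truncBraiding_rowIncl s b h), Category.assoc, ← b.naturality]

/-- The functor `Z ↦ e ⊗ Z` between the centers is braided. -/
noncomputable abbrev centerBraided : (centerTruncation s).Braided where
  toMonoidal := (centerCoreMonoidal s).toMonoidal
  braided X Y := by
    ext
    exact rowMul_whiskerLeft_braiding s X.2 (corner_tensor_center s Y)

lemma rowBraiding_naturality {Z : C} (b : HalfBraiding Z) {x y : C} (hx : row s x) (hy : row s y)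
    (f : x ⟶ y) :
    (e ⊗ Z) ◁ f ≫ (rowBraiding s b hy).hom = (rowBraiding s b hx).hom ≫ f ▷ Z := by
  rw [rowBraiding_hom, rowBraiding_hom, whisker_exchange_assoc, Category.assoc, b.naturality]

lemma whiskerRight_rowBraiding {Z Z' : C} (b : HalfBraiding Z) (b' : HalfBraiding Z')
    (f : Z ⟶ Z') (hf : ∀ U, f ▷ U ≫ (b'.β U).hom = (b.β U).hom ≫ U ◁ f) {x : C} (hx : row s x) :
    (e ◁ f) ▷ x ≫ (rowBraiding s b' hx).hom = (rowBraiding s b hx).hom ≫ x ◁ f := by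
  rw [rowBraiding_hom, rowBraiding_hom, ← comp_whiskerRight_assoc, rowIncl_naturality,
    comp_whiskerRight_assoc, hf, Category.assoc]

/-- The monoidal axiom of `b` at `c ⊗ x`, restricted along `rowIncl`; the same axiom at `x ⊗ d`
gives `rowBraiding_right`. -/
lemma rowBraiding_left {Z : C} (b : HalfBraiding Z) {c x : C} (hc : corner s s c) (hx : row s x)  :
    (α_ (e ⊗ Z) c x).hom ≫ (rowBraiding s b (row_tensor (corner_le_row s s c hc) x)).hom ≫
      (α_ c x Z).hom = (truncBraiding s b hc).hom ▷ x ≫ (α_ c (e ⊗ Z) x).hom ≫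
        c ◁ (rowBraiding s b hx).hom := by
  rw [rowBraiding_hom, rowBraiding_hom, MonoidalCategory.whiskerLeft_comp,
    ← associator_naturality_middle_assoc, ← comp_whiskerRight_assoc, truncBraiding_rowIncl,
    b.monoidal]
  simp

lemma rowBraiding_right {Z : C} (b : HalfBraiding Z) {x : C} (hx : row s x) (d : C) :
    (α_ (e ⊗ Z) x d).hom ≫ (rowBraiding s b (row_tensor hx d)).hom ≫ (α_ x d Z).hom =
      (rowBraiding s b hx).hom ▷ d ≫ (α_ x Z d).hom ≫ x ◁ (b.β d).hom := by
  rw [rowBraiding_hom, rowBraiding_hom, b.monoidal]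
  simp

lemma rowBraiding_tensor {Z Z' : C} (b : HalfBraiding Z) (b' : HalfBraiding Z')
    (b'' : HalfBraiding (Z ⊗ Z')) (h : ∀ U, (b''.β U).hom = (α_ _ _ _).hom ≫ Z ◁ (b'.β U).hom ≫
      (α_ _ _ _).inv ≫ (b.β U).hom ▷ Z' ≫ (α_ _ _ _).hom) {x : C} (hx : row s x) :
    rowMul s Z Z' ▷ x ≫ (rowBraiding s b'' hx).hom ≫ (α_ x Z Z').inv =
      (α_ _ _ _).hom ≫ (e ⊗ Z) ◁ (rowBraiding s b' hx).hom ≫ (α_ _ _ _).inv ≫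
        (rowBraiding s b hx).hom ▷ Z' := by
  rw [rowBraiding_hom, rowBraiding_hom, rowBraiding_hom, h, Category.assoc,
    ← comp_whiskerRight_assoc, rowMul_rowIncl, MonoidalCategory.tensorHom_def']
  simp only [Category.assoc, Iso.hom_inv_id, Category.comp_id, comp_whiskerRight,
    MonoidalCategory.whiskerLeft_comp]
  rw [← associator_inv_naturality_left_assoc, whisker_exchange_assoc]
  simp

lemma rowBraiding_unit (b : HalfBraiding (𝟙_ C)) (h : ∀ U, (b.β U).hom = (λ_ U).hom ≫ (ρ_ U).inv)
    {x : C} (hx : row s x) :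
    (ρ_ e).inv ▷ x ≫ (rowBraiding s b hx).hom ≫ (ρ_ x).hom = s.i ▷ x ≫ (λ_ x).hom := by
  rw [rowBraiding_hom, Category.assoc, ← comp_whiskerRight_assoc, inv_rightUnitor_rowIncl, h]
  simp

/-- The intertwiner `(e ⊗ Z) ⊗ x ≅ x ⊗ Z`. -/
noncomputable def centerIntertwiner :
    letI := centerBraided s
    CenterIntertwiner (Row s) (centerTruncation s) :=
  letI := centerBraided s
  { iso := fun Z x => ObjectProperty.isoMk _ (rowBraiding s Z.2 x.property)
    naturality := fun Z x y f => by
      ext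
      exact rowBraiding_naturality s Z.2 x.property y.property f.hom
    naturality_center := fun {Z Z'} g x => by
      ext
      exact whiskerRight_rowBraiding s Z.2 Z'.2 g.f g.comm x.property
    left := fun Z c x => by
      ext
      exact rowBraiding_left s Z.2 c.property x.property
    right := fun Z x d => by
      ext
      exact rowBraiding_right s Z.2 x.property d
    tensor := fun Z Z' x => by
      ext
      exact rowBraiding_tensor s Z.2 Z'.2 (Z ⊗ Z').2 (fun _ => rfl) x.property
    unit := fun x => by
      ext
      exact rowBraiding_unit s (𝟙_ (Center C)).2 (fun _ => rfl) x.property }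

end CenterTruncation

end UnitSummand
/-! ### The center of `e ⊗ C ⊗ e` is equivalent to that of `C` -/

namespace UnitSummand

section RowTransformation

variable {C : Type u} [Category.{v} C] [MonoidalCategory C] {e : C} {s : Retract e (𝟙_ C)}

variable (s) in
/-- A transformation `x ⊗ A ⟶ x ⊗ B` of functors of `x` in `e ⊗ C`, compatible with the left action
of `e ⊗ C ⊗ e`. -/
structure RowTransformation (A B : C) where
  app (x : C) (hx : row s x) : x ⊗ A ⟶ x ⊗ B
  naturality {x y : C} (hx : row s x) (hy : row s y) (f : x ⟶ y) :
    f ▷ A ≫ app y hy = app x hx ≫ f ▷ B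
  tensor {c x : C} (hc : corner s s c) (hx : row s x) (h : row s (c ⊗ x)) :
    app (c ⊗ x) h = (α_ c x A).hom ≫ c ◁ app x hx ≫ (α_ c x B).inv

variable {y x₀ : C} [ExactPairing x₀ y] (hy : column s y) (hx₀ : row s x₀)

lemma corner_tensor_of_row_column {x : C} (hx : row s x) (hy : column s y) :
    corner s s (x ⊗ y) :=
  (corner_iff_row_column s s _).2 ⟨row_tensor hx y, column_tensor x hy⟩

/-- Contracting `y` with `x₀` is a morphism `(x ⊗ y) ⊗ x₀ ⟶ x` in the row, and `x ⊗ y` lies in `e ⊗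
C ⊗ e`. Naturality along it, with compatibility with the left action, expresses `τ` at `x` through
`τ` at `x₀`. -/
lemma RowTransformation.evaluationMap_app {A B : C} (τ : RowTransformation s A B)
    (hy : column s y) (hx₀ : row s x₀) {x : C} (hx : row s x) :
    x ◁ evaluationMap y x₀ A ≫ τ.app x hx =
      x ◁ y ◁ τ.app x₀ hx₀ ≫ x ◁ evaluationMap y x₀ B := by
  let n : (x ⊗ y) ⊗ x₀ ⟶ x := (α_ x y x₀).hom ≫ x ◁ ε_ x₀ y ≫ (ρ_ x).hom
  have hn (A : C) : n ▷ A =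
      (α_ (x ⊗ y) x₀ A).hom ≫ (α_ x y (x₀ ⊗ A)).hom ≫ x ◁ evaluationMap y x₀ A := by
    simp [n, evaluationMap]
  have hc := corner_tensor_of_row_column hx hy
  have h := τ.naturality (row_tensor (corner_le_row s s _ hc) x₀) hx n
  rw [τ.tensor hc hx₀, hn, hn] at h
  simpa using h

lemma eq_of_whiskerLeft_eq [∀ A, Epi (evaluationMap y x₀ A)] {A B : C} {f g : A ⟶ B}
    (h : x₀ ◁ f = x₀ ◁ g) : f = g := by
  rw [← cancel_epi (evaluationMap y x₀ A), ← evaluationMap_naturality, h,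
    evaluationMap_naturality]

/-- `x₀ ⊗ -` is faithful, and a faithful functor on an abelian category reflects isomorphisms. -/
lemma isIso_of_isIso_whiskerLeft [Abelian C] [∀ A, Epi (evaluationMap y x₀ A)] {A B : C}
    (f : A ⟶ B) (h : IsIso (x₀ ◁ f)) : IsIso f := by
  have : (tensorLeft x₀).Faithful := ⟨fun h => eq_of_whiskerLeft_eq (y := y) h⟩
  have : IsIso ((tensorLeft x₀).map f) := h
  exact isIso_of_reflects_iso f (tensorLeft x₀)

/-- The value of `τ` at `x₀`, tensored with `y`, descends along the presentation of `A` by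
evaluations; `evaluationMap_app` gives both the descent condition and the value at every `x`. -/
lemma RowTransformation.exists_eq_whiskerLeft {C : Type u} [Category.{v} C] [Abelian C]
    [MonoidalCategory C] [RigidCategory C] {e : C} {s : Retract e (𝟙_ C)} {y x₀ : C}
    [ExactPairing x₀ y] [∀ A, Epi (evaluationMap y x₀ A)] {A B : C} (τ : RowTransformation s A B)
    (hy : column s y) (hx₀ : row s x₀) :
    ∃ f : A ⟶ B, ∀ x hx, τ.app x hx = x ◁ f := by
  let ε : tensorLeft x₀ ⋙ tensorLeft y ⟶ 𝟭 C :=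
    { app := fun A => evaluationMap y x₀ A
      naturality := fun _ _ f => evaluationMap_naturality y x₀ f }
  have hε : ∀ A, Epi (ε.app A) := fun A => inferInstanceAs (Epi (evaluationMap y x₀ A))
  obtain ⟨hA⟩ := nonempty_isColimit_selfCofork ε hε A
  obtain ⟨f, hf⟩ : ∃ f : A ⟶ B,
      evaluationMap y x₀ A ≫ f = y ◁ τ.app x₀ hx₀ ≫ evaluationMap y x₀ B := by
    refine ⟨Cofork.IsColimit.desc hA (y ◁ τ.app x₀ hx₀ ≫ evaluationMap y x₀ B) ?_,
      Cofork.IsColimit.π_desc' hA _ _⟩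
    change y ◁ x₀ ◁ evaluationMap y x₀ A ≫ _ = evaluationMap y x₀ (y ⊗ (x₀ ⊗ A)) ≫ _
    rw [← evaluationMap_naturality, ← MonoidalCategory.whiskerLeft_comp_assoc,
      τ.evaluationMap_app hy hx₀]
    simp
  refine ⟨f, fun x hx => ?_⟩
  rw [← cancel_epi (x ◁ evaluationMap y x₀ A), τ.evaluationMap_app hy hx₀,
    ← MonoidalCategory.whiskerLeft_comp, ← hf, MonoidalCategory.whiskerLeft_comp]

end RowTransformation

section CenterRowIso

variable {C : Type u} [Category.{v} C] [MonoidalCategory C] {e : C} {s : Retract e (𝟙_ C)}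

/-- The half braiding of a central object of `e ⊗ C ⊗ e`, as an isomorphism of `C`. -/
def cornerBraiding {V : Corner s s} (b : HalfBraiding V) {c : C} (hc : corner s s c) :
    V.obj ⊗ c ≅ c ⊗ V.obj := (corner s s).ι.mapIso (b.β ⟨c, hc⟩)

lemma cornerBraiding_naturality {V : Corner s s} (b : HalfBraiding V) {c c' : C}
    (hc : corner s s c) (hc' : corner s s c') (f : c ⟶ c') :
    V.obj ◁ f ≫ (cornerBraiding b hc').hom = (cornerBraiding b hc).hom ≫ f ▷ V.obj :=
  congrArg (fun g => g.hom)
    (b.naturality (U := ⟨c, hc⟩) (U' := ⟨c', hc'⟩) (ObjectProperty.homMk f))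

lemma cornerBraiding_tensor {V : Corner s s} (b : HalfBraiding V) {c c' : C}
    (hc : corner s s c) (hc' : corner s s c') (h : corner s s (c ⊗ c')) :
    (cornerBraiding b h).hom = (α_ _ _ _).inv ≫ (cornerBraiding b hc).hom ▷ c' ≫
      (α_ _ _ _).hom ≫ c ◁ (cornerBraiding b hc').hom ≫ (α_ _ _ _).inv :=
  congrArg (fun g => g.hom) (b.monoidal ⟨c, hc⟩ ⟨c', hc'⟩)

/-- An isomorphism between the actions on `e ⊗ C` of a central object `V` of `e ⊗ C ⊗ e` and of
an object `Z` of `C`. -/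
structure CenterRowIso {V : Corner s s} (b : HalfBraiding V) (Z : C) where
  iso (x : C) (hx : row s x) : V.obj ⊗ x ≅ x ⊗ Z
  naturality {x y : C} (hx : row s x) (hy : row s y) (f : x ⟶ y) :
    V.obj ◁ f ≫ (iso y hy).hom = (iso x hx).hom ≫ f ▷ Z
  left {c x : C} (hc : corner s s c) (hx : row s x) (h : row s (c ⊗ x)) :
    (α_ V.obj c x).hom ≫ (iso (c ⊗ x) h).hom ≫ (α_ c x Z).hom =
      (cornerBraiding b hc).hom ▷ x ≫ (α_ c V.obj x).hom ≫ c ◁ (iso x hx).hom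

/-- The isomorphism between the actions of a central object `Z` of `C` and of `e ⊗ Z`. -/
def centerRowIso {Z : C} (b : HalfBraiding Z) (h : corner s s (e ⊗ Z)) :
    CenterRowIso (truncHalfBraiding s b h) Z where
  iso _ hx := rowBraiding s b hx
  naturality hx hy f := rowBraiding_naturality s b hx hy f
  left hc hx _ := rowBraiding_left s b hc hx

namespace CenterRowIso

variable {V V' : Corner s s} {b : HalfBraiding V} {b' : HalfBraiding V'} {Z Z' : C}
  (φ : CenterRowIso b Z) (φ' : CenterRowIso b' Z')

/-- The transformation induced by a morphism of central objects. -/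
def transformation (g : V ⟶ V')
    (hg : ∀ U, g ▷ U ≫ (b'.β U).hom = (b.β U).hom ≫ U ◁ g) : RowTransformation s Z Z' where
  app x hx := (φ.iso x hx).inv ≫ g.hom ▷ x ≫ (φ'.iso x hx).hom
  naturality {x y} hx hy f := by
    have h : f ▷ Z ≫ (φ.iso y hy).inv = (φ.iso x hx).inv ≫ V.obj ◁ f := by
      rw [Iso.comp_inv_eq, Category.assoc, φ.naturality hx hy, Iso.inv_hom_id_assoc]
    rw [reassoc_of% h, whisker_exchange_assoc, φ'.naturality hx hy]
    simp only [Category.assoc]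
  tensor {c x} hc hx h := by
    have hg' : g.hom ▷ c ≫ (cornerBraiding b' hc).hom = (cornerBraiding b hc).hom ≫ c ◁ g.hom :=
      congrArg (fun g => g.hom) (hg ⟨c, hc⟩)
    have h1 := φ.left hc hx h
    have h2 := φ'.left hc hx h
    rw [← cancel_epi (φ.iso (c ⊗ x) h).hom, Iso.hom_inv_id_assoc,
      ← cancel_epi (α_ V.obj c x).hom, ← cancel_mono (α_ c x Z').hom, Category.assoc,
      Category.assoc, ← associator_naturality_left_assoc, h2, ← comp_whiskerRight_assoc, hg',
      Category.assoc, Category.assoc, Category.assoc, Category.assoc, Iso.inv_hom_id, Category.comp_id,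
      reassoc_of% h1]
    simp

lemma exists_hom {C : Type u} [Category.{v} C] [Abelian C]
    [MonoidalCategory C] [RigidCategory C] {e : C} {s : Retract e (𝟙_ C)} {y x₀ : C}
    [ExactPairing x₀ y] [∀ A, Epi (evaluationMap y x₀ A)] (hy : column s y) (hx₀ : row s x₀)
    {V V' : Corner s s} {b : HalfBraiding V} {b' : HalfBraiding V'} {Z Z' : C}
    (φ : CenterRowIso b Z) (φ' : CenterRowIso b' Z') (g : V ⟶ V')
    (hg : ∀ U, g ▷ U ≫ (b'.β U).hom = (b.β U).hom ≫ U ◁ g) :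
    ∃ f : Z ⟶ Z', ∀ x hx, (φ.iso x hx).hom ≫ x ◁ f = g.hom ▷ x ≫ (φ'.iso x hx).hom := by
  obtain ⟨f, hf⟩ := (φ.transformation φ' g hg).exists_eq_whiskerLeft hy hx₀
  refine ⟨f, fun x hx => ?_⟩
  rw [← hf x hx]
  exact Iso.hom_inv_id_assoc _ _

/-- The transformation which induces the half braiding of `Z` with `U`. -/
def halfBraidingTransformation (U : C) : RowTransformation s (Z ⊗ U) (U ⊗ Z) where
  app x hx := (α_ x Z U).inv ≫ (φ.iso x hx).inv ▷ U ≫ (α_ V.obj x U).hom ≫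
    (φ.iso (x ⊗ U) (row_tensor hx U)).hom ≫ (α_ x U Z).hom
  naturality {x y} hx hy f := by
    have h : f ▷ Z ≫ (φ.iso y hy).inv = (φ.iso x hx).inv ≫ V.obj ◁ f := by
      rw [Iso.comp_inv_eq, Category.assoc, φ.naturality hx hy, Iso.inv_hom_id_assoc]
    have h' := φ.naturality (row_tensor hx U) (row_tensor hy U) (f ▷ U)
    rw [associator_inv_naturality_left_assoc, ← comp_whiskerRight_assoc, h,
      comp_whiskerRight_assoc, associator_naturality_middle_assoc, reassoc_of% h',
      associator_naturality_left]
    simp only [Category.assoc]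
  tensor {c x} hc hx h := by
    have h1 : (φ.iso (c ⊗ x) h).inv = (α_ c x Z).hom ≫ c ◁ (φ.iso x hx).inv ≫
        (α_ c V.obj x).inv ≫ (cornerBraiding b hc).inv ▷ x ≫ (α_ V.obj c x).hom := by
      rw [← cancel_mono (φ.iso (c ⊗ x) h).hom, Iso.inv_hom_id, ← cancel_mono (α_ c x Z).hom]
      simp only [Category.assoc]
      rw [φ.left hc hx h]
      simp
    have h2 := φ.left hc (row_tensor hx U) (row_tensor (corner_le_row s s c hc) (x ⊗ U))
    have h3 := φ.naturality (row_tensor h U) (row_tensor (corner_le_row s s c hc) (x ⊗ U))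
      (α_ c x U).hom
    have h4 : (φ.iso ((c ⊗ x) ⊗ U) (row_tensor h U)).hom = V.obj ◁ (α_ c x U).hom ≫
        (φ.iso (c ⊗ (x ⊗ U)) (row_tensor (corner_le_row s s c hc) (x ⊗ U))).hom ≫
          (α_ c x U).inv ▷ Z := by
      rw [reassoc_of% h3, ← comp_whiskerRight, Iso.hom_inv_id, id_whiskerRight, Category.comp_id]
    have h5 : (φ.iso (c ⊗ (x ⊗ U)) (row_tensor (corner_le_row s s c hc) (x ⊗ U))).hom =
        (α_ V.obj c (x ⊗ U)).inv ≫ (cornerBraiding b hc).hom ▷ (x ⊗ U) ≫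
          (α_ c V.obj (x ⊗ U)).hom ≫ c ◁ (φ.iso (x ⊗ U) (row_tensor hx U)).hom ≫
            (α_ c (x ⊗ U) Z).inv := by
      rw [Iso.eq_inv_comp, ← cancel_mono (α_ c (x ⊗ U) Z).hom, Category.assoc, h2]
      simp
    rw [h4, h5, h1]
    simp only [Category.assoc, comp_whiskerRight, MonoidalCategory.whiskerLeft_comp]
    simp

/-- Moving `V` across `x` and across `x ⊗ U` gives a transformation `x ⊗ (Z ⊗ U) ⟶ x ⊗ (U ⊗ Z)`,
which comes from a morphism of `C`. Its invertibility and the axioms are checked after applying `x₀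
⊗ -`. -/
lemma exists_halfBraiding {C : Type u} [Category.{v} C] [Abelian C]
    [MonoidalCategory C] [RigidCategory C] {e : C} {s : Retract e (𝟙_ C)} {y x₀ : C}
    [ExactPairing x₀ y] [∀ A, Epi (evaluationMap y x₀ A)] (hy : column s y) (hx₀ : row s x₀)
    {V : Corner s s} {b : HalfBraiding V} {Z : C} (φ : CenterRowIso b Z) :
    ∃ b' : HalfBraiding Z, ∀ (x : C) (hx : row s x) (U : C),
      (φ.iso x hx).hom ▷ U ≫ (α_ x Z U).hom ≫ x ◁ (b'.β U).hom =
        (α_ V.obj x U).hom ≫ (φ.iso (x ⊗ U) (row_tensor hx U)).hom ≫ (α_ x U Z).hom := by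
  choose f hf using fun U => (φ.halfBraidingTransformation U).exists_eq_whiskerLeft hy hx₀
  have right (x : C) (hx : row s x) (U : C) :
      (φ.iso x hx).hom ▷ U ≫ (α_ x Z U).hom ≫ x ◁ f U =
        (α_ V.obj x U).hom ≫ (φ.iso (x ⊗ U) (row_tensor hx U)).hom ≫ (α_ x U Z).hom := by
    rw [← hf U x hx]
    simp [halfBraidingTransformation]
  have hiso (U : C) : IsIso (f U) := by
    refine isIso_of_isIso_whiskerLeft (y := y) (x₀ := x₀) _ ?_
    rw [← hf U x₀ hx₀]
    dsimp only [halfBraidingTransformation]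
    infer_instance
  refine ⟨{ β := fun U => asIso (f U), monoidal := fun U U' => ?_, naturality := fun {U U'} g => ?_ },
    right⟩
  · refine eq_of_whiskerLeft_eq (y := y) (x₀ := x₀) ?_
    rw [← cancel_epi (α_ x₀ Z (U ⊗ U')).hom, ← cancel_epi ((φ.iso x₀ hx₀).hom ▷ (U ⊗ U'))]
    have h := φ.naturality (row_tensor (row_tensor hx₀ U) U') (row_tensor hx₀ (U ⊗ U'))
      (α_ x₀ U U').hom
    have h1 := right x₀ hx₀ U
    have h2 := right (x₀ ⊗ U) (row_tensor hx₀ U) U'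
    dsimp only [asIso_hom]
    have h3 : (φ.iso (x₀ ⊗ (U ⊗ U')) (row_tensor hx₀ (U ⊗ U'))).hom =
        V.obj ◁ (α_ x₀ U U').inv ≫ (φ.iso ((x₀ ⊗ U) ⊗ U')
          (row_tensor (row_tensor hx₀ U) U')).hom ≫ (α_ x₀ U U').hom ▷ Z := by
      rw [← h, ← MonoidalCategory.whiskerLeft_comp_assoc, Iso.inv_hom_id]
      simp
    have h4 : (φ.iso ((x₀ ⊗ U) ⊗ U') (row_tensor (row_tensor hx₀ U) U')).hom =
        (α_ _ _ _).inv ≫ (φ.iso (x₀ ⊗ U) (row_tensor hx₀ U)).hom ▷ U' ≫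
          (α_ (x₀ ⊗ U) Z U').hom ≫ (x₀ ⊗ U) ◁ f U' ≫ (α_ (x₀ ⊗ U) U' Z).inv := by
      rw [Iso.eq_inv_comp, reassoc_of% h2, Iso.hom_inv_id, Category.comp_id]
    have h5 : (φ.iso (x₀ ⊗ U) (row_tensor hx₀ U)).hom =
        (α_ _ _ _).inv ≫ (φ.iso x₀ hx₀).hom ▷ U ≫ (α_ x₀ Z U).hom ≫ x₀ ◁ f U ≫
          (α_ x₀ U Z).inv := by
      rw [Iso.eq_inv_comp, reassoc_of% h1, Iso.hom_inv_id, Category.comp_id]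
    rw [right x₀ hx₀ (U ⊗ U'), h3, h4, h5]
    simp
  · refine eq_of_whiskerLeft_eq (y := y) (x₀ := x₀) ?_
    rw [← cancel_epi (α_ x₀ Z U).hom, ← cancel_epi ((φ.iso x₀ hx₀).hom ▷ U)]
    have h := φ.naturality (row_tensor hx₀ U) (row_tensor hx₀ U') (x₀ ◁ g)
    dsimp only [asIso_hom]
    rw [MonoidalCategory.whiskerLeft_comp, MonoidalCategory.whiskerLeft_comp,
      ← associator_naturality_right_assoc, ← whisker_exchange_assoc, right x₀ hx₀ U',
      reassoc_of% (right x₀ hx₀ U), associator_naturality_right_assoc, reassoc_of% h]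
    simp

end CenterRowIso

/-- A morphism between objects of `C ⊗ e` is determined by its tensor product with `e`. -/
lemma eq_of_whiskerRight_self {A B : C} (hA : column s A) (hB : column s B) {f g : A ⟶ B}
    (h : f ▷ e = g ▷ e) : f = g := by
  have key (f : A ⟶ B) : f = (rightIso s hA).inv ≫ f ▷ e ≫ (rightIso s hB).hom := by
    rw [Iso.eq_inv_comp, rightIso_hom, rightIso_hom, ← whisker_exchange_assoc,
      rightUnitor_naturality, Category.assoc]
  rw [key f, key g, h]

lemma rightIso_inv_whiskerRight (s : Retract e (𝟙_ C)) {A : C} (hA : column s A) (B : C) :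
    (rightIso s hA).inv ▷ B ≫ (α_ A e B).hom ≫ A ◁ rowIncl s B = 𝟙 _ := by
  have h := congrArg (fun f => f ▷ B) (whiskerLeft_idem hA)
  simp only [MonoidalCategory.whiskerLeft_comp, comp_whiskerRight, id_whiskerRight] at h
  simp only [rightIso_inv, rowIncl, comp_whiskerRight, MonoidalCategory.whiskerLeft_comp,
    Category.assoc, ← associator_naturality_middle_assoc]
  rw [reassoc_of% h]
  simp

section Equivalence

variable {C : Type u} [Category.{v} C] [Abelian C] [MonoidalCategory C] [RigidCategory C]
  {e : C} {s : Retract e (𝟙_ C)} {y x₀ : C} [ExactPairing x₀ y]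
  [∀ A, Epi (evaluationMap y x₀ A)]

-- `rowBraiding` conjugates `(e ⊗ f) ⊗ x₀` into `x₀ ⊗ f`, and `x₀ ⊗ -` is faithful.
include y in
lemma faithful_centerTruncation (hx₀ : row s x₀) : (centerTruncation s).Faithful := by
  refine ⟨fun {Z Z'} f g h => ?_⟩
  have h1 : e ◁ f.f = e ◁ g.f := congrArg (fun k => k.f.hom) h
  ext
  refine eq_of_whiskerLeft_eq (y := y) (x₀ := x₀) ?_
  rw [← cancel_epi (rowBraiding s Z.2 hx₀).hom,
    ← whiskerRight_rowBraiding s Z.2 Z'.2 f.f f.comm hx₀,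
    ← whiskerRight_rowBraiding s Z.2 Z'.2 g.f g.comm hx₀, h1]

/-- The morphism comes from `exists_hom`. It respects half braidings because `rowBraiding_right`
expresses these through the actions on `x₀` and on `x₀ ⊗ U`, where `f` corresponds to `g`. -/
lemma full_centerTruncation (hy : column s y) (hx₀ : row s x₀) : (centerTruncation s).Full := by
  refine ⟨fun {Z Z'} g => ?_⟩
  obtain ⟨f, hf⟩ := (centerRowIso Z.2 (corner_tensor_center s Z)).exists_hom hy hx₀
    (centerRowIso Z'.2 (corner_tensor_center s Z')) g.f g.comm
  let g' : e ⊗ Z.1 ⟶ e ⊗ Z'.1 := g.f.hom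
  have hf' (x : C) (hx : row s x) :
      (rowBraiding s Z.2 hx).hom ≫ x ◁ f = g' ▷ x ≫ (rowBraiding s Z'.2 hx).hom := hf x hx
  have comm (U : C) : f ▷ U ≫ (Z'.2.β U).hom = (Z.2.β U).hom ≫ U ◁ f := by
    refine eq_of_whiskerLeft_eq (y := y) (x₀ := x₀) ?_
    have h1 := rowBraiding_right s Z.2 hx₀ U
    have h2 := rowBraiding_right s Z'.2 hx₀ U
    have h3 := hf' (x₀ ⊗ U) (row_tensor hx₀ U)
    have h4 := hf' x₀ hx₀
    rw [← cancel_epi (α_ x₀ Z.1 U).hom, ← cancel_epi ((rowBraiding s Z.2 hx₀).hom ▷ U),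
      MonoidalCategory.whiskerLeft_comp, MonoidalCategory.whiskerLeft_comp,
      ← associator_naturality_middle_assoc, ← comp_whiskerRight_assoc, h4,
      comp_whiskerRight_assoc, ← h2, ← reassoc_of% h1, associator_naturality_left_assoc,
      ← reassoc_of% h3, tensor_whiskerLeft]
    simp
  refine ⟨⟨f, comm⟩, ?_⟩
  ext
  refine eq_of_whiskerRight_self (s := s) (corner_le_column s s _ (corner_tensor_center s Z))
    (corner_le_column s s _ (corner_tensor_center s Z')) ?_
  rw [← cancel_mono (rowBraiding s Z'.2 (row_self s)).hom]
  exact (whiskerRight_rowBraiding s Z.2 Z'.2 f comm (row_self s)).trans (hf' e (row_self s))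

lemma essSurj_centerTruncation (hy : column s y) (hx₀ : row s x₀)
    (h : ∀ V : Center (Corner s s), ∃ Z, Nonempty (CenterRowIso V.2 Z)) :
    (centerTruncation s).EssSurj := by
  refine ⟨fun V => ?_⟩
  obtain ⟨Z, ⟨φ⟩⟩ := h V
  obtain ⟨b', right⟩ := φ.exists_halfBraiding hy hx₀
  have hV := corner_le_column s s _ V.1.property
  let W : C := V.1.obj
  let t : W ≅ e ⊗ Z := (rightIso s hV).symm ≪≫ φ.iso e (row_self s)
  -- Compatibility with right tensoring writes the action on `c` through `t` and the half braiding
  -- of `Z`; `h2` writes it, by compatibility with the left action, through the half braiding of `V`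
  -- and `t`. Comparing the two shows that `t` is a morphism of central objects.
  have h1 {c : C} (hc : corner s s c) (hcr : row s c) :
      t.hom ▷ c ≫ rowIncl s Z ▷ c ≫ (b'.β c).hom = (φ.iso c hcr).hom := by
    have h3 : rowIncl s Z ▷ c = (α_ e Z c).hom ≫ rowIncl s (Z ⊗ c) := by
      rw [rowIncl_tensor, Iso.hom_inv_id_assoc]
    have h4 := φ.naturality (row_tensor (row_self s) c) hcr (rowIncl s c)
    have h5 := right e (row_self s) c
    have h6 : t.hom = (rightIso s hV).inv ≫ (φ.iso e (row_self s)).hom := rfl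
    rw [h3, Category.assoc, ← rowIncl_naturality, rowIncl_tensor, h6, comp_whiskerRight_assoc,
      reassoc_of% h5, Iso.hom_inv_id_assoc, ← h4,
      reassoc_of% (rightIso_inv_whiskerRight s hV c)]
  have h2 {c : C} (hc : corner s s c) (hcr : row s c) :
      (φ.iso c hcr).hom = (cornerBraiding V.2 hc).hom ≫ c ◁ t.hom ≫ c ◁ rowIncl s Z := by
    have hcc := corner_le_column s s c hc
    have h3 := φ.left hc (row_self s) (row_tensor hcr e)
    have h4 := φ.naturality hcr (row_tensor hcr e) (rightIso s hcc).inv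
    have h5 : (cornerBraiding V.2 hc).hom ≫ c ◁ (rightIso s hV).inv =
        V.1.obj ◁ (rightIso s hcc).inv ≫ (α_ _ _ _).inv ≫ (cornerBraiding V.2 hc).hom ▷ e ≫
          (α_ _ _ _).hom := by
      simp only [rightIso_inv, MonoidalCategory.whiskerLeft_comp, Category.assoc]
      rw [associator_inv_naturality_right_assoc, whisker_exchange_assoc]
      simp
    have h6 : t.hom = (rightIso s hV).inv ≫ (φ.iso e (row_self s)).hom := rfl
    rw [h6, MonoidalCategory.whiskerLeft_comp_assoc, reassoc_of% h5, ← reassoc_of% h3,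
      Iso.inv_hom_id_assoc, reassoc_of% h4, rightIso_inv_whiskerRight, Category.comp_id]
  have comm {c : C} (hc : corner s s c) :
      t.hom ▷ c ≫ (truncBraiding s b' hc).hom = (cornerBraiding V.2 hc).hom ≫ c ◁ t.hom := by
    rw [← cancel_mono (c ◁ rowIncl s Z), Category.assoc, Category.assoc, truncBraiding_rowIncl,
      h1 hc (corner_le_row s s c hc), h2 hc]
  let t' : V ⟶ (centerTruncation s).obj ⟨Z, b'⟩ :=
    { f := ObjectProperty.homMk t.hom
      comm := fun c => by
        ext
        exact comm c.property }
  have : IsIso t'.f := ⟨ObjectProperty.homMk t.inv, by ext; exact t.hom_inv_id,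
    by ext; exact t.inv_hom_id⟩
  exact ⟨⟨Z, b'⟩, ⟨(Center.isoMk t').symm⟩⟩

end Equivalence

/-! ### Objects of `C` induced from central objects of `e ⊗ C ⊗ e`. -/

section Induction

variable {C : Type u} [Category.{v} C] [MonoidalCategory C] {e : C} {s : Retract e (𝟙_ C)}
  {V : Corner s s} (b : HalfBraiding V)

/-- The isomorphism `c ⊗ (V ⊗ w) ≅ V ⊗ (c ⊗ w)` given by a half braiding of `V`. -/
def exchange {c : C} (hc : corner s s c) (w : C) : c ⊗ (V.obj ⊗ w) ≅ V.obj ⊗ (c ⊗ w) :=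
  (α_ _ _ _).symm ≪≫ whiskerRightIso (cornerBraiding b hc).symm w ≪≫ α_ _ _ _

lemma exchange_hom {c : C} (hc : corner s s c) (w : C) : (exchange b hc w).hom =
    (α_ _ _ _).inv ≫ (cornerBraiding b hc).inv ▷ w ≫ (α_ _ _ _).hom := rfl

lemma exchange_naturality_right {c : C} (hc : corner s s c) {w w' : C} (f : w ⟶ w') :
    c ◁ V.obj ◁ f ≫ (exchange b hc w').hom = (exchange b hc w).hom ≫ V.obj ◁ c ◁ f := by
  rw [exchange_hom, exchange_hom, associator_inv_naturality_right_assoc, whisker_exchange_assoc,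
    associator_naturality_right]
  simp only [Category.assoc]

lemma exchange_naturality_left {c c' : C} (hc : corner s s c) (hc' : corner s s c') (f : c ⟶ c')
    (w : C) :
    f ▷ (V.obj ⊗ w) ≫ (exchange b hc' w).hom = (exchange b hc w).hom ≫ V.obj ◁ f ▷ w := by
  have h : f ▷ V.obj ≫ (cornerBraiding b hc').inv = (cornerBraiding b hc).inv ≫ V.obj ◁ f := by
    rw [Iso.comp_inv_eq, Category.assoc, cornerBraiding_naturality b hc hc', Iso.inv_hom_id_assoc]
  rw [exchange_hom, exchange_hom, associator_inv_naturality_left_assoc, ← comp_whiskerRight_assoc,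
    h, comp_whiskerRight_assoc, associator_naturality_middle]
  simp only [Category.assoc]

lemma exchange_tensor {c c' : C} (hc : corner s s c) (hc' : corner s s c')
    (h : corner s s (c ⊗ c')) (w : C) :
    (exchange b h w).hom = (α_ c c' _).hom ≫ c ◁ (exchange b hc' w).hom ≫
      (exchange b hc (c' ⊗ w)).hom ≫ V.obj ◁ (α_ c c' w).inv := by
  have h1 : (cornerBraiding b h).inv = (α_ _ _ _).hom ≫ c ◁ (cornerBraiding b hc').inv ≫
      (α_ _ _ _).inv ≫ (cornerBraiding b hc).inv ▷ c' ≫ (α_ _ _ _).hom := by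
    rw [← cancel_mono (cornerBraiding b h).hom, Iso.inv_hom_id, cornerBraiding_tensor b hc hc' h]
    simp
  rw [exchange_hom, exchange_hom, exchange_hom, h1]
  simp

variable {y x₀ : C} [ExactPairing x₀ y] (hy : column s y) (hx₀ : row s x₀)

/-- The isomorphism `x ⊗ (y ⊗ (V ⊗ w)) ≅ V ⊗ (x ⊗ (y ⊗ w))` given by a half braiding of `V`, for
`x` in `e ⊗ C` and `y` in `C ⊗ e`. -/
def exchange₂ {x : C} (hx : row s x) (w : C) :
    x ⊗ (y ⊗ (V.obj ⊗ w)) ≅ V.obj ⊗ (x ⊗ (y ⊗ w)) :=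
  (α_ _ _ _).symm ≪≫ exchange b (corner_tensor_of_row_column hx hy) w ≪≫
    whiskerLeftIso _ (α_ _ _ _)

lemma exchange₂_hom {x : C} (hx : row s x) (w : C) : (exchange₂ b hy hx w).hom =
    (α_ _ _ _).inv ≫ (exchange b (corner_tensor_of_row_column hx hy) w).hom ≫
      V.obj ◁ (α_ _ _ _).hom := rfl

lemma exchange₂_naturality_right {x : C} (hx : row s x) {w w' : C} (f : w ⟶ w') :
    x ◁ y ◁ V.obj ◁ f ≫ (exchange₂ b hy hx w').hom =
      (exchange₂ b hy hx w).hom ≫ V.obj ◁ x ◁ y ◁ f := by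
  rw [exchange₂_hom, exchange₂_hom, associator_inv_naturality_right_assoc,
    reassoc_of% (exchange_naturality_right b (corner_tensor_of_row_column hx hy) f)]
  simp

lemma exchange₂_naturality_left {x x' : C} (hx : row s x) (hx' : row s x') (f : x ⟶ x') (w : C) :
    f ▷ _ ≫ (exchange₂ b hy hx' w).hom = (exchange₂ b hy hx w).hom ≫ V.obj ◁ f ▷ _ := by
  rw [exchange₂_hom, exchange₂_hom, associator_inv_naturality_left_assoc,
    reassoc_of% (exchange_naturality_left b (corner_tensor_of_row_column hx hy)
      (corner_tensor_of_row_column hx' hy) (f ▷ y) w)]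
  simp

lemma exchange₂_tensor {c x : C} (hc : corner s s c) (hx : row s x) (h : row s (c ⊗ x)) (w : C) :
    (exchange₂ b hy h w).hom = (α_ _ _ _).hom ≫ c ◁ (exchange₂ b hy hx w).hom ≫
      (exchange b hc (x ⊗ (y ⊗ w))).hom ≫ V.obj ◁ (α_ _ _ _).inv := by
  have hxy := corner_tensor_of_row_column hx hy
  have h1 := exchange_naturality_left b (corner_tensor_of_row_column h hy)
    (corner_tensor hc hxy) (α_ c x y).hom w
  rw [exchange_tensor b hc hxy (corner_tensor hc hxy)] at h1
  have h2 : (exchange b (corner_tensor_of_row_column h hy) w).hom =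
      (α_ c x y).hom ▷ (V.obj ⊗ w) ≫ ((α_ c (x ⊗ y) _).hom ≫ c ◁ (exchange b hxy w).hom ≫
      (exchange b hc ((x ⊗ y) ⊗ w)).hom ≫ V.obj ◁ (α_ c (x ⊗ y) w).inv) ≫
        V.obj ◁ (α_ c x y).inv ▷ w := by
    simp only [Category.assoc] at h1 ⊢
    rw [reassoc_of% h1, ← MonoidalCategory.whiskerLeft_comp, ← comp_whiskerRight, Iso.hom_inv_id]
    simp
  have h3 := exchange_naturality_right b hc (α_ x y w).hom
  rw [exchange₂_hom, exchange₂_hom, h2]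
  simp only [MonoidalCategory.whiskerLeft_comp, Category.assoc]
  rw [reassoc_of% h3]
  monoidal

/-- Contracting the inner `y ⊗ x₀` is a morphism `k` of `e ⊗ C ⊗ e`, so the half braiding of `V` is
natural at `k`; the hexagon splits its value at the source of `k` into two exchanges. -/
lemma exchange₂_evaluationMap {x : C} (hx : row s x) (w : C) :
    x ◁ y ◁ (exchange₂ b hy hx₀ w).hom ≫ (exchange₂ b hy hx (x₀ ⊗ (y ⊗ w))).hom ≫
      V.obj ◁ x ◁ evaluationMap y x₀ (y ⊗ w) =
    x ◁ evaluationMap y x₀ (y ⊗ (V.obj ⊗ w)) ≫ (exchange₂ b hy hx w).hom := by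
  have hxy := corner_tensor_of_row_column hx hy
  have hxy₀ := corner_tensor_of_row_column hx₀ hy
  let k : (x ⊗ y) ⊗ (x₀ ⊗ y) ⟶ x ⊗ y := (α_ _ _ _).hom ≫ x ◁ evaluationMap y x₀ y
  have h1 := exchange_naturality_left b (corner_tensor hxy hxy₀) hxy k w
  rw [exchange_tensor b hxy hxy₀ (corner_tensor hxy hxy₀)] at h1
  have h2 (W : C) : x ◁ evaluationMap y x₀ (y ⊗ W) = x ◁ y ◁ (α_ _ _ _).inv ≫
      (α_ _ _ _).inv ≫ (α_ _ _ _).inv ≫ k ▷ W ≫ (α_ _ _ _).hom := by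
    simp only [k, evaluationMap]
    monoidal
  rw [h2, h2, exchange₂_hom]
  simp only [Category.assoc, Iso.hom_inv_id_assoc, exchange₂_hom]
  simp only [Category.assoc] at h1
  have h3 := exchange_naturality_right b hxy (α_ x₀ y w).inv
  have h4 : (exchange b hxy (x₀ ⊗ (y ⊗ w))).hom = (x ⊗ y) ◁ V.obj ◁ (α_ x₀ y w).inv ≫
      (exchange b hxy ((x₀ ⊗ y) ⊗ w)).hom ≫ V.obj ◁ (x ⊗ y) ◁ (α_ x₀ y w).hom := by
    rw [reassoc_of% h3]
    simp
  rw [reassoc_of% h1, h4]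
  -- Only coherence remains, so `k` may be treated as an arbitrary morphism.
  clear_value k
  monoidal

end Induction

section Descent

variable {C : Type u} [Category.{v} C] [Abelian C] [MonoidalCategory C] [RigidCategory C]
  {e : C} {s : Retract e (𝟙_ C)} {y x₀ : C} [ExactPairing x₀ y]
  {V : Corner s s} (b : HalfBraiding V) (hy : column s y) (hx₀ : row s x₀) (u : C)

/-- The source of the parallel pair which presents `u` twisted by `V`. -/
abbrev descentSource (V : Corner s s) (y x₀ u : C) : C := y ⊗ (V.obj ⊗ (x₀ ⊗ (y ⊗ (x₀ ⊗ u))))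

/-- The target of the parallel pair which presents `u` twisted by `V`. -/
abbrev descentTarget (V : Corner s s) (y x₀ u : C) : C := y ⊗ (V.obj ⊗ (x₀ ⊗ u))

/-- The map given by the evaluation on the right of `V`. -/
def descentRight (V : Corner s s) (y x₀ : C) [ExactPairing x₀ y] (u : C) :
    descentSource V y x₀ u ⟶ descentTarget V y x₀ u :=
  y ◁ V.obj ◁ x₀ ◁ evaluationMap y x₀ u

/-- The map given by the evaluation on the left of `V`. -/
def descentLeft : descentSource V y x₀ u ⟶ descentTarget V y x₀ u :=
  y ◁ (exchange₂ b hy hx₀ (x₀ ⊗ u)).inv ≫ evaluationMap y x₀ _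

/-- The evaluation on the right of `V`, after moving `V` to the left. -/
def descentMap {x : C} (hx : row s x) : x ⊗ descentTarget V y x₀ u ⟶ V.obj ⊗ (x ⊗ u) :=
  (exchange₂ b hy hx (x₀ ⊗ u)).hom ≫ V.obj ◁ x ◁ evaluationMap y x₀ u

lemma whiskerLeft_descentRight {x : C} (hx : row s x) :
    x ◁ descentRight V y x₀ u ≫ (exchange₂ b hy hx (x₀ ⊗ u)).hom =
      (exchange₂ b hy hx _).hom ≫ V.obj ◁ x ◁ y ◁ x₀ ◁ evaluationMap y x₀ u :=
  exchange₂_naturality_right b hy hx _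

/-- After tensoring with `x` and moving `V` to the left, the parallel pair becomes `V ⊗ (x ⊗ -)`
applied to the two legs of the presentation of `u`. For this leg that is `exchange₂_evaluationMap`.
-/
lemma whiskerLeft_descentLeft {x : C} (hx : row s x) :
    x ◁ descentLeft b hy hx₀ u ≫ (exchange₂ b hy hx (x₀ ⊗ u)).hom =
      (exchange₂ b hy hx _).hom ≫ V.obj ◁ x ◁ evaluationMap y x₀ (y ⊗ (x₀ ⊗ u)) := by
  have h := exchange₂_evaluationMap b hy hx₀ hx (x₀ ⊗ u)
  rw [descentLeft, MonoidalCategory.whiskerLeft_comp, Category.assoc, ← h,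
    ← MonoidalCategory.whiskerLeft_comp_assoc, ← MonoidalCategory.whiskerLeft_comp,
    Iso.inv_hom_id]
  simp

lemma descentMap_condition {x : C} (hx : row s x) :
    x ◁ descentRight V y x₀ u ≫ descentMap b hy u hx =
      x ◁ descentLeft b hy hx₀ u ≫ descentMap b hy u hx := by
  rw [descentMap, reassoc_of% (whiskerLeft_descentRight b hy u hx),
    reassoc_of% (whiskerLeft_descentLeft b hy hx₀ u hx), ← MonoidalCategory.whiskerLeft_comp,
    ← MonoidalCategory.whiskerLeft_comp, evaluationMap_naturality]
  simp

/-- `V ⊗ (x ⊗ -)` preserves the presentation of `u`, and `exchange₂` identifies the image with the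
given cofork. -/
lemma nonempty_isColimit_descentMap [∀ A, Epi (evaluationMap y x₀ A)] {x : C} (hx : row s x) :
    Nonempty (IsColimit (Cofork.ofπ (f := x ◁ descentRight V y x₀ u)
      (g := x ◁ descentLeft b hy hx₀ u) (descentMap b hy u hx)
      (descentMap_condition b hy hx₀ u hx))) := by
  let ε : tensorLeft x₀ ⋙ tensorLeft y ⟶ 𝟭 C :=
    { app := fun A => evaluationMap y x₀ A
      naturality := fun _ _ f => evaluationMap_naturality y x₀ f }
  have hε : ∀ A, Epi (ε.app A) := fun A => inferInstanceAs (Epi (evaluationMap y x₀ A))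
  obtain ⟨hA⟩ := nonempty_isColimit_selfCofork ε hε u
  let G : C ⥤ C := tensorLeft x ⋙ tensorLeft V.obj
  have hG := isColimitCoforkMapOfIsColimit G _ hA
  let ev : V.obj ⊗ (x ⊗ (y ⊗ (x₀ ⊗ u))) ⟶ V.obj ⊗ (x ⊗ u) := V.obj ◁ x ◁ evaluationMap y x₀ u
  have desc {T : C} (k : V.obj ⊗ (x ⊗ (y ⊗ (x₀ ⊗ u))) ⟶ T)
      (hk : V.obj ◁ x ◁ y ◁ x₀ ◁ evaluationMap y x₀ u ≫ k =
        V.obj ◁ x ◁ evaluationMap y x₀ (y ⊗ (x₀ ⊗ u)) ≫ k) :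
      ∃ l : V.obj ⊗ (x ⊗ u) ⟶ T, ev ≫ l = k :=
    ⟨Cofork.IsColimit.desc hG k hk, Cofork.IsColimit.π_desc' hG k hk⟩
  have epi : Epi (descentMap b hy (x₀ := x₀) u hx) := by
    unfold descentMap
    infer_instance
  refine ⟨Cofork.IsColimit.ofExistsUnique fun t => ?_⟩
  have ht : x ◁ descentRight V y x₀ u ≫ t.π = x ◁ descentLeft b hy hx₀ u ≫ t.π := t.condition
  obtain ⟨l, hl⟩ := desc ((exchange₂ b hy hx (x₀ ⊗ u)).inv ≫ t.π) (by
    rw [← cancel_epi (exchange₂ b hy hx _).hom,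
      ← reassoc_of% (whiskerLeft_descentRight b hy u hx), Iso.hom_inv_id_assoc, ht,
      ← reassoc_of% (whiskerLeft_descentLeft b hy hx₀ u hx), Iso.hom_inv_id_assoc])
  have hl' : descentMap b hy u hx ≫ l = t.π := by
    change ((exchange₂ b hy hx (x₀ ⊗ u)).hom ≫ ev) ≫ l = _
    rw [Category.assoc, hl, Iso.hom_inv_id_assoc]
  exact ⟨l, hl', fun l' h' => (cancel_epi (descentMap b hy u hx)).1 (h'.trans hl'.symm)⟩

lemma descentMap_naturality {x x' : C} (hx : row s x) (hx' : row s x') (f : x ⟶ x') :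
    f ▷ _ ≫ descentMap b hy (x₀ := x₀) u hx' = descentMap b hy u hx ≫ V.obj ◁ f ▷ u := by
  rw [descentMap, descentMap, reassoc_of% (exchange₂_naturality_left b hy hx hx' f (x₀ ⊗ u)),
    Category.assoc, ← MonoidalCategory.whiskerLeft_comp, ← MonoidalCategory.whiskerLeft_comp,
    whisker_exchange]

lemma descentMap_tensor {c x : C} (hc : corner s s c) (hx : row s x) (h : row s (c ⊗ x)) :
    descentMap b hy (x₀ := x₀) u h = (α_ _ _ _).hom ≫ c ◁ descentMap b hy u hx ≫
      (exchange b hc (x ⊗ u)).hom ≫ V.obj ◁ (α_ _ _ _).inv := by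
  have h1 := exchange_naturality_right b hc (x ◁ evaluationMap y x₀ u)
  rw [descentMap, descentMap, exchange₂_tensor b hy hc hx h, MonoidalCategory.whiskerLeft_comp]
  simp only [Category.assoc]
  rw [reassoc_of% h1]
  simp

include hy hx₀ in
/-- Every central object of `e ⊗ C ⊗ e` acts on `e ⊗ C` as an object of `C` does. -/
lemma exists_centerRowIso [∀ A, Epi (evaluationMap y x₀ A)] :
    ∃ Z, Nonempty (CenterRowIso b Z) := by
  -- `x ⊗ -` preserves this coequalizer, and `nonempty_isColimit_descentMap` at `u = 𝟙_ C` computes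
  -- the result as `V ⊗ (x ⊗ 𝟙_ C)`.
  let Z := coequalizer (descentRight V y x₀ (𝟙_ C)) (descentLeft b hy hx₀ (𝟙_ C))
  let π : descentTarget V y x₀ (𝟙_ C) ⟶ Z := coequalizer.π _ _
  have hπ : Epi π := inferInstanceAs (Epi (coequalizer.π _ _))
  have hZ := coequalizerIsCoequalizer (descentRight V y x₀ (𝟙_ C)) (descentLeft b hy hx₀ (𝟙_ C))
  have ψ (x : C) (hx : row s x) :
      ∃ ψ : x ⊗ Z ≅ V.obj ⊗ (x ⊗ 𝟙_ C), x ◁ π ≫ ψ.hom = descentMap b hy (𝟙_ C) hx := by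
    obtain ⟨h⟩ := nonempty_isColimit_descentMap b hy hx₀ (𝟙_ C) hx
    have h' := isColimitCoforkMapOfIsColimit (tensorLeft x) _ hZ
    exact ⟨IsColimit.coconePointUniqueUpToIso h' h,
      IsColimit.comp_coconePointUniqueUpToIso_hom h' h WalkingParallelPair.one⟩
  choose ψ hψ using ψ
  have nat {x x' : C} (hx : row s x) (hx' : row s x') (f : x ⟶ x') :
      f ▷ Z ≫ (ψ x' hx').hom = (ψ x hx).hom ≫ V.obj ◁ f ▷ 𝟙_ C := by
    rw [← cancel_epi (x ◁ π), whisker_exchange_assoc, hψ, reassoc_of% hψ,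
      descentMap_naturality b hy _ hx hx']
  have tens {c x : C} (hc : corner s s c) (hx : row s x) (h : row s (c ⊗ x)) :
      (ψ (c ⊗ x) h).hom = (α_ _ _ _).hom ≫ c ◁ (ψ x hx).hom ≫
        (exchange b hc (x ⊗ 𝟙_ C)).hom ≫ V.obj ◁ (α_ _ _ _).inv := by
    rw [← cancel_epi ((c ⊗ x) ◁ π), hψ, descentMap_tensor b hy _ hc hx,
      associator_naturality_right_assoc, ← MonoidalCategory.whiskerLeft_comp_assoc, hψ]
  refine ⟨Z, ⟨{
    iso := fun x hx => whiskerLeftIso _ (ρ_ x).symm ≪≫ (ψ x hx).symm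
    naturality := fun {x x'} hx hx' f => ?_
    left := fun {c x} hc hx h => ?_ }⟩⟩
  · have h1 : V.obj ◁ f ▷ 𝟙_ C ≫ (ψ x' hx').inv = (ψ x hx).inv ≫ f ▷ Z := by
      rw [Iso.eq_inv_comp, ← reassoc_of% (nat hx hx' f), Iso.hom_inv_id, Category.comp_id]
    simp only [Iso.trans_hom, whiskerLeftIso_hom, Iso.symm_hom, Category.assoc]
    rw [← h1, ← MonoidalCategory.whiskerLeft_comp_assoc, ← MonoidalCategory.whiskerLeft_comp_assoc,
      rightUnitor_inv_naturality]
  · have h1 : (ψ (c ⊗ x) h).inv = V.obj ◁ (α_ _ _ _).hom ≫ (exchange b hc (x ⊗ 𝟙_ C)).inv ≫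
        c ◁ (ψ x hx).inv ≫ (α_ _ _ _).inv := by
      rw [← cancel_epi (ψ (c ⊗ x) h).hom, Iso.hom_inv_id, tens hc hx h]
      simp
    have h2 : (exchange b hc (x ⊗ 𝟙_ C)).inv =
        (α_ _ _ _).inv ≫ (cornerBraiding b hc).hom ▷ (x ⊗ 𝟙_ C) ≫ (α_ _ _ _).hom := by
      simp [exchange]
    simp only [Iso.trans_hom, whiskerLeftIso_hom, Iso.symm_hom, Category.assoc]
    rw [h1, h2]
    monoidal

end Descent

end CenterRowIso

end UnitSummand

/-! ### Assembly of the center equivalence and of the theorem. -/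

namespace UnitDecomposition

lemma exists_center_equivalence {C : Type u} [Category.{v} C]
    [Abelian C] [MonoidalCategory C] [MonoidalPreadditive C] [RigidCategory C]
    {Λ : Type u₁} [Finite Λ] (d : UnitDecomposition C Λ)
    (h : ∀ i j, IsNonzeroCategory (d.Block i j)) (i : Λ) :
    ∃ (F : Center C ⥤ Center (d.Block i i)) (_ : F.Braided),
          F.IsEquivalence ∧ Nonempty (CenterIntertwiner (d.RowBlock i) F) := by
  -- The same object that makes the row invertible, with its left dual in the role of `x₀`.
  obtain ⟨y, hy, hε⟩ := d.exists_column_epi_evaluation h i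
  have hx₀ := (UnitSummand.row_iff_column_dual (ᘁy) y (d.summand i)).2 hy
  have hε' (A : C) : Epi (UnitSummand.evaluationMap y (ᘁy) A) :=
    UnitSummand.epi_evaluationMap _ _ inferInstance
  have := UnitSummand.faithful_centerTruncation (y := y) hx₀
  have := UnitSummand.full_centerTruncation hy hx₀
  have := UnitSummand.essSurj_centerTruncation hy hx₀
    fun V => UnitSummand.exists_centerRowIso V.2 hy hx₀
  exact ⟨UnitSummand.centerTruncation (d.summand i), UnitSummand.centerBraided (d.summand i), { },
    ⟨UnitSummand.centerIntertwiner (d.summand i)⟩⟩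

end UnitDecomposition

theorem theorem2p31 {k : Type w} [Field k] {C : Type u} [Category.{v} C] [Preadditive C]
    [Linear k C] [MonoidalCategory C] [IsMultiTensorCategory k C] :
    -- the unit object is semisimple
    (∃ n : ℕ, Nonempty (UnitDecomposition C (Fin n))) ∧
    ∀ {Λ : Type u₁} [Finite Λ] (d : UnitDecomposition C Λ),
      -- `e_i ⊗ e_i ≅ e_i`, `e_i ≅ e_i^R` (for any right dual `r`), and `e_i ⊗ e_j ≅ 0`
      (∀ i, Nonempty (d.e i ⊗ d.e i ≅ d.e i) ∧
        ∀ (r : C) [ExactPairing r (d.e i)], Nonempty (d.e i ≅ r)) ∧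
      (∀ i j, i ≠ j → IsZero (d.e i ⊗ d.e j)) ∧
      -- `X ↦ (e_i ⊗ X ⊗ e_j)` is a `k`-linear equivalence onto the direct sum of the `C_ij`
      ((Functor.pi' fun p : Λ × Λ =>
          UnitSummand.toCorner (d.summand p.1) (d.summand p.2)).IsEquivalence ∧
        ∀ i j, (UnitSummand.toCorner (d.summand i) (d.summand j)).Additive ∧
          (UnitSummand.toCorner (d.summand i) (d.summand j)).Linear k) ∧
      -- `C_ij ⊗ C_jl ⊆ C_il`
      (∀ (i j l : Λ) (X Y : C), UnitSummand.corner (d.summand i) (d.summand j) X →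
        UnitSummand.corner (d.summand j) (d.summand l) Y →
        UnitSummand.corner (d.summand i) (d.summand l) (X ⊗ Y)) ∧
      (IsIndecomposableMultiTensor k C →
        -- every `C_ij` is nonzero
        (∀ i j, IsNonzeroCategory (d.Block i j)) ∧
        -- the tensor product of `C` exhibits `C_il` as the bimodule `C_ij ⊠ C_jl` over `C_jj`
        (∀ i j l, BalancedBimoduleFunctor.IsTensorProduct.{u', v'}
          (UnitSummand.cornerTensor (IsMultiTensorCategory.rightExact_tensorLeft k)
            (IsMultiTensorCategory.rightExact_tensorRight k)
            (d.summand i) (d.summand j) (d.summand l))) ∧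
        -- `C_ij` is an invertible `C_ii`-`C_jj`-bimodule
        (∀ i j, IsInvertibleBimodule.{u', v'} (d.Block i i) (d.Block j j) (d.Block i j)) ∧
        -- `e_i ⊗ C`, the direct sum of the `C_ij` over `j`, is an invertible `C_ii`-`C`-bimodule
        (∀ i, (Functor.pi' fun j =>
            UnitSummand.rowToCorner (d.summand i) (d.summand j)).IsEquivalence ∧
          IsInvertibleBimodule.{u', v'} (d.Block i i) C (d.RowBlock i)) ∧
        -- the canonical braided equivalence `Z(C) ≃ Z(C_ii)`, intertwining the two actions
        -- on the bimodule `e_i ⊗ C`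
        (∀ i, ∃ (F : Center C ⥤ Center (d.Block i i)) (_ : F.Braided),
          F.IsEquivalence ∧ Nonempty (CenterIntertwiner (d.RowBlock i) F))) := by
  have hC := ‹IsMultiTensorCategory k C›
  have hl := hC.rightExact_tensorLeft
  have hr := hC.rightExact_tensorRight
  -- Substituting the equation makes the given preadditive structure the one underlying the abelian
  -- structure, so that the linear and monoidal hypotheses apply to it.
  obtain ⟨a, ha⟩ := hC.finite.exists_abelian
  subst ha
  have hfin := hC.finite.finite_hom
  have : MonoidalPreadditive C := hC.toMonoidalPreadditive
  have : MonoidalLinear k C := hC.toMonoidalLinear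
  have : RigidCategory C := hC.rigid.some
  refine ⟨UnitSemisimple.exists_unitDecomposition hfin, fun {Λ} _ d =>
    ⟨fun i => ⟨⟨UnitSummand.leftIso _ (UnitSummand.row_self (d.summand i))⟩, fun r hr => ?_⟩,
      fun i j h => d.isZero_tensor h,
      ⟨have := Abelian.hasFiniteBiproducts (C := C); d.isEquivalence_toCorner, fun i j => ⟨?_, ?_⟩⟩,
      fun i j l X Y hX hY => UnitSummand.corner_tensor hX hY, fun hind => ?_⟩⟩
  -- Duals are unique, and `e i` is dual to itself.
  · have := UnitSummand.exactPairingSelf (d.summand i)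
    exact ⟨leftDualIso ‹ExactPairing (d.e i) (d.e i)› hr⟩
  · exact { map_add := by intros; ext; simp [UnitSummand.toCorner]; rfl }
  · exact { map_smul := by intros; ext; simp [UnitSummand.toCorner]; rfl }
  · have hne : ∀ i j, IsNonzeroCategory (d.Block i j) := d.isNonzeroCategory_block hind
    exact ⟨hne, d.isTensorProduct_cornerTensor _ _ hne, d.isInvertibleBimodule_block hl hr hne,
      fun i => ⟨have := Abelian.hasFiniteBiproducts (C := C); d.isEquivalence_rowToCorner i, d.isInvertibleBimodule_rowBlock hl hr hne i⟩,
      fun i => d.exists_center_equivalence hne i⟩
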